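/- Let $n\ge 3$, let $\omega_n$ be the volume of the unit ball of $\mathbb R^n$, $B_r(y)$ the open ball of radius $r$ about $y$ (the empty set if $r\le 0$), and $h(x)=\frac{1}{n(n-2)\omega_n}\,|x|^{-(n-2)}$ for $x\neq 0$. For a bounded set $A\subset\mathbb R^n$ let $$\mathrm{cap}(A)=\inf\Big\{\int_{\mathbb R^n}|\nabla u|^2\,dx\;;\;u\in H^1(\mathbb R^n),\ u\ge 1\text{ on }A,\ \lim_{|x|\to\infty}u(x)=0\Big\},$$ where "$u\ge 1$ on $A$" means that $u\ge 1$ on some open set containing $A$, and let $\varphi_A$ be its capacitary potential, $$\varphi_A(x)=\inf\{v(x)\;;\;v\text{ superharmonic on }\mathbb R^n,\ v\ge1\text{ on }A,\ \lim_{|y|\to\infty}v(y)=0\}.$$ (i) Let $S\subset B_M(0)$. Then $\varphi_S$ is harmonic in $\mathbb R^n\setminus\overline S$, $\varphi_S=1$ on $S$, and $\varphi_S(x)\to0$ as $|x|\to\infty$. (ii) For all $M\in\mathbb R$ and $\delta>0$ there is $R>0$, depending only on $\delta$, $M$ (and $n$), such that both of the following hold. (a) For every set $S\subset B_M(0)$,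 with $\gamma=\mathrm{cap}(S)$, $$|\varphi_S(x)-\gamma\,h(x)|\le\delta\,h(x)\qquad\text{whenever }|x|\ge R.$$ (b) Put $a^\varepsilon(r)=r\,\varepsilon^{n/(n-2)}$. Let $\Omega$ be any set, $S_\varepsilon(k,\omega)\subset\mathbb R^n$ a family of sets indexed by $\varepsilon>0$, $k\in\mathbb Z^n$, $\omega\in\Omega$, and $\gamma:\mathbb Z^n\times\Omega\to\mathbb R$. For all $\varepsilon>0$, $k$ and $\omega$ such that $S_\varepsilon(k,\omega)\subset B_{a^\varepsilon(M)}(\varepsilon k)$ and $\mathrm{cap}(S_\varepsilon(k,\omega))=\varepsilon^n\gamma(k,\omega)$, $$|\varphi_{S_\varepsilon(k,\omega)}(x)-\varepsilon^n\gamma(k,\omega)\,h(x-\varepsilon k)|\le\delta\,\varepsilon^n\,h(x-\varepsilon k)\qquad\text{whenever }|x-\varepsilon k|\ge a^\varepsilon(R).$$ In particular $R$ does not depend on $\varepsilon$, $k$, $\omega$ or on the sets. -/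

import Mathlib

open MeasureTheory Filter Topology Set

noncomputable section

namespace CapPot

/-- `ℝⁿ` with its Euclidean norm. -/
abbrev Rn (n : ℕ) : Type := EuclideanSpace ℝ (Fin n)

/-- The fundamental solution `h(x) = 1 / (n (n-2) ω_n |x|^{n-2})` of `-Δ` in `ℝⁿ`, `n ≥ 3`
(and `x ≠ 0`), where `ω_n` is the volume of the unit ball. -/
def fundSol (n : ℕ) (x : Rn n) : ℝ :=
  1 / ((n : ℝ) * ((n : ℝ) - 2) * (volume (Metric.ball (0 : Rn n) 1)).toReal) *
    (1 / ‖x‖ ^ (n - 2))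

/-- `G` is the weak gradient of `u` on the whole of `ℝⁿ`. -/
def IsWeakGradient {n : ℕ} (u : Rn n → ℝ) (G : Rn n → Rn n) : Prop :=
  ∀ ψ : Rn n → ℝ, ContDiff ℝ ((⊤ : ℕ∞) : WithTop ℕ∞) ψ → HasCompactSupport ψ → ∀ e : Rn n,
    ∫ x, u x * fderiv ℝ ψ x e = - ∫ x, ψ x * inner ℝ (G x) e

/-- `u` is (a representative of) a function of `H¹(ℝⁿ)` with weak gradient `G`. -/
structure IsH1With {n : ℕ} (u : Rn n → ℝ) (G : Rn n → Rn n) : Prop where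
  memLp : MemLp u 2 volume
  memLp_grad : MemLp G 2 volume
  weakGrad : IsWeakGradient u G

/-- The capacity of a set `A ⊆ ℝⁿ`, `n ≥ 3`: the infimum of `∫ |∇u|²` over the functions `u` of
`H¹(ℝⁿ)` that tend to `0` at infinity and are `≥ 1` on `A`. Elements of `H¹` are only defined almost
everywhere, so that, as usual for the variational capacity of an arbitrary set, `u ≥ 1` on `A`
means that (some representative of) `u` is `≥ 1` on an open set that contains `A`. -/
def cap {n : ℕ} (A : Set (Rn n)) : ℝ :=
  sInf {c : ℝ | ∃ (u : Rn n → ℝ) (G : Rn n → Rn n), IsH1With u G ∧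
    (∃ U : Set (Rn n), IsOpen U ∧ A ⊆ U ∧ ∀ x ∈ U, 1 ≤ u x) ∧
    Tendsto u (Bornology.cobounded (Rn n)) (𝓝 0) ∧
    c = ∫ x, ‖G x‖ ^ 2}

/-- `Δ v ≤ 0` on `ℝⁿ` for an everywhere defined function: `v` is superharmonic in the classical
sense, i.e. lower semicontinuous, locally integrable, and at each point at least as large as its
mean over each ball centred there. For functions of class `C²` this is the pointwise inequality. -/
structure Superharmonic {n : ℕ} (v : Rn n → ℝ) : Prop where
  lsc : LowerSemicontinuous v
  locInt : LocallyIntegrable v volume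
  mean_le : ∀ (x : Rn n) (r : ℝ), 0 < r → ⨍ y in Metric.ball x r, v y ≤ v x

/-- The competitors for the capacitary potential of `S`: `Δ v ≤ 0`, `v ≥ 1` on `S`, and `v → 0` at
infinity. (Superharmonic functions with the value `+∞` would not change the infimum, since
`min v 1` is a competitor whenever `v` is.) -/
structure IsCompetitor {n : ℕ} (S : Set (Rn n)) (v : Rn n → ℝ) : Prop where
  superharmonic : Superharmonic v
  one_le : ∀ x ∈ S, 1 ≤ v x
  tendsto_zero : Tendsto v (Bornology.cobounded (Rn n)) (𝓝 0)

/-- The capacitary potential of `S`: the pointwise infimum of the competitors. -/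
def potential {n : ℕ} (S : Set (Rn n)) (x : Rn n) : ℝ :=
  sInf {t : ℝ | ∃ v : Rn n → ℝ, IsCompetitor S v ∧ t = v x}

/-- The point `ε k` of the lattice `ε ℤⁿ`. -/
def latticePt {n : ℕ} (ε : ℝ) (k : Fin n → ℤ) : Rn n :=
  WithLp.toLp 2 (fun i => ε * (k i : ℝ))

/-- The critical radius `a^ε(r) = r ε^{n/(n-2)}`. -/
def critRadius (n : ℕ) (ε r : ℝ) : ℝ :=
  r * ε ^ ((n : ℝ) / ((n : ℝ) - 2))

end CapPot

end

/-! The potential of a bounded open set `U` is superharmonic and its Riesz mass sits on the closure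
of `U`. Far away it is the Newton potential of that mass, hence close to the total mass times
`fundSol`, and the total mass is the capacity. All of this is carried out on the mollifications
`moll ε (potential U)`: the Riesz measure is replaced by the smooth density `mollMass U ε`, so that
no distribution theory enters.

One formula drives the potential theory. If `∇Q = -y η` weakly, then the derivative in `r` of `∫ u
(x + r y) η(y) dy` equals `r ∫ Δu (x + r y) Q(y) dy` (`MeanPair.hasDerivAt`). It gives the
monotonicity of means of superharmonic functions, the fundamental solution (by integrating over all
radii, `integral_fundSol_mul_lap`), and the comparison between the mass of `-Δu` and the defect in
the mean value property.

Harmonicity off the closure of an open `U` is a sweeping argument. Spreading out the mass of `moll ε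
(potential U)` near `x₀` (`exists_sweep`) lowers the function at `x₀` in proportion to that mass,
and in the limit `ε → 0` still produces a competitor. Minimality of the potential forces the mass to
vanish (`tendsto_integral_lap_moll`). An arbitrary set `S` is approximated from outside by open sets
(`exists_open_potential_le`), with Harnack's inequality giving locally uniform convergence
(`harmonicAt_potential`).

For open `U` inside a fixed ball the potential is at most `1`, which bounds the total mass a priori.
Hence the error in the expansion at infinity is controlled uniformly in `U`
(`exists_uniform_radius`). The mass, called the flux, equals the capacity. Truncated potentials are
admissible in the definition of `cap` with energy close to the flux (`cap_le_flux`). Conversely,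
testing an admissible `u` against the mollified potential gives `m ≤ m / 2 + E / 2` up to errors,
where `m` is the flux and `E` the energy of `u` (`flux_le_energy`).

A general `S` has an open neighbourhood that is nearly optimal both for the capacity and for the
potential at a given point; the radius does not depend on this choice. Part (b) follows by dilation,
since capacity scales like `a ^ (n - 2)`. -/

set_option linter.unusedSectionVars false

/-! ### Smooth calculus in coordinates and the derivative of weighted means. -/

namespace CapPot
open scoped ContDiff

variable {n : ℕ}

/-! ### Partial derivatives and the Laplacian -/

/-- The `i`-th standard basis vector. -/
noncomputable abbrev stdVec (i : Fin n) : Rn n := EuclideanSpace.single i (1 : ℝ)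

/-- The `i`-th partial derivative. -/
noncomputable def pd (i : Fin n) (u : Rn n → ℝ) (x : Rn n) : ℝ := fderiv ℝ u x (stdVec i)

/-- The Laplacian as the sum of the pure second partial derivatives. -/
noncomputable def lap (u : Rn n → ℝ) (x : Rn n) : ℝ := ∑ i, pd i (pd i u) x

theorem fderiv_apply_eq_sum (u : Rn n → ℝ) (x y : Rn n) :
    fderiv ℝ u x y = ∑ i, y i * pd i u x := by
  have h : y = ∑ i, y i • (stdVec i : Rn n) := by
    have := (EuclideanSpace.basisFun (Fin n) ℝ).sum_repr y
    simpa using this.symm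
  conv_lhs => rw [h]
  simp [map_sum, pd]

theorem contDiff_pd {u : Rn n → ℝ} (hu : ContDiff ℝ ∞ u) (i : Fin n) : ContDiff ℝ ∞ (pd i u) :=
  (hu.fderiv_right (m := ∞) (by simp)).clm_apply contDiff_const

theorem contDiff_lap {u : Rn n → ℝ} (hu : ContDiff ℝ ∞ u) : ContDiff ℝ ∞ (lap u) :=
  ContDiff.sum fun i _ => contDiff_pd (contDiff_pd hu i) i

theorem differentiable_of_smooth {u : Rn n → ℝ} (hu : ContDiff ℝ ∞ u) : Differentiable ℝ u :=
  hu.differentiable (by simp)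

theorem pd_sub {u v : Rn n → ℝ} (hu : ContDiff ℝ ∞ u) (hv : ContDiff ℝ ∞ v) (i : Fin n) :
    pd i (fun x => u x - v x) = fun x => pd i u x - pd i v x := by
  ext x
  simp [pd, fderiv_fun_sub (differentiable_of_smooth hu x) (differentiable_of_smooth hv x)]

theorem pd_mul {u v : Rn n → ℝ} (hu : ContDiff ℝ ∞ u) (hv : ContDiff ℝ ∞ v) (i : Fin n) :
    pd i (fun x => u x * v x) = fun x => u x * pd i v x + v x * pd i u x := by
  ext x
  simp [pd, fderiv_fun_mul (differentiable_of_smooth hu x) (differentiable_of_smooth hv x)]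

theorem pd_const_mul {u : Rn n → ℝ} (hu : ContDiff ℝ ∞ u) (c : ℝ) (i : Fin n) :
    pd i (fun x => c * u x) = fun x => c * pd i u x := by
  ext x
  simp [pd, fderiv_const_mul (differentiable_of_smooth hu x)]

theorem lap_sub {u v : Rn n → ℝ} (hu : ContDiff ℝ ∞ u) (hv : ContDiff ℝ ∞ v) :
    lap (fun x => u x - v x) = fun x => lap u x - lap v x := by
  ext x
  simp only [lap, pd_sub hu hv, pd_sub (contDiff_pd hu _) (contDiff_pd hv _),
    Finset.sum_sub_distrib]

theorem lap_const_mul {u : Rn n → ℝ} (hu : ContDiff ℝ ∞ u) (c : ℝ) :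
    lap (fun x => c * u x) = fun x => c * lap u x := by
  ext x
  simp only [lap, pd_const_mul hu, pd_const_mul (contDiff_pd hu _), Finset.mul_sum]

theorem pd_comp_add_smul {u : Rn n → ℝ} (hu : ContDiff ℝ ∞ u) (x : Rn n) (r : ℝ) (i : Fin n) :
    pd i (fun y => u (x + r • y)) = fun y => r * pd i u (x + r • y) := by
  ext y
  have h1 : HasFDerivAt (fun y : Rn n => x + r • y) (r • ContinuousLinearMap.id ℝ (Rn n)) y :=
    ((hasFDerivAt_id y).const_smul r).const_add x
  have h2 := ((differentiable_of_smooth hu (x + r • y)).hasFDerivAt).comp y h1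
  have h3 : fderiv ℝ (fun y => u (x + r • y)) y = _ := h2.fderiv
  simp [pd, h3]

theorem pd_congr {u v : Rn n → ℝ} {x : Rn n} (h : u =ᶠ[𝓝 x] v) (i : Fin n) :
    pd i u =ᶠ[𝓝 x] pd i v := by
  filter_upwards [h.eventuallyEq_nhds] with y hy
  simp [pd, hy.fderiv_eq]

theorem lap_congr {u v : Rn n → ℝ} {x : Rn n} (h : u =ᶠ[𝓝 x] v) : lap u x = lap v x := by
  simp only [lap]
  exact Finset.sum_congr rfl fun i _ => (pd_congr (pd_congr h i) i).eq_of_nhds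

theorem pd_zero_fun (i : Fin n) : pd i (fun _ : Rn n => (0 : ℝ)) = fun _ => 0 := by
  ext x; simp [pd]

theorem lap_eq_zero_of_eventually_zero {u : Rn n → ℝ} {x : Rn n} (h : u =ᶠ[𝓝 x] fun _ => 0) :
    lap u x = 0 := by
  rw [lap_congr h]; simp [lap, pd_zero_fun]

theorem hasCompactSupport_pd {u : Rn n → ℝ} (h : HasCompactSupport u) (i : Fin n) :
    HasCompactSupport (pd i u) := h.fderiv_apply ℝ (stdVec i)

theorem hasCompactSupport_lap {u : Rn n → ℝ} (h : HasCompactSupport u) :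
    HasCompactSupport (lap u) := by
  refine HasCompactSupport.of_support_subset_isCompact h (fun x hx => ?_)
  by_contra hx'
  exact hx (lap_eq_zero_of_eventually_zero (notMem_tsupport_iff_eventuallyEq.1 hx'))

theorem laplacian_eq_lap {u : Rn n → ℝ} {x : Rn n} (hu : ContDiffAt ℝ 2 u x) :
    Laplacian.laplacian u x = lap u x := by
  rw [InnerProductSpace.laplacian_eq_iteratedFDeriv_orthonormalBasis u
    (EuclideanSpace.basisFun (Fin n) ℝ)]
  simp only [lap]
  refine Finset.sum_congr rfl fun i _ => ?_
  rw [iteratedFDeriv_two_apply]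
  have hd : DifferentiableAt ℝ (fderiv ℝ u) x :=
    (hu.fderiv_right (m := 1) (by norm_num)).differentiableAt (by norm_num)
  have : fderiv ℝ (pd i u) x = _ := fderiv_clm_apply hd (differentiableAt_const (stdVec i))
  simp [pd] at this ⊢
  have h2 : fderiv ℝ (fun y => fderiv ℝ u y (stdVec i)) x = fderiv ℝ (pd i u) x := rfl
  rw [this]
  simp

/-- Integration by parts. -/
theorem integral_pd_mul {u g : Rn n → ℝ} (hu : ContDiff ℝ ∞ u) (hg : ContDiff ℝ ∞ g)
    (hc : HasCompactSupport g) (i : Fin n) :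
    ∫ x, pd i u x * g x = - ∫ x, u x * pd i g x := by
  have := integral_mul_fderiv_eq_neg_fderiv_mul_of_integrable (μ := (volume : Measure (Rn n)))
    (f := u) (g := g) (v := stdVec i)
    (((contDiff_pd hu i).continuous.mul hg.continuous).integrable_of_hasCompactSupport hc.mul_left)
    ((hu.continuous.mul (contDiff_pd hg i).continuous).integrable_of_hasCompactSupport
      (hasCompactSupport_pd hc i).mul_left)
    ((hu.continuous.mul hg.continuous).integrable_of_hasCompactSupport hc.mul_left)
    (fun x _ => differentiable_of_smooth hu x) (fun x _ => differentiable_of_smooth hg x)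
  simp only [pd]
  linarith

/-! ### Radial averages -/

/-- `Q` is a potential of the field `-y η(y)`, in the weak sense. Both functions live on the closed
unit ball. -/
structure MeanPair (η Q : Rn n → ℝ) : Prop where
  meas : Measurable η
  meas' : Measurable Q
  bdd : ∃ C, ∀ y, |η y| ≤ C
  bdd' : ∃ C, ∀ y, |Q y| ≤ C
  supp : ∀ y, 1 < ‖y‖ → η y = 0
  supp' : ∀ y, 1 < ‖y‖ → Q y = 0
  nonneg : ∀ y, 0 ≤ η y
  nonneg' : ∀ y, 0 ≤ Q y
  ibp : ∀ g : Rn n → ℝ, ContDiff ℝ ∞ g → ∀ i, ∫ y, pd i g y * Q y = ∫ y, g y * (y i * η y)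

/-- The mean of `u` at `x`, at scale `r`, with weight `η`. -/
noncomputable def wmean (η u : Rn n → ℝ) (x : Rn n) (r : ℝ) : ℝ := ∫ y, u (x + r • y) * η y

theorem integrable_of_bdd_supp {f : Rn n → ℝ} (hf : AEStronglyMeasurable f volume) {C ρ : ℝ}
    (hb : ∀ y, |f y| ≤ C) (hs : ∀ y, ρ < ‖y‖ → f y = 0) : Integrable f := by
  have h : IntegrableOn f (Metric.closedBall 0 ρ) :=
    Measure.integrableOn_of_bounded (M := C) (isCompact_closedBall (0 : Rn n) ρ).measure_lt_top.ne
      hf (Eventually.of_forall hb)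
  refine (integrableOn_iff_integrable_of_support_subset fun y hy => ?_).1 h
  by_contra hy'
  exact hy (hs y (by simpa using hy'))

/-- A function that is bounded on the unit ball times a weight supported there. -/
theorem integrable_mul_weight {f η : Rn n → ℝ} (hf : Measurable f) (hm : Measurable η)
    {C K : ℝ} (hC : ∀ y, ‖y‖ ≤ 1 → |f y| ≤ C) (hK : ∀ y, |η y| ≤ K)
    (hs : ∀ y, 1 < ‖y‖ → η y = 0) : Integrable fun y => f y * η y := by
  refine integrable_of_bdd_supp (C := C * K) (ρ := 1) (hf.mul hm).aestronglyMeasurable ?_ ?_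
  · intro y
    by_cases hy : 1 < ‖y‖
    · rw [hs y hy, mul_zero, abs_zero]
      exact mul_nonneg ((abs_nonneg _).trans (hC 0 (by simp))) ((abs_nonneg _).trans (hK 0))
    · rw [abs_mul]
      exact mul_le_mul (hC y (not_lt.1 hy)) (hK y) (abs_nonneg _)
        ((abs_nonneg _).trans (hC y (not_lt.1 hy)))
  · intro y hy
    simp [hs y hy]

theorem MeanPair.integrable_mul {η Q : Rn n → ℝ} (h : MeanPair η Q) {f : Rn n → ℝ}
    (hf : Continuous f) : Integrable fun y => f y * η y := by
  obtain ⟨K, hK⟩ := h.bdd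
  obtain ⟨C, hC⟩ := (isCompact_closedBall (0 : Rn n) 1).exists_bound_of_continuousOn hf.continuousOn
  exact integrable_mul_weight hf.measurable h.meas (fun y hy => hC y (by simpa using hy)) hK h.supp

theorem MeanPair.integrable_mul' {η Q : Rn n → ℝ} (h : MeanPair η Q) {f : Rn n → ℝ}
    (hf : Continuous f) : Integrable fun y => f y * Q y := by
  obtain ⟨K, hK⟩ := h.bdd'
  obtain ⟨C, hC⟩ := (isCompact_closedBall (0 : Rn n) 1).exists_bound_of_continuousOn hf.continuousOn
  exact integrable_mul_weight hf.measurable h.meas' (fun y hy => hC y (by simpa using hy)) hK h.supp'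

/-- Differentiation under the integral produces `∇u(x + r y) · y η(y)`; moving the field `y η` onto
its potential `Q` by `ibp`, applied to each partial derivative of `u`, turns the gradient into the
Laplacian and releases a factor `r`. -/
theorem MeanPair.hasDerivAt {η Q : Rn n → ℝ} (h : MeanPair η Q) {u : Rn n → ℝ}
    (hu : ContDiff ℝ ∞ u) (x : Rn n) (r : ℝ) :
    HasDerivAt (wmean η u x) (r * ∫ y, lap u (x + r • y) * Q y) r := by
  have hcont : ∀ s : ℝ, Continuous fun y : Rn n => x + s • y := fun s => by fun_prop
  have hdc : Continuous (fderiv ℝ u) := hu.continuous_fderiv (by simp)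
  obtain ⟨C, hC⟩ := (isCompact_closedBall x (|r| + 1)).exists_bound_of_continuousOn
    (f := fderiv ℝ u) hdc.continuousOn
  have hC0 : 0 ≤ C := (norm_nonneg _).trans
    (hC x (Metric.mem_closedBall_self (by positivity)))
  have key := (hasDerivAt_integral_of_dominated_loc_of_deriv_le (μ := (volume : Measure (Rn n)))
    (F := fun s y => u (x + s • y) * η y) (F' := fun s y => fderiv ℝ u (x + s • y) y * η y)
    (x₀ := r) (s := Metric.ball r 1) (bound := fun y => C * |η y|)
    (Metric.ball_mem_nhds r one_pos)
    (Eventually.of_forall fun s =>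
      ((hu.continuous.comp (hcont s)).measurable.mul h.meas).aestronglyMeasurable)
    (h.integrable_mul (hu.continuous.comp (hcont r)))
    ((((hdc.comp (hcont r)).clm_apply continuous_id).measurable.mul h.meas).aestronglyMeasurable)
    (Eventually.of_forall fun y s hs => ?_)
    ?_
    (Eventually.of_forall fun y s hs => ?_)).2
  · refine key.congr_deriv ?_
    have h1 : ∀ y : Rn n, fderiv ℝ u (x + r • y) y * η y
        = ∑ i, pd i u (x + r • y) * (y i * η y) := fun y => by
      rw [fderiv_apply_eq_sum, Finset.sum_mul]
      exact Finset.sum_congr rfl fun i _ => by ring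
    have hsm : ∀ i, ContDiff ℝ ∞ fun y : Rn n => pd i u (x + r • y) := fun i =>
      (contDiff_pd hu i).comp (contDiff_const.add (contDiff_id.const_smul r))
    have h2 : ∀ i, ∫ y, pd i u (x + r • y) * (y i * η y)
        = r * ∫ y, pd i (pd i u) (x + r • y) * Q y := fun i => by
      rw [← h.ibp _ (hsm i) i, pd_comp_add_smul (contDiff_pd hu i), ← integral_const_mul]
      exact integral_congr_ae (Eventually.of_forall fun y => by simp only; ring)

    calc ∫ y, fderiv ℝ u (x + r • y) y * η y
        = ∫ y, ∑ i, pd i u (x + r • y) * (y i * η y) :=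
          integral_congr_ae (Eventually.of_forall h1)
      _ = r * ∫ y, lap u (x + r • y) * Q y := ?_
    rw [integral_finsetSum]
    · simp_rw [h2, lap, Finset.sum_mul]
      rw [integral_finsetSum, Finset.mul_sum]
      intro i _
      exact h.integrable_mul' ((contDiff_pd (contDiff_pd hu i) i).continuous.comp (hcont r))
    · intro i _
      have : Continuous fun y : Rn n => pd i u (x + r • y) * y i := by
        exact (hsm i).continuous.mul (by fun_prop)
      refine (h.integrable_mul this).congr (Eventually.of_forall fun y => ?_)
      simp only; ring
  · by_cases hy : 1 < ‖y‖
    · simp [h.supp y hy]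
    · rw [norm_mul, Real.norm_eq_abs (η y)]
      refine mul_le_mul_of_nonneg_right ?_ (abs_nonneg _)
      have hmem : x + s • y ∈ Metric.closedBall x (|r| + 1) := by
        rw [mem_closedBall_iff_norm, add_sub_cancel_left, norm_smul]
        have h1 : |s| ≤ |r| + 1 := by
          have := Metric.mem_ball.1 hs
          rw [Real.dist_eq] at this
          have := abs_sub_abs_le_abs_sub s r
          linarith
        calc ‖s‖ * ‖y‖ ≤ (|r| + 1) * 1 :=
              mul_le_mul h1 (not_lt.1 hy) (norm_nonneg _) (by positivity)
          _ = _ := mul_one _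
      calc ‖fderiv ℝ u (x + s • y) y‖ ≤ ‖fderiv ℝ u (x + s • y)‖ * ‖y‖ :=
            ContinuousLinearMap.le_opNorm _ _
        _ ≤ C * 1 := mul_le_mul (hC _ hmem) (not_lt.1 hy) (norm_nonneg _) hC0
        _ = C := mul_one _
  · have := h.integrable_mul (f := fun _ => (1 : ℝ)) continuous_const
    simp only [one_mul] at this
    exact this.abs.const_mul C
  · have h1 : HasDerivAt (fun s : ℝ => x + s • y) y s := by
      simpa using ((hasDerivAt_id s).smul_const y).const_add x
    have h2 := ((differentiable_of_smooth hu (x + s • y)).hasFDerivAt).comp_hasDerivAt s h1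
    exact h2.mul_const (η y)

end CapPot

/-! ### Two concrete mean pairs: a sharp one for means over balls, a smooth one for mollification.
-/

namespace CapPot
open scoped ContDiff

variable {n : ℕ}

/-! ### The two weights: the unit ball and a smooth bump -/

/-- The indicator function of the unit ball. -/
noncomputable def ballWt (n : ℕ) (y : Rn n) : ℝ := (Metric.ball (0 : Rn n) 1).indicator 1 y

/-- The potential of the unit ball. -/
noncomputable def ballPot (n : ℕ) (y : Rn n) : ℝ := (1 - (min ‖y‖ 1) ^ 2) / 2

/-- The potential of the ball has a kink on the unit sphere; Lipschitz regularity is what makes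
integration by parts against it legitimate. -/
theorem lipschitzWith_ballPot : LipschitzWith 1 (ballPot n) := by
  refine LipschitzWith.of_dist_le_mul fun y z => ?_
  have h0 := le_min (norm_nonneg y) zero_le_one
  have h0' := le_min (norm_nonneg z) zero_le_one
  have h1 := min_le_right ‖y‖ 1
  have h1' := min_le_right ‖z‖ 1
  have h2 : |min ‖y‖ 1 - min ‖z‖ 1| ≤ ‖y - z‖ :=
    (abs_min_sub_min_le_max _ _ _ _).trans (by simpa using abs_norm_sub_norm_le y z)
  rw [Real.dist_eq, dist_eq_norm, NNReal.coe_one, one_mul, ballPot, ballPot]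
  have : (1 - min ‖y‖ 1 ^ 2) / 2 - (1 - min ‖z‖ 1 ^ 2) / 2
      = (min ‖y‖ 1 - min ‖z‖ 1) * (-(min ‖y‖ 1 + min ‖z‖ 1) / 2) := by ring
  rw [this, abs_mul]
  refine (mul_le_mul h2 (?_ : _ ≤ (1 : ℝ)) (abs_nonneg _) (norm_nonneg _)).trans (by simp)
  rw [abs_le]; constructor <;> linarith

theorem ballPot_of_one_le {y : Rn n} (hy : 1 ≤ ‖y‖) : ballPot n y = 0 := by
  simp [ballPot, hy]

theorem ballPot_nonneg (y : Rn n) : 0 ≤ ballPot n y := by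
  have h0 := le_min (norm_nonneg y) zero_le_one
  have h1 := min_le_right ‖y‖ 1
  rw [ballPot]
  nlinarith

theorem ballPot_le (y : Rn n) : ballPot n y ≤ 1 / 2 := by
  rw [ballPot]
  have := sq_nonneg (min ‖y‖ 1)
  linarith

theorem hasCompactSupport_ballPot : HasCompactSupport (ballPot n) := by
  refine HasCompactSupport.of_support_subset_isCompact (isCompact_closedBall (0 : Rn n) 1)
    fun y hy => ?_
  by_contra h
  exact hy (ballPot_of_one_le (le_of_lt (by simpa using h)))

theorem ballWt_of_lt {y : Rn n} (hy : ‖y‖ < 1) : ballWt n y = 1 := by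
  simp [ballWt, hy]

theorem ballWt_of_le {y : Rn n} (hy : 1 ≤ ‖y‖) : ballWt n y = 0 := by
  simp [ballWt, hy]

theorem lineDeriv_ballPot {y : Rn n} (hy : ‖y‖ ≠ 1) (i : Fin n) :
    lineDeriv ℝ (ballPot n) y (-stdVec i) = y i * ballWt n y := by
  rcases lt_or_gt_of_ne hy with h | h
  · have h1 : ballPot n =ᶠ[𝓝 y] fun z => (1 - ‖z‖ ^ 2) / 2 := by
      filter_upwards [(continuous_norm.tendsto y).eventually (gt_mem_nhds h)] with z hz
      simp [ballPot, min_eq_left (le_of_lt hz)]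
    have h2 := ((hasStrictFDerivAt_norm_sq y).hasFDerivAt.const_sub 1).mul_const (2 : ℝ)⁻¹
    simp only [← div_eq_mul_inv] at h2
    rw [Filter.EventuallyEq.lineDeriv_eq h1, h2.differentiableAt.lineDeriv_eq_fderiv, h2.fderiv, ballWt_of_lt h]
    simp [EuclideanSpace.inner_single_right]
  · have h1 : ballPot n =ᶠ[𝓝 y] fun z => (0 : ℝ) := by
      filter_upwards [(continuous_norm.tendsto y).eventually (lt_mem_nhds h)] with z hz
      exact ballPot_of_one_le hz.le
    rw [Filter.EventuallyEq.lineDeriv_eq h1, ballWt_of_le h.le]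
    simp [lineDeriv]

theorem ae_norm_ne_one [Nontrivial (Rn n)] : ∀ᵐ y : Rn n, ‖y‖ ≠ 1 := by
  have := Measure.addHaar_sphere (volume : Measure (Rn n)) 0 1
  rw [ae_iff]
  convert this using 2
  ext y; simp

theorem meanPair_ball [Nontrivial (Rn n)] : MeanPair (ballWt n) (ballPot n) where
  meas := measurable_one.indicator Metric.isOpen_ball.measurableSet
  meas' := lipschitzWith_ballPot.continuous.measurable
  bdd := ⟨1, fun y => by
    by_cases hy : ‖y‖ < 1
    · simp [ballWt_of_lt hy]
    · simp [ballWt_of_le (not_lt.1 hy)]⟩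
  bdd' := ⟨1 / 2, fun y => by rw [abs_of_nonneg (ballPot_nonneg y)]; exact ballPot_le y⟩
  supp := fun y hy => ballWt_of_le hy.le
  supp' := fun y hy => ballPot_of_one_le hy.le
  nonneg := fun y => indicator_nonneg (fun _ _ => by simp) y
  nonneg' := ballPot_nonneg
  ibp := fun g hg i => by
    -- The test function need not be globally Lipschitz. Cutting it off outside the ball of radius 2
    -- makes it so and changes nothing on the unit ball, where `ballPot` lives.
    let χ : ContDiffBump (0 : Rn n) := ⟨2, 3, by norm_num, by norm_num⟩
    have hχ : ∀ y : Rn n, ‖y‖ < 2 → (fun z => χ z * g z) =ᶠ[𝓝 y] g := fun y hy => by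
      filter_upwards [(continuous_norm.tendsto y).eventually (gt_mem_nhds hy)] with z hz
      rw [χ.one_of_mem_closedBall (by simpa using hz.le), one_mul]
    have hsm : ContDiff ℝ ∞ fun z => χ z * g z := χ.contDiff.mul hg
    obtain ⟨C, hC⟩ := hsm.lipschitzWith_of_hasCompactSupport
      (χ.hasCompactSupport.mul_right) (by simp)
    have key := hC.integral_lineDeriv_mul_eq (μ := volume) lipschitzWith_ballPot
      hasCompactSupport_ballPot (stdVec i)
    calc ∫ y, pd i g y * ballPot n y
        = ∫ y, lineDeriv ℝ (fun z => χ z * g z) y (stdVec i) * ballPot n y := by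
          refine integral_congr_ae (Eventually.of_forall fun y => ?_)
          simp only
          by_cases hy : ‖y‖ < 2
          · rw [(differentiable_of_smooth hsm y).lineDeriv_eq_fderiv, (hχ y hy).fderiv_eq, pd]
          · rw [ballPot_of_one_le (by linarith), mul_zero, mul_zero]
      _ = ∫ y, lineDeriv ℝ (ballPot n) y (-stdVec i) * (χ y * g y) := key
      _ = ∫ y, g y * (y i * ballWt n y) := by
          refine integral_congr_ae ?_
          filter_upwards [ae_norm_ne_one] with y hy
          rw [lineDeriv_ballPot hy]
          by_cases h1 : ‖y‖ < 1
          · rw [(hχ y (by linarith)).eq_of_nhds]; ring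
          · rw [ballWt_of_le (not_lt.1 h1)]; ring

/-- The potential of a smooth radial bump (not normalised). -/
noncomputable def preBumpPot (n : ℕ) (y : Rn n) : ℝ := Real.smoothTransition (1 - ‖y‖ ^ 2)

/-- A smooth radial bump (not normalised). -/
noncomputable def preBump (n : ℕ) (y : Rn n) : ℝ := 2 * deriv Real.smoothTransition (1 - ‖y‖ ^ 2)

theorem contDiff_one_sub_norm_sq : ContDiff ℝ ∞ fun y : Rn n => 1 - ‖y‖ ^ 2 :=
  contDiff_const.sub (contDiff_norm_sq ℝ)

theorem contDiff_preBumpPot : ContDiff ℝ ∞ (preBumpPot n) :=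
  Real.smoothTransition.contDiff.comp contDiff_one_sub_norm_sq

theorem contDiff_preBump : ContDiff ℝ ∞ (preBump n) := by
  have h : ContDiff ℝ ∞ (deriv Real.smoothTransition) := by
    have := (contDiff_infty_iff_deriv (𝕜 := ℝ) (f := Real.smoothTransition)).1
      Real.smoothTransition.contDiff
    exact this.2
  exact contDiff_const.mul (h.comp contDiff_one_sub_norm_sq)

theorem preBumpPot_of_one_le {y : Rn n} (hy : 1 ≤ ‖y‖) : preBumpPot n y = 0 :=
  Real.smoothTransition.zero_of_nonpos (by nlinarith)

theorem preBump_of_one_lt {y : Rn n} (hy : 1 < ‖y‖) : preBump n y = 0 := by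
  have h : Real.smoothTransition =ᶠ[𝓝 (1 - ‖y‖ ^ 2)] fun _ => 0 := by
    filter_upwards [gt_mem_nhds (show 1 - ‖y‖ ^ 2 < 0 by nlinarith)] with t ht
    exact Real.smoothTransition.zero_of_nonpos ht.le
  simp [preBump, h.deriv_eq]

theorem preBump_nonneg (y : Rn n) : 0 ≤ preBump n y :=
  mul_nonneg zero_le_two (Real.smoothTransition.monotone.deriv_nonneg)

theorem hasCompactSupport_preBumpPot : HasCompactSupport (preBumpPot n) := by
  refine HasCompactSupport.of_support_subset_isCompact (isCompact_closedBall (0 : Rn n) 1)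
    fun y hy => ?_
  by_contra h
  exact hy (preBumpPot_of_one_le (le_of_lt (by simpa using h)))

theorem hasCompactSupport_preBump : HasCompactSupport (preBump n) := by
  refine HasCompactSupport.of_support_subset_isCompact (isCompact_closedBall (0 : Rn n) 1)
    fun y hy => ?_
  by_contra h
  exact hy (preBump_of_one_lt (by simpa using h))

theorem pd_preBumpPot (i : Fin n) (y : Rn n) : pd i (preBumpPot n) y = -(y i * preBump n y) := by
  have h1 : HasFDerivAt (fun z : Rn n => 1 - ‖z‖ ^ 2) (-(2 • innerSL ℝ y)) y :=
    (hasStrictFDerivAt_norm_sq y).hasFDerivAt.const_sub 1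
  have h2 : HasDerivAt Real.smoothTransition (deriv Real.smoothTransition (1 - ‖y‖ ^ 2))
      (1 - ‖y‖ ^ 2) :=
    ((Real.smoothTransition.contDiff (n := 1)).differentiable (by simp) _).hasDerivAt
  have h3 := h2.comp_hasFDerivAt y h1
  have h4 : fderiv ℝ (preBumpPot n) y = _ := h3.fderiv
  rw [pd, h4, preBump]
  simp [EuclideanSpace.inner_single_right]
  ring

theorem preBump_ibp {g : Rn n → ℝ} (hg : ContDiff ℝ ∞ g) (i : Fin n) :
    ∫ y, pd i g y * preBumpPot n y = ∫ y, g y * (y i * preBump n y) := by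
  rw [integral_pd_mul hg contDiff_preBumpPot hasCompactSupport_preBumpPot, ← integral_neg]
  exact integral_congr_ae (Eventually.of_forall fun y => by simp only [pd_preBumpPot]; ring)

/-- If the integral were zero, `preBump` would vanish almost everywhere. Integration by parts with
the coordinate function `y 0` would then give `∫ preBumpPot = ∫ (y 0)² preBump = 0`, although
`preBumpPot` is positive at the origin. -/
theorem integral_preBump_pos [NeZero n] : 0 < ∫ y, preBump n y := by
  have hint : Integrable (preBump n) :=
    contDiff_preBump.continuous.integrable_of_hasCompactSupport hasCompactSupport_preBump
  refine lt_of_le_of_ne (integral_nonneg preBump_nonneg) fun h => ?_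
  have h0 := (integral_eq_zero_iff_of_nonneg preBump_nonneg hint).1 h.symm
  have hg : ContDiff ℝ ∞ fun y : Rn n => y 0 :=
    (EuclideanSpace.proj (𝕜 := ℝ) (0 : Fin n)).contDiff
  have h1 := preBump_ibp hg 0
  have h2 : ∀ y, pd 0 (fun y : Rn n => y 0) y = 1 := fun y => by
    have : fderiv ℝ (fun y : Rn n => y 0) y = EuclideanSpace.proj (𝕜 := ℝ) (0 : Fin n) :=
      (EuclideanSpace.proj (𝕜 := ℝ) (0 : Fin n)).fderiv
    simp [pd, this]
  have h3 : ∫ y : Rn n, y 0 * (y 0 * preBump n y) = 0 := by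
    rw [integral_eq_zero_of_ae]
    filter_upwards [h0] with y hy
    simp [hy]
  have h4 : 0 < ∫ y, preBumpPot n y := by
    refine contDiff_preBumpPot.continuous.integral_pos_of_hasCompactSupport_nonneg_nonzero
      hasCompactSupport_preBumpPot (fun y => Real.smoothTransition.nonneg _) (x := 0) ?_
    simp [preBumpPot]
  simp only [h2, one_mul] at h1
  linarith

/-- The smooth radial bump, of total mass one. -/
noncomputable def bump (n : ℕ) (y : Rn n) : ℝ := (∫ y, preBump n y)⁻¹ * preBump n y

/-- The potential of the smooth radial bump. -/
noncomputable def bumpPot (n : ℕ) (y : Rn n) : ℝ := (∫ y, preBump n y)⁻¹ * preBumpPot n y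

theorem contDiff_bump : ContDiff ℝ ∞ (bump n) := contDiff_const.mul contDiff_preBump

theorem hasCompactSupport_bump : HasCompactSupport (bump n) := hasCompactSupport_preBump.mul_left

theorem bump_neg (y : Rn n) : bump n (-y) = bump n y := by simp [bump, preBump]

theorem integral_bump [NeZero n] : ∫ y, bump n y = 1 := by
  simp only [bump]
  rw [integral_const_mul, inv_mul_cancel₀ integral_preBump_pos.ne']

theorem meanPair_bump [NeZero n] : MeanPair (bump n) (bumpPot n) where
  meas := contDiff_bump.continuous.measurable
  meas' := (contDiff_preBumpPot.continuous.measurable).const_mul _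
  bdd := hasCompactSupport_bump.exists_bound_of_continuous contDiff_bump.continuous
  bdd' := (hasCompactSupport_preBumpPot.mul_left (f := fun _ => (∫ y, preBump n y)⁻¹)
    ).exists_bound_of_continuous (continuous_const.mul contDiff_preBumpPot.continuous)
  supp := fun y hy => by simp [bump, preBump_of_one_lt hy]
  supp' := fun y hy => by simp [bumpPot, preBumpPot_of_one_le hy.le]
  nonneg := fun y => mul_nonneg (inv_nonneg.2 integral_preBump_pos.le) (preBump_nonneg y)
  nonneg' := fun y =>
    mul_nonneg (inv_nonneg.2 integral_preBump_pos.le) (Real.smoothTransition.nonneg _)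
  ibp := fun g hg i => by
    calc ∫ y, pd i g y * bumpPot n y
        = (∫ y, preBump n y)⁻¹ * ∫ y, pd i g y * preBumpPot n y := by
          rw [← integral_const_mul]
          exact integral_congr_ae (Eventually.of_forall fun y => by simp only [bumpPot]; ring)
      _ = ∫ y, g y * (y i * bump n y) := by
          rw [preBump_ibp hg, ← integral_const_mul]
          exact integral_congr_ae (Eventually.of_forall fun y => by simp only [bump]; ring)

theorem exists_le_bumpPot [NeZero n] :
    ∃ q, 0 < q ∧ ∀ y : Rn n, ‖y‖ ≤ 1 / 2 → q ≤ bumpPot n y := by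
  -- The value `3 / 4` is `1 - ‖y‖ ^ 2` at `‖y‖ = 1 / 2`.
  refine ⟨(∫ y, preBump n y)⁻¹ * Real.smoothTransition (3 / 4),
    mul_pos (inv_pos.2 integral_preBump_pos) (Real.smoothTransition.pos_of_pos (by norm_num)),
    fun y hy => mul_le_mul_of_nonneg_left (Real.smoothTransition.monotone ?_)
      (inv_nonneg.2 integral_preBump_pos.le)⟩
  have := norm_nonneg y
  nlinarith

end CapPot

/-! ### Monotone means of smooth superharmonic functions and quantitative mean value defects. -/

namespace CapPot
open scoped ContDiff

variable {n : ℕ}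

instance neZero_of_fact [h : Fact (3 ≤ n)] : NeZero n := ⟨by have := h.out; omega⟩

instance nontrivial_Rn [NeZero n] : Nontrivial (Rn n) :=
  ⟨⟨0, stdVec 0, fun h => by
    have := congrArg norm h
    simp at this⟩⟩

/-! ### Consequences of the derivative formula for averages -/

/-- The volume of the unit ball. -/
noncomputable def vball (n : ℕ) : ℝ := (volume (Metric.ball (0 : Rn n) 1)).toReal

theorem vball_pos : 0 < vball n :=
  ENNReal.toReal_pos (Metric.measure_ball_pos _ _ one_pos).ne' measure_ball_lt_top.ne

theorem volume_real_ball (x : Rn n) {r : ℝ} (hr : 0 < r) :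
    volume.real (Metric.ball x r) = r ^ n * vball n := by
  have h := Measure.addHaar_ball_of_pos (volume : Measure (Rn n)) x hr
  rw [Measure.real, h, ENNReal.toReal_mul, ENNReal.toReal_ofReal (by positivity), vball]
  simp

theorem integral_comp_add_smul (f : Rn n → ℝ) (x : Rn n) {r : ℝ} (hr : 0 < r) :
    ∫ y, f (x + r • y) = (r ^ n)⁻¹ * ∫ y, f y := by
  rw [Measure.integral_comp_smul volume (fun y => f (x + y)) r, integral_add_left_eq_self f x]
  simp [abs_of_pos hr]

theorem wmean_eq_inv_mul (η u : Rn n → ℝ) (x : Rn n) {r : ℝ} (hr : 0 < r) :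
    wmean η u x r = (r ^ n)⁻¹ * ∫ z, u z * η (r⁻¹ • (z - x)) := by
  rw [← integral_comp_add_smul _ x hr, wmean]
  simp [smul_smul, hr.ne']

theorem wmean_ballWt (u : Rn n → ℝ) (x : Rn n) {r : ℝ} (hr : 0 < r) :
    wmean (ballWt n) u x r = vball n * ⨍ y in Metric.ball x r, u y := by
  have h : ∀ z, u z * ballWt n (r⁻¹ • (z - x)) = (Metric.ball x r).indicator u z := fun z => by
    have hz : ‖r⁻¹ • (z - x)‖ < 1 ↔ z ∈ Metric.ball x r := by
      rw [norm_smul, norm_inv, Real.norm_of_nonneg hr.le, inv_mul_lt_iff₀ hr, mul_one,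
        mem_ball_iff_norm]
    by_cases hm : z ∈ Metric.ball x r
    · rw [ballWt_of_lt (hz.2 hm), indicator_of_mem hm, mul_one]
    · rw [ballWt_of_le (not_lt.1 (hz.not.2 hm)), indicator_of_notMem hm, mul_zero]
  rw [wmean_eq_inv_mul _ _ _ hr]
  simp_rw [h]
  rw [integral_indicator Metric.isOpen_ball.measurableSet, setAverage_eq,
    volume_real_ball _ hr, smul_eq_mul]
  have := (vball_pos (n := n)).ne'
  field_simp

theorem wmean_zero (η u : Rn n → ℝ) (x : Rn n) : wmean η u x 0 = u x * ∫ y, η y := by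
  simp [wmean, integral_const_mul]

theorem add_smul_mem_closedBall {x y : Rn n} {r R : ℝ} (hr : 0 ≤ r) (hrR : r ≤ R)
    (hy : ‖y‖ ≤ 1) : x + r • y ∈ Metric.closedBall x R := by
  rw [mem_closedBall_iff_norm, add_sub_cancel_left, norm_smul, Real.norm_of_nonneg hr]
  nlinarith [norm_nonneg y]

variable {η Q u : Rn n → ℝ} {x : Rn n} {R : ℝ}

theorem MeanPair.integral_lap_nonpos (h : MeanPair η Q)
    (hl : ∀ y ∈ Metric.closedBall x R, lap u y ≤ 0) {r : ℝ} (hr : 0 ≤ r) (hrR : r ≤ R) :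
    ∫ y, lap u (x + r • y) * Q y ≤ 0 := by
  refine integral_nonpos fun y => ?_
  by_cases hy : 1 < ‖y‖
  · simp [h.supp' y hy]
  · exact mul_nonpos_of_nonpos_of_nonneg
      (hl _ (add_smul_mem_closedBall hr hrR (not_lt.1 hy))) (h.nonneg' y)

/-- The derivative is a nonnegative multiple of an average of the Laplacian against `Q ≥ 0`. -/
theorem MeanPair.antitoneOn (h : MeanPair η Q) (hu : ContDiff ℝ ∞ u)
    (hl : ∀ y ∈ Metric.closedBall x R, lap u y ≤ 0) : AntitoneOn (wmean η u x) (Icc 0 R) := by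
  refine antitoneOn_of_deriv_nonpos (convex_Icc 0 R)
    (fun r _ => (h.hasDerivAt hu x r).continuousAt.continuousWithinAt)
    (fun r _ => (h.hasDerivAt hu x r).differentiableAt.differentiableWithinAt) fun r hr => ?_
  rw [interior_Icc] at hr
  rw [(h.hasDerivAt hu x r).deriv]
  exact mul_nonpos_of_nonneg_of_nonpos hr.1.le (h.integral_lap_nonpos hl hr.1.le hr.2.le)

theorem wmean_neg (η u : Rn n → ℝ) (x : Rn n) (r : ℝ) :
    wmean η (fun y => -1 * u y) x r = - wmean η u x r := by
  simp [wmean, integral_neg]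

theorem MeanPair.wmean_const (h : MeanPair η Q) (hu : ContDiff ℝ ∞ u)
    (hl : ∀ y ∈ Metric.closedBall x R, lap u y = 0) {r : ℝ} (hr : 0 ≤ r) (hrR : r ≤ R) :
    wmean η u x r = u x * ∫ y, η y := by
  have h1 := h.antitoneOn hu (fun y hy => (hl y hy).le) ⟨le_rfl, hr.trans hrR⟩ ⟨hr, hrR⟩ hr
  have h2 := h.antitoneOn (u := fun y => -1 * u y) (x := x) (R := R) (contDiff_const.mul hu)
    (fun y hy => by rw [lap_const_mul hu]; simp [hl y hy]) ⟨le_rfl, hr.trans hrR⟩ ⟨hr, hrR⟩ hr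
  rw [wmean_neg, wmean_neg] at h2
  rw [wmean_zero] at h1 h2
  linarith

theorem average_ball_le_of_lap_nonpos [NeZero n] (hu : ContDiff ℝ ∞ u)
    (hl : ∀ y ∈ Metric.closedBall x R, lap u y ≤ 0) (hR : 0 < R) :
    ⨍ y in Metric.ball x R, u y ≤ u x := by
  have h1 := meanPair_ball.antitoneOn hu hl ⟨le_rfl, hR.le⟩ ⟨hR.le, le_rfl⟩ hR.le
  have h2 : ∫ y, ballWt n y = vball n := by
    simp only [ballWt]
    rw [integral_indicator Metric.isOpen_ball.measurableSet]
    simp [vball, Measure.real]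
  rw [wmean_zero, wmean_ballWt _ _ hR, h2, mul_comm] at h1
  exact (mul_le_mul_iff_of_pos_right vball_pos).1 (by linarith)

theorem superharmonic_of_lap_nonpos [NeZero n] (hu : ContDiff ℝ ∞ u) (hl : ∀ y, lap u y ≤ 0) :
    Superharmonic u :=
  ⟨hu.continuous.lowerSemicontinuous, hu.continuous.locallyIntegrable,
    fun _ _ hr => average_ball_le_of_lap_nonpos hu (fun y _ => hl y) hr⟩

theorem wmean_mono_of_le (hη : ∀ y, 0 ≤ η y) {v w : Rn n → ℝ} {r : ℝ}
    (hv : Integrable fun y => v (x + r • y) * η y) (hw : Integrable fun y => w (x + r • y) * η y)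
    (h : ∀ y, ‖y‖ ≤ 1 → v (x + r • y) ≤ w (x + r • y)) (hs : ∀ y, 1 < ‖y‖ → η y = 0) :
    wmean η v x r ≤ wmean η w x r := by
  refine integral_mono hv hw fun y => ?_
  by_cases hy : 1 < ‖y‖
  · simp [hs y hy]
  · exact mul_le_mul_of_nonneg_right (h y (not_lt.1 hy)) (hη y)

/-- A positive Laplacian at `x` stays positive nearby, so the ball means would increase strictly
from their value at radius zero, against the hypothesis. -/
theorem lap_nonpos_of_average_le [NeZero n] (hu : ContDiff ℝ ∞ u) {ρ : ℝ} (hρ : 0 < ρ)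
    (h : ∀ r, 0 < r → r < ρ → ⨍ y in Metric.ball x r, u y ≤ u x) : lap u x ≤ 0 := by
  by_contra! hpos
  have hev : ∀ᶠ y in 𝓝 x, 0 < lap u y :=
    ((contDiff_lap hu).continuous.tendsto x).eventually (lt_mem_nhds hpos)
  obtain ⟨τ, hτ, hball⟩ := Metric.eventually_nhds_iff_ball.1 hev
  set b := min (τ / 2) (ρ / 2) with hb
  have hb0 : 0 < b := by positivity
  have hbτ : b < τ := (min_le_left _ _).trans_lt (by linarith)
  have hbρ : b < ρ := (min_le_right _ _).trans_lt (by linarith)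
  have hM := meanPair_ball (n := n)
  have hstrict : StrictMonoOn (wmean (ballWt n) u x) (Icc 0 b) := by
    refine strictMonoOn_of_deriv_pos (convex_Icc 0 b)
      (fun r _ => (hM.hasDerivAt hu x r).continuousAt.continuousWithinAt) fun r hr => ?_
    rw [interior_Icc] at hr
    rw [(hM.hasDerivAt hu x r).deriv]
    have hc : Continuous fun y : Rn n => lap u (x + r • y) :=
      (contDiff_lap hu).continuous.comp (by fun_prop)
    refine mul_pos hr.1 ?_
    refine (hc.mul lipschitzWith_ballPot.continuous).integral_pos_of_hasCompactSupport_nonneg_nonzero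
      hasCompactSupport_ballPot.mul_left (fun y => ?_) (x := 0) ?_
    · by_cases hy : 1 < ‖y‖
      · simp [hM.supp' y hy]
      · refine mul_nonneg (hball _ ?_).le (ballPot_nonneg y)
        exact Metric.closedBall_subset_ball hbτ
          (add_smul_mem_closedBall hr.1.le hr.2.le (not_lt.1 hy))
    · simp [ballPot, hpos.ne']
  have h1 := hstrict ⟨le_rfl, hb0.le⟩ ⟨hb0.le, le_rfl⟩ hb0
  have h2 : ∫ y, ballWt n y = vball n := by
    simp only [ballWt]
    rw [integral_indicator Metric.isOpen_ball.measurableSet]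
    simp [vball, Measure.real]
  rw [wmean_zero, wmean_ballWt _ _ hb0, h2, mul_comm, mul_lt_mul_iff_right₀ vball_pos] at h1
  exact absurd (h b hb0 hbρ) (not_le.2 h1)

/-- After rescaling, the weight is bounded by `K` and supported in the ball of radius `t ≤ b`. With
`f = -Δu` this bounds the speed at which means decrease by the mass in the larger ball. -/
theorem integral_comp_mul_pot_le (h : MeanPair η Q) {f : Rn n → ℝ} (hf : Continuous f)
    {b K : ℝ} (hK : ∀ y, |Q y| ≤ K) (hf0 : ∀ y ∈ Metric.closedBall x b, 0 ≤ f y)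
    {t : ℝ} (ht : 0 < t) (htb : t ≤ b) :
    ∫ y, f (x + t • y) * Q y ≤ (t ^ n)⁻¹ * (K * ∫ y in Metric.closedBall x b, f y) := by
  have h1 : ∫ y, f (x + t • y) * Q y = wmean Q f x t := rfl
  rw [h1, wmean_eq_inv_mul _ _ _ ht]
  refine mul_le_mul_of_nonneg_left ?_ (by positivity)
  rw [← integral_const_mul, ← integral_indicator Metric.isClosed_closedBall.measurableSet]
  refine integral_mono_of_nonneg (Eventually.of_forall fun z => ?_) ?_
    (Eventually.of_forall fun z => ?_)
  · by_cases hz : z ∈ Metric.closedBall x b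
    · exact mul_nonneg (hf0 z hz) (h.nonneg' _)
    · have : 1 < ‖t⁻¹ • (z - x)‖ := by
        rw [mem_closedBall_iff_norm, not_le] at hz
        rw [norm_smul, norm_inv, Real.norm_of_nonneg ht.le, lt_inv_mul_iff₀ ht]
        linarith
      simp [h.supp' _ this]
  · rw [integrable_indicator_iff Metric.isClosed_closedBall.measurableSet]
    exact (hf.continuousOn.integrableOn_compact (isCompact_closedBall x b)).const_mul K
  · by_cases hz : z ∈ Metric.closedBall x b
    · simp only [indicator_of_mem hz]
      rw [mul_comm]
      exact mul_le_mul_of_nonneg_right ((le_abs_self _).trans (hK _)) (hf0 z hz)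
    · have : 1 < ‖t⁻¹ • (z - x)‖ := by
        rw [mem_closedBall_iff_norm, not_le] at hz
        rw [norm_smul, norm_inv, Real.norm_of_nonneg ht.le, lt_inv_mul_iff₀ ht]
        linarith
      simp [h.supp' _ this, hz]

/-- Away from scale zero, averages differ by at most a multiple of the mass of the Laplacian. -/
theorem MeanPair.wmean_sub_le (h : MeanPair η Q) {a b : ℝ} (ha : 0 < a) (hab : a ≤ b) :
    ∃ C, ∀ u : Rn n → ℝ, ContDiff ℝ ∞ u → ∀ x, (∀ y ∈ Metric.closedBall x b, lap u y ≤ 0) →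
      wmean η u x a - wmean η u x b ≤ C * ∫ y in Metric.closedBall x b, - lap u y := by
  obtain ⟨K, hK⟩ := h.bdd'
  -- The speed at scale `t ∈ [a, b]` is at most `b * (a ^ n)⁻¹ * K` times the mass, over an interval
  -- of length `b - a`. The constant degenerates as `a → 0`, but it is the same for all `u`.
  refine ⟨(b * ((a ^ n)⁻¹ * K)) * (b - a), fun u hu x hl => ?_⟩
  set I := ∫ y in Metric.closedBall x b, - lap u y with hI
  have hI0 : 0 ≤ I := setIntegral_nonneg Metric.isClosed_closedBall.measurableSet
    fun y hy => neg_nonneg.2 (hl y hy)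
  have hK0 : 0 ≤ K := (abs_nonneg _).trans (hK 0)
  have hc : Continuous fun y => - lap u y := (contDiff_lap hu).continuous.neg
  have key := (convex_Icc a b).image_sub_le_mul_sub_of_deriv_le (f := fun t => -wmean η u x t)
    (C := b * ((a ^ n)⁻¹ * K) * I)
    (fun r _ => (h.hasDerivAt hu x r).neg.continuousAt.continuousWithinAt)
    (fun r _ => (h.hasDerivAt hu x r).neg.differentiableAt.differentiableWithinAt) ?_
    a ⟨le_rfl, hab⟩ b ⟨hab, le_rfl⟩ hab
  · linarith
  intro t ht
  rw [interior_Icc] at ht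
  have ht0 : 0 < t := ha.trans ht.1
  have hd : deriv (fun t => -wmean η u x t) t = _ := (h.hasDerivAt hu x t).neg.deriv
  rw [hd]
  have h1 := integral_comp_mul_pot_le h hc hK (fun y hy => neg_nonneg.2 (hl y hy)) ht0 ht.2.le
  have h2 : ∫ y, - lap u (x + t • y) * Q y = - ∫ y, lap u (x + t • y) * Q y := by
    rw [← integral_neg]; exact integral_congr_ae (Eventually.of_forall fun y => by simp)
  rw [h2] at h1
  have h3 : (t ^ n)⁻¹ ≤ (a ^ n)⁻¹ := inv_anti₀ (by positivity) (pow_le_pow_left₀ ha.le ht.1.le n)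
  have h4 : 0 ≤ - ∫ y, lap u (x + t • y) * Q y := by
    have := h.integral_lap_nonpos hl ht0.le ht.2.le
    linarith
  calc -(t * ∫ y, lap u (x + t • y) * Q y) = t * (- ∫ y, lap u (x + t • y) * Q y) := by ring
    _ ≤ b * ((a ^ n)⁻¹ * (K * I)) :=
        mul_le_mul ht.2.le (h1.trans (mul_le_mul_of_nonneg_right h3 (by positivity))) h4
          (by linarith)
    _ = _ := by ring

/-- The defect of the smooth mean controls the mass of the Laplacian nearby. -/
theorem exists_mass_le_bump_defect [NeZero n] {r : ℝ} (hr : 0 < r) :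
    ∃ c, 0 < c ∧ ∀ u : Rn n → ℝ, ContDiff ℝ ∞ u → ∀ x, (∀ y ∈ Metric.closedBall x r, lap u y ≤ 0) →
      c * ∫ y in Metric.closedBall x (r / 4), - lap u y ≤ u x - wmean (bump n) u x r := by
  obtain ⟨q, hq, hqQ⟩ := exists_le_bumpPot (n := n)
  have h := meanPair_bump (n := n)
  -- Only the scales `t ∈ [r / 2, r]` are used. There the rescaled `bumpPot` is at least `q` on the
  -- ball of radius `t / 2`, which contains that of radius `r / 4`.
  refine ⟨(r / 2) * ((r ^ n)⁻¹ * q) * (r - r / 2), by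
    have : 0 < r - r / 2 := by linarith
    positivity, fun u hu x hl => ?_⟩
  set I := ∫ y in Metric.closedBall x (r / 4), - lap u y with hI
  have hc : Continuous fun y => - lap u y := (contDiff_lap hu).continuous.neg
  have hI0 : 0 ≤ I := setIntegral_nonneg Metric.isClosed_closedBall.measurableSet
    fun y hy => neg_nonneg.2 (hl y (Metric.closedBall_subset_closedBall (by linarith) hy))
  have key := (convex_Icc (r / 2) r).mul_sub_le_image_sub_of_le_deriv
    (f := fun t => -wmean (bump n) u x t)
    (C := (r / 2) * ((r ^ n)⁻¹ * q) * I)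
    (fun r _ => (h.hasDerivAt hu x r).neg.continuousAt.continuousWithinAt)
    (fun r _ => (h.hasDerivAt hu x r).neg.differentiableAt.differentiableWithinAt) ?_
    (r / 2) ⟨le_rfl, by linarith⟩ r ⟨by linarith, le_rfl⟩ (by linarith)
  · have h0 := h.antitoneOn hu hl ⟨le_rfl, hr.le⟩ (⟨by positivity, by linarith⟩ : r / 2 ∈ Icc 0 r)
      (by positivity)
    rw [wmean_zero, integral_bump, mul_one] at h0
    have : r / 2 * ((r ^ n)⁻¹ * q) * (r - r / 2) * I = r / 2 * ((r ^ n)⁻¹ * q) * I * (r - r / 2) := by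
      ring
    linarith
  intro t ht
  rw [interior_Icc] at ht
  have ht0 : 0 < t := by linarith [ht.1]
  have hd : deriv (fun t => -wmean (bump n) u x t) t = _ := (h.hasDerivAt hu x t).neg.deriv
  rw [hd]
  have h2 : ∫ y, - lap u (x + t • y) * bumpPot n y = - ∫ y, lap u (x + t • y) * bumpPot n y := by
    rw [← integral_neg]; exact integral_congr_ae (Eventually.of_forall fun y => by simp)
  have h3 : (r ^ n)⁻¹ ≤ (t ^ n)⁻¹ := inv_anti₀ (by positivity) (pow_le_pow_left₀ ht0.le ht.2.le n)
  have h1 : (t ^ n)⁻¹ * (q * I) ≤ ∫ y, - lap u (x + t • y) * bumpPot n y := by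
    have e : ∫ y, - lap u (x + t • y) * bumpPot n y
      = wmean (bumpPot n) (fun y => - lap u y) x t := rfl
    have hint : Integrable fun z => - lap u z * bumpPot n (t⁻¹ • (z - x)) := by
      have := (h.integrable_mul' (hc.comp (by fun_prop : Continuous fun y => x + t • y)))
      have := (this.comp_smul (inv_ne_zero ht0.ne')).comp_sub_right x
      refine this.congr (Eventually.of_forall fun z => ?_)
      simp [smul_smul, ht0.ne']
    rw [e, wmean_eq_inv_mul _ _ _ ht0]
    refine mul_le_mul_of_nonneg_left ?_ (by positivity)
    rw [← integral_const_mul, ← integral_indicator Metric.isClosed_closedBall.measurableSet]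
    refine integral_mono ?_ hint fun z => ?_
    · rw [integrable_indicator_iff Metric.isClosed_closedBall.measurableSet]
      exact (hc.continuousOn.integrableOn_compact (isCompact_closedBall x _)).const_mul q
    · by_cases hz : z ∈ Metric.closedBall x (r / 4)
      · simp only [indicator_of_mem hz]
        rw [mul_comm]
        refine mul_le_mul_of_nonneg_left (hqQ _ ?_)
          (neg_nonneg.2 (hl z (Metric.closedBall_subset_closedBall (by linarith) hz)))
        rw [mem_closedBall_iff_norm] at hz
        rw [norm_smul, norm_inv, Real.norm_of_nonneg ht0.le, inv_mul_le_iff₀ ht0]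
        linarith [ht.1]
      · simp only [indicator_of_notMem hz]
        by_cases hz1 : 1 < ‖t⁻¹ • (z - x)‖
        · simp [h.supp' _ hz1]
        · refine mul_nonneg (neg_nonneg.2 (hl z ?_)) (h.nonneg' _)
          rw [not_lt, norm_smul, norm_inv, Real.norm_of_nonneg ht0.le, inv_mul_le_iff₀ ht0] at hz1
          rw [mem_closedBall_iff_norm]
          linarith [ht.2]
  rw [h2] at h1
  calc r / 2 * ((r ^ n)⁻¹ * q) * I = r / 2 * ((r ^ n)⁻¹ * (q * I)) := by ring
    _ ≤ t * (- ∫ y, lap u (x + t • y) * bumpPot n y) :=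
        mul_le_mul ht.1.le ((mul_le_mul_of_nonneg_right h3 (by positivity)).trans h1)
          (by positivity) ht0.le
    _ = _ := by ring

end CapPot

/-! ### Convolution, mollification and their limits. -/

namespace CapPot
open scoped ContDiff

variable {n : ℕ}

/-! ### Convolution with a smooth function of compact support -/

/-- The convolution of `v` and `κ`. -/
noncomputable def conv (v κ : Rn n → ℝ) (x : Rn n) : ℝ := ∫ z, v z * κ (x - z)

theorem conv_eq_convolution (v κ : Rn n → ℝ) :
    conv v κ = convolution v κ (ContinuousLinearMap.mul ℝ ℝ) volume := by
  ext x; simp [conv, convolution]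

theorem contDiff_conv {v κ : Rn n → ℝ} (hv : LocallyIntegrable v) (hκ : ContDiff ℝ ∞ κ)
    (hc : HasCompactSupport κ) : ContDiff ℝ ∞ (conv v κ) := by
  rw [conv_eq_convolution]
  exact hc.contDiff_convolution_right _ hv hκ

theorem pd_conv {v κ : Rn n → ℝ} (hv : LocallyIntegrable v) (hκ : ContDiff ℝ ∞ κ)
    (hc : HasCompactSupport κ) (i : Fin n) : pd i (conv v κ) = conv v (pd i κ) := by
  ext x
  have h := hc.hasFDerivAt_convolution_right (ContinuousLinearMap.mul ℝ ℝ) hv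
    (hκ.of_le (by simp)) x
  rw [← conv_eq_convolution] at h
  rw [pd, h.fderiv, convolution, conv, ContinuousLinearMap.integral_apply]
  · simp [pd, ContinuousLinearMap.precompR]
  · exact (hc.fderiv ℝ).convolutionExists_right _ hv (hκ.continuous_fderiv (by simp)) x

theorem integrable_mul_of_compact {v κ : Rn n → ℝ} (hv : LocallyIntegrable v) (hκ : Continuous κ)
    (hc : HasCompactSupport κ) : Integrable fun z => v z * κ z := by
  have := hv.integrable_smul_right_of_hasCompactSupport hκ hc
  simpa [smul_eq_mul] using this

theorem hasCompactSupport_comp_sub {κ : Rn n → ℝ} (hc : HasCompactSupport κ) (x : Rn n) :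
    HasCompactSupport fun z => κ (x - z) :=
  hc.comp_homeomorph (Homeomorph.subLeft x)

theorem integrable_conv {v κ : Rn n → ℝ} (hv : LocallyIntegrable v) (hκ : Continuous κ)
    (hc : HasCompactSupport κ) (x : Rn n) : Integrable fun z => v z * κ (x - z) :=
  integrable_mul_of_compact hv (hκ.comp (by fun_prop)) (hasCompactSupport_comp_sub hc x)

theorem lap_conv {v κ : Rn n → ℝ} (hv : LocallyIntegrable v) (hκ : ContDiff ℝ ∞ κ)
    (hc : HasCompactSupport κ) : lap (conv v κ) = conv v (lap κ) := by
  ext x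
  simp only [lap, pd_conv hv hκ hc, pd_conv hv (contDiff_pd hκ _) (hasCompactSupport_pd hc _)]
  simp only [conv]
  rw [← integral_finsetSum]
  · simp only [lap, Finset.mul_sum]
  exact fun i _ => integrable_conv hv (contDiff_pd (contDiff_pd hκ i) i).continuous
    (hasCompactSupport_pd (hasCompactSupport_pd hc i) i) x

theorem pd_comp_sub {κ : Rn n → ℝ} (hκ : ContDiff ℝ ∞ κ) (x : Rn n) (i : Fin n) :
    pd i (fun z => κ (x - z)) = fun z => - pd i κ (x - z) := by
  have := pd_comp_add_smul hκ x (-1) i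
  ext z
  simpa [sub_eq_add_neg] using congrFun this z

theorem conv_pd_comm {v κ : Rn n → ℝ} (hv : ContDiff ℝ ∞ v) (hκ : ContDiff ℝ ∞ κ)
    (hc : HasCompactSupport κ) (i : Fin n) : conv v (pd i κ) = conv (pd i v) κ := by
  ext x
  have hs : ContDiff ℝ ∞ fun z => κ (x - z) := hκ.comp (contDiff_const.sub contDiff_id)
  rw [conv, conv, integral_pd_mul hv hs (hasCompactSupport_comp_sub hc x), pd_comp_sub hκ,
    ← integral_neg]
  simp

/-- Here the derivatives fall on `v`, unlike in `lap_conv`; this is the form needed to compute the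
mass of a mollified Newton potential. -/
theorem lap_conv' {v κ : Rn n → ℝ} (hv : ContDiff ℝ ∞ v) (hκ : ContDiff ℝ ∞ κ)
    (hc : HasCompactSupport κ) : lap (conv v κ) = conv (lap v) κ := by
  ext x
  have h : ∀ i, pd i (pd i (conv v κ)) = conv (pd i (pd i v)) κ := fun i => by
    rw [pd_conv hv.continuous.locallyIntegrable hκ hc, conv_pd_comm hv hκ hc,
      pd_conv (contDiff_pd hv i).continuous.locallyIntegrable hκ hc,
      conv_pd_comm (contDiff_pd hv i) hκ hc]
  simp only [lap, h]
  simp only [conv]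
  rw [← integral_finsetSum]
  · simp only [lap, Finset.sum_mul]
  exact fun i _ => integrable_conv (contDiff_pd (contDiff_pd hv i) i).continuous.locallyIntegrable
    hκ.continuous hc x

/-! ### Mollification -/

/-- The mollification of `v` at scale `ε`. -/
noncomputable def moll (ε : ℝ) (v : Rn n → ℝ) (x : Rn n) : ℝ := wmean (bump n) v x ε

/-- The kernel of `moll ε`. -/
noncomputable def mollKer (n : ℕ) (ε : ℝ) (y : Rn n) : ℝ := (ε ^ n)⁻¹ * bump n (ε⁻¹ • y)

theorem contDiff_mollKer (ε : ℝ) : ContDiff ℝ ∞ (mollKer n ε) :=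
  contDiff_const.mul (contDiff_bump.comp (contDiff_id.const_smul _))

theorem hasCompactSupport_mollKer {ε : ℝ} (hε : 0 < ε) : HasCompactSupport (mollKer n ε) :=
  (hasCompactSupport_bump.comp_smul (inv_ne_zero hε.ne')).mul_left

theorem moll_eq_conv {ε : ℝ} (hε : 0 < ε) (v : Rn n → ℝ) : moll ε v = conv v (mollKer n ε) := by
  ext x
  rw [moll, wmean_eq_inv_mul _ _ _ hε, conv, ← integral_const_mul]
  refine integral_congr_ae (Eventually.of_forall fun z => ?_)
  have : x - z = -(z - x) := by abel
  simp only [mollKer]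
  rw [this, smul_neg, bump_neg]
  ring

theorem contDiff_moll {ε : ℝ} (hε : 0 < ε) {v : Rn n → ℝ} (hv : LocallyIntegrable v) :
    ContDiff ℝ ∞ (moll ε v) := by
  rw [moll_eq_conv hε]
  exact contDiff_conv hv (contDiff_mollKer ε) (hasCompactSupport_mollKer hε)

theorem lap_moll {ε : ℝ} (hε : 0 < ε) {v : Rn n → ℝ} (hv : ContDiff ℝ ∞ v) :
    lap (moll ε v) = moll ε (lap v) := by
  rw [moll_eq_conv hε, moll_eq_conv hε]
  exact lap_conv' hv (contDiff_mollKer ε) (hasCompactSupport_mollKer hε)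

theorem locallyIntegrable_of_bdd {v : Rn n → ℝ} (hm : Measurable v) {C : ℝ}
    (hb : ∀ x, |v x| ≤ C) : LocallyIntegrable v := by
  refine (locallyIntegrable_const C).mono hm.aestronglyMeasurable (Eventually.of_forall fun x => ?_)
  exact (hb x).trans (le_abs_self C)

theorem MeanPair.integrable_bdd_mul {η Q : Rn n → ℝ} (h : MeanPair η Q) {v : Rn n → ℝ}
    (hm : Measurable v) {C : ℝ} (hb : ∀ x, |v x| ≤ C) : Integrable fun y => v y * η y := by
  obtain ⟨K, hK⟩ := h.bdd
  exact integrable_mul_weight hm h.meas (fun y _ => hb y) hK h.supp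

theorem measurable_comp_add_smul {v : Rn n → ℝ} (hm : Measurable v) (x : Rn n) (r : ℝ) :
    Measurable fun y => v (x + r • y) :=
  hm.comp (by fun_prop)

variable [NeZero n] {v : Rn n → ℝ} {C : ℝ}

theorem integrable_bump_mul (hm : Measurable v) (hb : ∀ x, |v x| ≤ C) (x : Rn n) (ε : ℝ) :
    Integrable fun y => v (x + ε • y) * bump n y :=
  meanPair_bump.integrable_bdd_mul (measurable_comp_add_smul hm x ε) fun _ => hb _

theorem integrable_bump : Integrable (bump n) :=
  contDiff_bump.continuous.integrable_of_hasCompactSupport hasCompactSupport_bump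

theorem moll_mem_Icc (hm : Measurable v) {a b : ℝ} (h : ∀ x, v x ∈ Icc a b) (ε : ℝ) (x : Rn n) :
    moll ε v x ∈ Icc a b := by
  have hb : ∀ x, |v x| ≤ max |a| |b| := fun x => abs_le_max_abs_abs (h x).1 (h x).2
  have hi := integrable_bump_mul hm hb x ε
  constructor
  · calc a = ∫ y, a * bump n y := by rw [integral_const_mul, integral_bump, mul_one]
      _ ≤ _ := integral_mono (integrable_bump.const_mul a) hi fun y =>
        mul_le_mul_of_nonneg_right (h _).1 (meanPair_bump.nonneg y)
  · calc moll ε v x ≤ ∫ y, b * bump n y :=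
        integral_mono hi (integrable_bump.const_mul b) fun y =>
          mul_le_mul_of_nonneg_right (h _).2 (meanPair_bump.nonneg y)
      _ = b := by rw [integral_const_mul, integral_bump, mul_one]

theorem abs_moll_le (hm : Measurable v) (hb : ∀ x, |v x| ≤ C) (ε : ℝ) (x : Rn n) :
    |moll ε v x| ≤ C :=
  abs_le.2 (moll_mem_Icc hm (fun x => abs_le.1 (hb x)) ε x)

theorem moll_const (c ε : ℝ) (x : Rn n) : moll ε (fun _ => c) x = c := by
  simp [moll, wmean, integral_const_mul, integral_bump]

theorem moll_neg (ε : ℝ) (x : Rn n) : moll ε (fun y => - v y) x = - moll ε v x := by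
  simp [moll, wmean, integral_neg]

/-- Mollifications converge almost everywhere. -/
theorem ae_tendsto_moll (hm : Measurable v) (hb : ∀ x, |v x| ≤ C) :
    ∀ᵐ x, Tendsto (fun ε => moll ε v x) (𝓝[>] 0) (𝓝 (v x)) := by
  have hL := IsUnifLocDoublingMeasure.ae_tendsto_average_norm_sub (volume : Measure (Rn n))
    (locallyIntegrable_of_bdd hm hb) 1
  obtain ⟨K, hK⟩ := (meanPair_bump (n := n)).bdd
  have hK0 : 0 ≤ K := (abs_nonneg _).trans (hK 0)
  filter_upwards [hL] with x hx
  have hx' := hx (fun _ : ℝ => x) (fun ε : ℝ => ε) (l := 𝓝[>] 0) tendsto_id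
    (by filter_upwards [self_mem_nhdsWithin] with ε (hε : 0 < ε)
        exact Metric.mem_closedBall_self (by linarith))
  rw [tendsto_iff_norm_sub_tendsto_zero]
  have hlim := hx'.const_mul (K * vball n)
  rw [mul_zero] at hlim
  refine squeeze_zero' (Eventually.of_forall fun _ => norm_nonneg _) ?_ hlim
  filter_upwards [self_mem_nhdsWithin] with ε (hε : 0 < ε)
  have hmd : Measurable fun z => |v z - v x| := by fun_prop
  have hbd : ∀ z, |v z - v x| ≤ 2 * C := fun z => by
    have := abs_sub (v z) (v x)
    linarith [hb z, hb x]
  have h1 : moll ε v x - v x = ∫ y, (v (x + ε • y) - v x) * bump n y := by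
    have hi := integrable_bump_mul hm hb x ε
    simp_rw [sub_mul]
    rw [integral_sub hi (integrable_bump.const_mul _), integral_const_mul, integral_bump, mul_one]
    rfl
  have hvol : volume.real (Metric.closedBall x ε) = ε ^ n * vball n := by
    rw [← volume_real_ball x hε, Measure.real, Measure.real, Measure.addHaar_closedBall_eq_addHaar_ball]
  have hii : IntegrableOn (fun z => |v z - v x|) (Metric.closedBall x ε) :=
    Measure.integrableOn_of_bounded (M := 2 * C) (isCompact_closedBall x ε).measure_lt_top.ne
      hmd.aestronglyMeasurable (Eventually.of_forall fun z => by simpa using hbd z)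
  rw [h1, setAverage_eq, hvol, smul_eq_mul]
  calc ‖∫ y, (v (x + ε • y) - v x) * bump n y‖
      ≤ ∫ y, ‖(v (x + ε • y) - v x) * bump n y‖ := norm_integral_le_integral_norm _
    _ = wmean (fun y => bump n y) (fun z => |v z - v x|) x ε := by
        refine integral_congr_ae (Eventually.of_forall fun y => ?_)
        simp [abs_of_nonneg (meanPair_bump.nonneg y)]
    _ = (ε ^ n)⁻¹ * ∫ z, |v z - v x| * bump n (ε⁻¹ • (z - x)) := wmean_eq_inv_mul _ _ _ hε
    _ ≤ (ε ^ n)⁻¹ * (K * ∫ z in Metric.closedBall x ε, |v z - v x|) := by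
        refine mul_le_mul_of_nonneg_left ?_ (by positivity)
        rw [← integral_const_mul, ← integral_indicator Metric.isClosed_closedBall.measurableSet]
        refine integral_mono_of_nonneg (Eventually.of_forall fun z =>
          mul_nonneg (abs_nonneg _) (meanPair_bump.nonneg _)) ?_ (Eventually.of_forall fun z => ?_)
        · rw [integrable_indicator_iff Metric.isClosed_closedBall.measurableSet]
          exact hii.const_mul K
        · by_cases hz : z ∈ Metric.closedBall x ε
          · simp only [indicator_of_mem hz]
            rw [mul_comm]
            exact mul_le_mul_of_nonneg_right ((le_abs_self _).trans (hK _)) (abs_nonneg _)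
          · have : 1 < ‖ε⁻¹ • (z - x)‖ := by
              rw [mem_closedBall_iff_norm, not_le] at hz
              rw [norm_smul, norm_inv, Real.norm_of_nonneg hε.le, lt_inv_mul_iff₀ hε]
              linarith
            simp [meanPair_bump.supp _ this, hz]
    _ = _ := by
        have := (vball_pos (n := n)).ne'
        simp only [Real.norm_eq_abs]
        field_simp

/-- Dominated convergence, for any weight of a mean pair; it serves for ball means as well as for
mollifications. -/
theorem tendsto_moll_of_ae {η Q : Rn n → ℝ} (h : MeanPair η Q) {ι : Type*} {l : Filter ι}
    [l.IsCountablyGenerated] {w : ι → Rn n → ℝ} (hw : ∀ i, Measurable (w i))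
    (hb : ∀ i x, |w i x| ≤ C) (hl : ∀ᵐ x, Tendsto (fun i => w i x) l (𝓝 (v x))) (x : Rn n) {ε : ℝ}
    (hε : 0 < ε) : Tendsto (fun i => wmean η (w i) x ε) l (𝓝 (wmean η v x ε)) := by
  obtain ⟨K, hK⟩ := h.bdd
  simp_rw [wmean_eq_inv_mul _ _ _ hε]
  refine Tendsto.const_mul _ ?_
  have hη : Integrable fun z => η (ε⁻¹ • (z - x)) := by
    have h1 : Integrable η := by
      simpa using h.integrable_mul (f := fun _ => (1 : ℝ)) continuous_const
    exact (h1.comp_smul (inv_ne_zero hε.ne')).comp_sub_right x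
  refine tendsto_integral_filter_of_dominated_convergence (fun z => C * |η (ε⁻¹ • (z - x))|)
    (Eventually.of_forall fun i => ((hw i).mul (h.meas.comp (by fun_prop))).aestronglyMeasurable)
    (Eventually.of_forall fun i => Eventually.of_forall fun z => ?_) (hη.abs.const_mul C) ?_
  · rw [norm_mul]
    exact mul_le_mul_of_nonneg_right (hb i z) (abs_nonneg _)
  · filter_upwards [hl] with z hz
    exact hz.mul_const _

/-- Averages with two weights commute. -/
theorem wmean_comm {η Q κ P : Rn n → ℝ} (h : MeanPair η Q) (h' : MeanPair κ P)
    (hm : Measurable v) (hb : ∀ x, |v x| ≤ C) (x : Rn n) (r s : ℝ) :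
    wmean η (fun y => wmean κ v y s) x r = wmean κ (fun y => wmean η v y r) x s := by
  have h1 : Integrable η := by
    simpa using h.integrable_mul (f := fun _ => (1 : ℝ)) continuous_const
  have h2 : Integrable κ := by
    simpa using h'.integrable_mul (f := fun _ => (1 : ℝ)) continuous_const
  have hmeas : Measurable fun p : Rn n × Rn n => v (x + r • p.1 + s • p.2) :=
    hm.comp (by fun_prop)
  have hint : Integrable (fun p : Rn n × Rn n => v (x + r • p.1 + s • p.2) * (η p.1 * κ p.2))
      (volume.prod volume) :=
    (h1.mul_prod h2).bdd_mul (c := C) hmeas.aestronglyMeasurable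
      (Eventually.of_forall fun p => hb _)
  have hswap := integral_integral_swap (μ := (volume : Measure (Rn n)))
    (ν := (volume : Measure (Rn n)))
    (f := fun y t => v (x + r • y + s • t) * (η y * κ t)) hint
  calc wmean η (fun y => wmean κ v y s) x r
      = ∫ y, ∫ t, v (x + r • y + s • t) * (η y * κ t) := by
        refine integral_congr_ae (Eventually.of_forall fun y => ?_)
        simp only [wmean]
        rw [← integral_mul_const]
        exact integral_congr_ae (Eventually.of_forall fun t => by simp only; ring)
    _ = _ := hswap
    _ = wmean κ (fun y => wmean η v y r) x s := by
        refine integral_congr_ae (Eventually.of_forall fun t => ?_)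
        simp only [wmean]
        rw [← integral_mul_const]
        refine integral_congr_ae (Eventually.of_forall fun y => ?_)
        simp only
        rw [add_right_comm]; ring

end CapPot

/-! ### Mollifying functions with a one-sided mean value property. -/

namespace CapPot
open scoped ContDiff

variable {n : ℕ} [NeZero n] {v : Rn n → ℝ} {C : ℝ} {D : Set (Rn n)}

/-! ### Local super-mean-value property -/

/-- `v` is at least its mean over the balls that are contained, with their closure, in `D`. -/
def SuperMeanOn (v : Rn n → ℝ) (D : Set (Rn n)) : Prop :=
  ∀ x r, 0 < r → Metric.closedBall x r ⊆ D → ⨍ y in Metric.ball x r, v y ≤ v x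

theorem Superharmonic.superMeanOn (h : Superharmonic v) (D : Set (Rn n)) : SuperMeanOn v D :=
  fun x r hr _ => h.mean_le x r hr

theorem average_ball_eq (u : Rn n → ℝ) (x : Rn n) {r : ℝ} (hr : 0 < r) :
    ⨍ y in Metric.ball x r, u y = (vball n)⁻¹ * wmean (ballWt n) u x r := by
  rw [wmean_ballWt _ _ hr, inv_mul_cancel_left₀ vball_pos.ne']

theorem integral_ballWt : ∫ y, ballWt n y = vball n := by
  simp only [ballWt]
  rw [integral_indicator Metric.isOpen_ball.measurableSet]
  simp [vball, Measure.real]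

theorem average_ball_moll (hm : Measurable v) (hb : ∀ x, |v x| ≤ C) (x : Rn n) {r : ℝ}
    (hr : 0 < r) (ε : ℝ) : ⨍ y in Metric.ball x r, moll ε v y
      = moll ε (fun y => ⨍ z in Metric.ball y r, v z) x := by
  rw [average_ball_eq _ _ hr]
  simp_rw [average_ball_eq v _ hr]
  have : wmean (ballWt n) (moll ε v) x r = _ :=
    wmean_comm meanPair_ball meanPair_bump hm hb x r ε
  rw [this]
  simp only [moll, wmean]
  rw [← integral_const_mul]
  exact integral_congr_ae (Eventually.of_forall fun y => by simp only; ring)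

theorem measurable_wmean {η Q : Rn n → ℝ} (h : MeanPair η Q) (hm : Measurable v) (r : ℝ) :
    Measurable fun x => wmean η v x r := by
  have : StronglyMeasurable fun p : Rn n × Rn n => v (p.1 + r • p.2) * η p.2 :=
    ((hm.comp (by fun_prop)).mul (h.meas.comp measurable_snd)).stronglyMeasurable
  exact (this.integral_prod_right (ν := (volume : Measure (Rn n)))).measurable

theorem abs_average_ball_le (hm : Measurable v) (hb : ∀ x, |v x| ≤ C) (x : Rn n) {r : ℝ}
    (hr : 0 < r) : |⨍ y in Metric.ball x r, v y| ≤ C := by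
  rw [average_ball_eq _ _ hr, abs_mul, abs_of_pos (inv_pos.2 vball_pos), inv_mul_le_iff₀ vball_pos]
  have hi : Integrable (ballWt n) := by
    simpa using meanPair_ball.integrable_mul (f := fun _ => (1 : ℝ)) continuous_const
  calc |wmean (ballWt n) v x r| ≤ ∫ y, ‖v (x + r • y) * ballWt n y‖ := by
        rw [← Real.norm_eq_abs]; exact norm_integral_le_integral_norm _
    _ ≤ ∫ y, C * ballWt n y := by
        refine integral_mono
          (meanPair_ball.integrable_bdd_mul (measurable_comp_add_smul hm x r) fun _ => hb _).norm
          (hi.const_mul C) fun y => ?_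
        simp only [norm_mul, Real.norm_eq_abs]
        rw [abs_of_nonneg (meanPair_ball.nonneg y)]
        exact mul_le_mul_of_nonneg_right (hb _) (meanPair_ball.nonneg y)
    _ = vball n * C := by rw [integral_const_mul, integral_ballWt, mul_comm]

theorem moll_mono_on {v w : Rn n → ℝ} (hv : Measurable v) (hb : ∀ x, |v x| ≤ C)
    (hw : Measurable w) {K : ℝ} (hbw : ∀ x, |w x| ≤ K) {x : Rn n} {ε : ℝ} (hε : 0 ≤ ε)
    (h : ∀ y ∈ Metric.closedBall x ε, v y ≤ w y) : moll ε v x ≤ moll ε w x :=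
  wmean_mono_of_le meanPair_bump.nonneg (integrable_bump_mul hv hb x ε)
    (integrable_bump_mul hw hbw x ε)
    (fun _ hy => h _ (add_smul_mem_closedBall hε le_rfl hy)) meanPair_bump.supp

/-- Ball means commute with mollification (`average_ball_moll`), so the inequality for `v` is
averaged over centres within `ε` of `x`; this is why a margin `ε` inside `D` is required. -/
theorem SuperMeanOn.moll (h : SuperMeanOn v D) (hm : Measurable v) (hb : ∀ x, |v x| ≤ C)
    {x : Rn n} {r ε : ℝ} (hr : 0 < r) (hε : 0 ≤ ε) (hx : Metric.closedBall x (r + ε) ⊆ D) :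
    ⨍ y in Metric.ball x r, CapPot.moll ε v y ≤ CapPot.moll ε v x := by
  rw [average_ball_moll hm hb x hr]
  refine moll_mono_on (C := C) ?_ (fun y => abs_average_ball_le hm hb y hr) hm hb hε
    fun y hy => h y r hr ((Metric.closedBall_subset_closedBall' ?_).trans hx)
  · simp_rw [average_ball_eq v _ hr]
    exact (measurable_wmean meanPair_ball hm r).const_mul _
  · rw [Metric.mem_closedBall] at hy
    linarith

theorem SuperMeanOn.lap_moll_nonpos (h : SuperMeanOn v D) (hm : Measurable v)
    (hb : ∀ x, |v x| ≤ C) {x : Rn n} {ε ρ : ℝ} (hε : 0 < ε) (hερ : ε < ρ)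
    (hx : Metric.closedBall x ρ ⊆ D) : lap (CapPot.moll ε v) x ≤ 0 :=
  lap_nonpos_of_average_le (contDiff_moll hε (locallyIntegrable_of_bdd hm hb)) (sub_pos.2 hερ)
    fun r hr hr' => h.moll hm hb hr hε.le
      ((Metric.closedBall_subset_closedBall (by linarith)).trans hx)

theorem measurable_moll {ε : ℝ} (hm : Measurable v) : Measurable (moll ε v) :=
  measurable_wmean meanPair_bump hm ε

/-- A second mollification at scale `δ` makes the function smooth and superharmonic near `x`, where
the derivative formula applies; then `δ → 0`. -/
theorem SuperMeanOn.moll_antitone (h : SuperMeanOn v D) (hm : Measurable v)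
    (hb : ∀ x, |v x| ≤ C) {x : Rn n} {ε ε' ρ : ℝ} (hε : 0 < ε) (hεε' : ε ≤ ε') (hε'ρ : ε' < ρ)
    (hx : Metric.closedBall x ρ ⊆ D) : CapPot.moll ε' v x ≤ CapPot.moll ε v x := by
  have hae := ae_tendsto_moll hm hb
  have ht : ∀ s, 0 < s → Tendsto (fun δ => CapPot.moll s (CapPot.moll δ v) x) (𝓝[>] 0)
      (𝓝 (CapPot.moll s v x)) := fun s hs =>
    tendsto_moll_of_ae (C := C) meanPair_bump (fun δ => measurable_moll hm)
      (fun δ => abs_moll_le hm hb δ) hae x hs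
  refine le_of_tendsto_of_tendsto (ht ε' (hε.trans_le hεε')) (ht ε hε) ?_
  filter_upwards [Ioo_mem_nhdsGT (sub_pos.2 hε'ρ)] with δ hδ
  refine meanPair_bump.antitoneOn (R := ε')
    (contDiff_moll hδ.1 (locallyIntegrable_of_bdd hm hb)) (fun y hy => ?_)
    ⟨hε.le, hεε'⟩ ⟨hε.le.trans hεε', le_rfl⟩ hεε'
  refine h.lap_moll_nonpos hm hb (ρ := ρ - ε') hδ.1 hδ.2
    ((Metric.closedBall_subset_closedBall' ?_).trans hx)
  rw [Metric.mem_closedBall] at hy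
  linarith

theorem tendsto_average_ball {u : Rn n → ℝ} (hu : ContDiff ℝ ∞ u) (x : Rn n) :
    Tendsto (fun r => ⨍ y in Metric.ball x r, u y) (𝓝[>] 0) (𝓝 (u x)) := by
  have h1 : Tendsto (wmean (ballWt n) u x) (𝓝 0) (𝓝 (u x * vball n)) := by
    have := (meanPair_ball.hasDerivAt hu x 0).continuousAt.tendsto
    rwa [wmean_zero, integral_ballWt] at this
  have h2 := (h1.mono_left (nhdsWithin_le_nhds (s := Ioi 0))).const_mul (vball n)⁻¹
  have h3 : (vball n)⁻¹ * (u x * vball n) = u x := by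
    have := (vball_pos (n := n)).ne'
    field_simp
  rw [h3] at h2
  refine h2.congr' ?_
  filter_upwards [self_mem_nhdsWithin] with r hr
  rw [average_ball_eq _ _ hr]

theorem integrableOn_ball_of_bdd (hm : Measurable v) (hb : ∀ x, |v x| ≤ C) (x : Rn n) (r : ℝ) :
    IntegrableOn v (Metric.ball x r) :=
  Measure.integrableOn_of_bounded (M := C) measure_ball_lt_top.ne hm.aestronglyMeasurable
    (Eventually.of_forall hb)

theorem average_ball_mono_ae {v w : Rn n → ℝ} {x : Rn n} {r : ℝ}
    (hv : IntegrableOn v (Metric.ball x r)) (hw : IntegrableOn w (Metric.ball x r))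
    (h : ∀ᵐ y, y ∈ Metric.ball x r → v y ≤ w y) :
    ⨍ y in Metric.ball x r, v y ≤ ⨍ y in Metric.ball x r, w y := by
  rw [setAverage_eq, setAverage_eq]
  refine mul_le_mul_of_nonneg_left ?_ (inv_nonneg.2 measureReal_nonneg)
  exact setIntegral_mono_on_ae hv hw Metric.isOpen_ball.measurableSet h

/-- The inequality is clear almost everywhere, since the mollifications increase to `v` there as the
scale shrinks. It passes to every point because the smooth `moll ε v` is the limit of its means over
small balls, and these are at most the means of `v`, hence at most `v x`. -/
theorem SuperMeanOn.moll_le (h : SuperMeanOn v D) (hm : Measurable v)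
    (hb : ∀ x, |v x| ≤ C) {x : Rn n} {ε ρ : ℝ} (hε : 0 < ε) (hερ : ε < ρ)
    (hx : Metric.closedBall x ρ ⊆ D) : CapPot.moll ε v x ≤ v x := by
  have hsm := contDiff_moll hε (locallyIntegrable_of_bdd hm hb)
  refine le_of_tendsto (tendsto_average_ball hsm x) ?_
  filter_upwards [Ioo_mem_nhdsGT (sub_pos.2 hερ)] with r hr
  refine le_trans (average_ball_mono_ae
    (integrableOn_ball_of_bdd hsm.continuous.measurable (abs_moll_le hm hb ε) x r)
    (integrableOn_ball_of_bdd hm hb x r) ?_)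
    (h x r hr.1 ((Metric.closedBall_subset_closedBall (by linarith [hr.2])).trans hx))
  filter_upwards [ae_tendsto_moll hm hb] with y hy hyr
  refine ge_of_tendsto hy ?_
  filter_upwards [Ioo_mem_nhdsGT hε] with δ hδ
  refine h.moll_antitone hm hb (ρ := ρ - r) hδ.1 hδ.2.le (by linarith [hr.2])
    ((Metric.closedBall_subset_closedBall' ?_).trans hx)
  rw [Metric.mem_ball] at hyr
  linarith

/-- Mollifications of a lower semicontinuous function with the super-mean-value property
converge everywhere. -/
theorem SuperMeanOn.tendsto_moll (h : SuperMeanOn v D) (hl : LowerSemicontinuous v)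
    (hb : ∀ x, |v x| ≤ C) {x : Rn n} {ρ : ℝ} (hρ : 0 < ρ) (hx : Metric.closedBall x ρ ⊆ D) :
    Tendsto (fun ε => CapPot.moll ε v x) (𝓝[>] 0) (𝓝 (v x)) := by
  have hm := hl.measurable
  refine tendsto_order.2 ⟨fun a ha => ?_, fun a ha => ?_⟩
  · obtain ⟨a', ha', ha'v⟩ := exists_between ha
    obtain ⟨τ, hτ, hball⟩ := Metric.eventually_nhds_iff_ball.1 (hl x a' ha'v)
    filter_upwards [Ioo_mem_nhdsGT hτ] with ε hε
    calc a < a' := ha'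
      _ = CapPot.moll ε (fun _ => a') x := (moll_const a' ε x).symm
      _ ≤ CapPot.moll ε v x := moll_mono_on measurable_const (fun _ => le_rfl) hm hb hε.1.le
          fun y hy => (hball y (Metric.closedBall_subset_ball hε.2 hy)).le
  · filter_upwards [Ioo_mem_nhdsGT hρ] with ε hε
    exact (h.moll_le hm hb hε.1 hε.2 hx).trans_lt ha

/-! ### Functions with the mean value property -/

theorem SuperMeanOn.moll_eq (h : SuperMeanOn v D) (h' : SuperMeanOn (fun y => - v y) D)
    (hm : Measurable v) (hb : ∀ x, |v x| ≤ C) {x : Rn n} {ε ρ : ℝ} (hε : 0 < ε) (hερ : ε < ρ)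
    (hx : Metric.closedBall x ρ ⊆ D) : CapPot.moll ε v x = v x := by
  refine le_antisymm (h.moll_le hm hb hε hερ hx) ?_
  have := h'.moll_le hm.neg (C := C) (fun x => by simpa using hb x) hε hερ hx
  rw [moll_neg] at this
  linarith

theorem SuperMeanOn.lap_moll_eq_zero (h : SuperMeanOn v D)
    (h' : SuperMeanOn (fun y => - v y) D)
    (hm : Measurable v) (hb : ∀ x, |v x| ≤ C) {x : Rn n} {ε ρ : ℝ} (hε : 0 < ε) (hερ : ε < ρ)
    (hx : Metric.closedBall x ρ ⊆ D) : lap (CapPot.moll ε v) x = 0 := by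
  refine le_antisymm (h.lap_moll_nonpos hm hb hε hερ hx) ?_
  have := h'.lap_moll_nonpos hm.neg (C := C) (fun x => by simpa using hb x) hε hερ hx
  have e : CapPot.moll ε (fun y => - v y) = fun y => -1 * CapPot.moll ε v y := by
    ext y; rw [moll_neg]; ring
  rw [e, lap_const_mul (contDiff_moll hε (locallyIntegrable_of_bdd hm hb))] at this
  linarith

/-- With both inequalities a function coincides locally with its mollification, hence is smooth, and
the Laplacian of that mollification vanishes. -/
theorem SuperMeanOn.harmonicAt (h : SuperMeanOn v D) (h' : SuperMeanOn (fun y => - v y) D)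
    (hm : Measurable v) (hb : ∀ x, |v x| ≤ C) {x : Rn n} (hx : D ∈ 𝓝 x) :
    InnerProductSpace.HarmonicAt v x := by
  obtain ⟨ρ, hρ, hball⟩ := Metric.nhds_basis_closedBall.mem_iff.1 hx
  set ε := ρ / 4 with hε
  have hε0 : 0 < ε := by positivity
  have hsm := contDiff_moll hε0 (locallyIntegrable_of_bdd hm hb)
  have hsub : ∀ y ∈ Metric.ball x ε, Metric.closedBall y (2 * ε) ⊆ D := fun y hy =>
    (Metric.closedBall_subset_closedBall' (by rw [Metric.mem_ball] at hy; linarith)).trans hball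
  have heq : CapPot.moll ε v =ᶠ[𝓝 x] v := by
    filter_upwards [Metric.ball_mem_nhds x hε0] with y hy
    exact h.moll_eq h' hm hb hε0 (by linarith) (hsub y hy)
  rw [← InnerProductSpace.harmonicAt_congr_nhds heq]
  refine ⟨(contDiff_infty.1 hsm 2).contDiffAt, ?_⟩
  filter_upwards [Metric.ball_mem_nhds x hε0] with y hy
  rw [laplacian_eq_lap ((contDiff_infty.1 hsm 2).contDiffAt)]
  exact h.lap_moll_eq_zero h' hm hb hε0 (by linarith) (hsub y hy)

end CapPot

/-! ### The fundamental solution, Newton potentials and their expansion at infinity. -/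

namespace CapPot
open scoped ContDiff

variable {n : ℕ}

/-! ### The fundamental solution -/

/-- The constant in the fundamental solution. -/
noncomputable def fundConst (n : ℕ) : ℝ := 1 / ((n : ℝ) * ((n : ℝ) - 2) * vball n)

theorem fundSol_eq (x : Rn n) : fundSol n x = fundConst n * (‖x‖ ^ (n - 2))⁻¹ := by
  simp [fundSol, fundConst, vball]

theorem fundSol_neg (x : Rn n) : fundSol n (-x) = fundSol n x := by simp [fundSol_eq]

theorem hasDerivAt_inv_pow_succ (k : ℕ) {r : ℝ} (hr : r ≠ 0) :
    HasDerivAt (fun r : ℝ => (r ^ (k + 1))⁻¹) (-((k : ℝ) + 1) * (r ^ (k + 2))⁻¹) r := by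
  have h := (hasDerivAt_pow (k + 1) r).inv (pow_ne_zero _ hr)
  refine h.congr_deriv ?_
  push_cast
  field_simp
  ring

theorem tendsto_inv_pow_atTop (k : ℕ) : Tendsto (fun r : ℝ => (r ^ (k + 1))⁻¹) atTop (𝓝 0) :=
  tendsto_inv_atTop_zero.comp (tendsto_pow_atTop k.succ_ne_zero)

/-- The radial integral that produces the fundamental solution from the potentials of balls. -/
theorem integral_radial (k : ℕ) {a : ℝ} (ha : 0 < a) :
    IntegrableOn (fun r : ℝ => r * ((r ^ (k + 3))⁻¹ * ((1 - (a / r) ^ 2) / 2))) (Ioi a) ∧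
    ∫ r in Ioi a, r * ((r ^ (k + 3))⁻¹ * ((1 - (a / r) ^ 2) / 2))
      = (((k : ℝ) + 3) * (k + 1))⁻¹ * (a ^ (k + 1))⁻¹ := by
  let g : ℝ → ℝ := fun r => -(1 / (2 * ((k : ℝ) + 1))) * (r ^ (k + 1))⁻¹
    + a ^ 2 / (2 * ((k : ℝ) + 3)) * (r ^ (k + 3))⁻¹
  have hd : ∀ r ∈ Ici a, HasDerivAt g (r * ((r ^ (k + 3))⁻¹ * ((1 - (a / r) ^ 2) / 2))) r := by
    intro r hr
    have hr0 : r ≠ 0 := (ha.trans_le hr).ne'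
    refine (((hasDerivAt_inv_pow_succ k hr0).const_mul _).add
      ((hasDerivAt_inv_pow_succ (k + 2) hr0).const_mul _)).congr_deriv ?_
    push_cast
    have h1 : (k : ℝ) + 1 ≠ 0 := by positivity
    have h2 : (k : ℝ) + 3 ≠ 0 := by positivity
    have h3 : (k : ℝ) + 2 + 1 ≠ 0 := by positivity
    field_simp
    ring
  have hn : ∀ r ∈ Ioi a, 0 ≤ r * ((r ^ (k + 3))⁻¹ * ((1 - (a / r) ^ 2) / 2)) := by
    intro r hr
    have hr0 : 0 < r := ha.trans hr
    have h1 : a / r ≤ 1 := (div_le_one hr0).2 (le_of_lt hr)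
    have h2 : 0 ≤ a / r := by positivity
    have h3 : 0 ≤ 1 - (a / r) ^ 2 := by nlinarith
    positivity
  have ht : Tendsto g atTop (𝓝 0) := by
    have := ((tendsto_inv_pow_atTop k).const_mul (-(1 / (2 * ((k : ℝ) + 1))))).add
      ((tendsto_inv_pow_atTop (k + 2)).const_mul (a ^ 2 / (2 * ((k : ℝ) + 3))))
    rw [mul_zero, mul_zero, add_zero] at this
    exact this
  refine ⟨integrableOn_Ioi_deriv_of_nonneg' hd hn ht, ?_⟩
  rw [integral_Ioi_of_hasDerivAt_of_nonneg' hd hn ht]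
  have h1 : (k : ℝ) + 1 ≠ 0 := by positivity
  have h2 : (k : ℝ) + 3 ≠ 0 := by positivity
  simp only [g]
  field_simp
  ring

theorem ballPot_smul {r : ℝ} {z : Rn n} (hr : 0 < r) :
    (‖z‖ < r → ballPot n (r⁻¹ • z) = (1 - (‖z‖ / r) ^ 2) / 2) ∧
    (r ≤ ‖z‖ → ballPot n (r⁻¹ • z) = 0) := by
  have h : ‖r⁻¹ • z‖ = ‖z‖ / r := by
    rw [norm_smul, norm_inv, Real.norm_of_nonneg hr.le, inv_mul_eq_div]
  constructor
  · intro hz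
    rw [ballPot, h, min_eq_left ((div_le_one hr).2 hz.le)]
  · intro hz
    exact ballPot_of_one_le (by rw [h]; exact (one_le_div hr).2 hz)

variable [h3 : Fact (3 ≤ n)]

theorem two_lt_cast : (2 : ℝ) < n := by
  have := h3.out
  exact_mod_cast (by omega : 2 < n)

theorem fundConst_pos : 0 < fundConst n := by
  have := two_lt_cast (n := n)
  have h1 : (0 : ℝ) < n - 2 := by linarith
  have h2 : (0 : ℝ) < n := by linarith
  exact one_div_pos.2 (mul_pos (mul_pos h2 h1) vball_pos)

theorem fundSol_nonneg (x : Rn n) : 0 ≤ fundSol n x := by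
  rw [fundSol_eq]
  have := fundConst_pos (n := n)
  positivity

theorem fundSol_pos {x : Rn n} (hx : x ≠ 0) : 0 < fundSol n x := by
  rw [fundSol_eq]
  have := fundConst_pos (n := n)
  have := norm_pos_iff.2 hx
  positivity

/-- In polar coordinates the integrand is a constant times `t ^ (n - 1) / t ^ (n - 2) = t`. -/
theorem locallyIntegrable_fundSol : LocallyIntegrable (fundSol n) := by
  rw [locallyIntegrable_iff]
  intro K hK
  obtain ⟨r, hr⟩ := hK.isBounded.subset_ball (0 : Rn n)
  refine IntegrableOn.mono_set ?_ hr
  have := (integrableOn_fun_norm_addHaar (volume : Measure (Rn n)) (r := r)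
    (f := fun t : ℝ => fundConst n * (t ^ (n - 2))⁻¹)).2 ?_
  · exact this.congr_fun (fun x _ => (fundSol_eq x).symm) measurableSet_ball
  · have h1 : IntegrableOn (fun y : ℝ => fundConst n * y) (Ioo 0 r) :=
      ((continuous_const.mul continuous_id).continuousOn.integrableOn_compact
        (isCompact_Icc (a := (0:ℝ)) (b := r))).mono_set Ioo_subset_Icc_self
    refine h1.congr_fun (fun y hy => ?_) measurableSet_Ioo
    have hy0 : y ≠ 0 := hy.1.ne'
    have hn := h3.out
    obtain ⟨k, rfl⟩ : ∃ k, n = k + 3 := ⟨n - 3, by omega⟩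
    simp only [finrank_euclideanSpace, Fintype.card_fin, smul_eq_mul]
    have e1 : k + 3 - 1 = k + 2 := by omega
    have e2 : k + 3 - 2 = k + 1 := by omega
    rw [e1, e2]
    field_simp
    ring

/-- Superposition of the potentials of all balls centred at the origin. -/
theorem integral_ballPot {z : Rn n} (hz : z ≠ 0) :
    IntegrableOn (fun r : ℝ => r * ((r ^ n)⁻¹ * ballPot n (r⁻¹ • z))) (Ioi 0) ∧
    ∫ r in Ioi (0 : ℝ), r * ((r ^ n)⁻¹ * ballPot n (r⁻¹ • z)) = vball n * fundSol n z := by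
  have hz0 : 0 < ‖z‖ := norm_pos_iff.2 hz
  obtain ⟨k, hk⟩ : ∃ k, n = k + 3 := ⟨n - 3, by have := h3.out; omega⟩
  obtain ⟨hi, he⟩ := integral_radial k hz0
  rw [← hk] at hi he
  have hset : ∀ r : ℝ, (Ioi (0 : ℝ)).indicator
      (fun r : ℝ => r * ((r ^ n)⁻¹ * ballPot n (r⁻¹ • z))) r
      = (Ioi ‖z‖).indicator (fun r : ℝ => r * ((r ^ n)⁻¹ * ((1 - (‖z‖ / r) ^ 2) / 2))) r := by
    intro r
    by_cases h1 : ‖z‖ < r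
    · have h0 : 0 < r := hz0.trans h1
      rw [indicator_of_mem (show r ∈ Ioi 0 from h0), indicator_of_mem (show r ∈ Ioi ‖z‖ from h1),
        (ballPot_smul h0).1 h1]
    · rw [indicator_of_notMem (show r ∉ Ioi ‖z‖ from h1)]
      by_cases h0 : 0 < r
      · rw [indicator_of_mem (show r ∈ Ioi 0 from h0), (ballPot_smul h0).2 (not_lt.1 h1)]
        simp
      · rw [indicator_of_notMem (show r ∉ Ioi 0 from h0)]
  have hset' := funext hset
  constructor
  · rw [← integrable_indicator_iff measurableSet_Ioi, hset',
      integrable_indicator_iff measurableSet_Ioi]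
    exact hi
  · rw [← integral_indicator measurableSet_Ioi, hset', integral_indicator measurableSet_Ioi, he,
      fundSol_eq, fundConst]
    have h1 := (vball_pos (n := n)).ne'
    have h2 : n - 2 = k + 1 := by omega
    have h4 : (n : ℝ) = k + 3 := by rw [hk]; push_cast; ring
    rw [h2, h4]
    have e : (k : ℝ) + 3 - 2 = k + 1 := by ring
    rw [e]
    field_simp

theorem tendsto_wmean_ballWt_atTop {g : Rn n → ℝ} (hg : Continuous g)
    (hc : HasCompactSupport g) (x : Rn n) :
    Tendsto (wmean (ballWt n) g x) atTop (𝓝 0) := by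
  have h0 : Tendsto (fun r : ℝ => (r ^ n)⁻¹ * ∫ z, |g z|) atTop (𝓝 0) := by
    have := (tendsto_inv_atTop_zero.comp (tendsto_pow_atTop (α := ℝ) (NeZero.ne n))).mul_const
      (∫ z, |g z|)
    simpa using this
  refine squeeze_zero_norm' ?_ h0
  filter_upwards [eventually_gt_atTop 0] with r hr
  rw [wmean_eq_inv_mul _ _ _ hr, norm_mul, Real.norm_of_nonneg (by positivity)]
  refine mul_le_mul_of_nonneg_left ((norm_integral_le_integral_norm _).trans ?_) (by positivity)
  have hi := hg.integrable_of_hasCompactSupport hc (μ := volume)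
  refine integral_mono_of_nonneg (Eventually.of_forall fun z => norm_nonneg _) hi.abs
    (Eventually.of_forall fun z => ?_)
  simp only [norm_mul, Real.norm_eq_abs]
  refine mul_le_of_le_one_right (abs_nonneg _) ?_
  rw [abs_of_nonneg (meanPair_ball.nonneg _)]
  exact indicator_apply_le' (fun _ => le_rfl) (fun _ => zero_le_one)

/-- The derivative formula for ball means is integrated over all radii. Ball integrals at unit scale
go from `g x * vball n` at radius zero to `0` at infinity, while Fubini and `integral_ballPot`
convert the integrated potentials into `vball n * fundSol n`. -/
theorem integral_fundSol_mul_lap {g : Rn n → ℝ} (hg : ContDiff ℝ ∞ g) (hc : HasCompactSupport g)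
    (x : Rn n) : ∫ z, fundSol n z * lap g (x + z) = - g x := by
  have hlc : Continuous (lap g) := (contDiff_lap hg).continuous
  have hls := hasCompactSupport_lap hc
  have hlc' : Continuous fun z => lap g (x + z) := hlc.comp (by fun_prop)
  have hls' : HasCompactSupport fun z => lap g (x + z) := hls.comp_homeomorph (Homeomorph.addLeft x)
  let F : ℝ × Rn n → ℝ := fun p =>
    p.1 * ((p.1 ^ n)⁻¹ * ballPot n (p.1⁻¹ • p.2)) * lap g (x + p.2)
  have hFm : Measurable F := by
    have h1 : Measurable (ballPot n) := lipschitzWith_ballPot.continuous.measurable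
    have h2 : Measurable (fun p : ℝ × Rn n => ballPot n (p.1⁻¹ • p.2)) := h1.comp (by fun_prop)
    have h4 : Measurable (fun p : ℝ × Rn n => lap g (x + p.2)) := hlc'.measurable.comp measurable_snd
    exact (measurable_fst.mul (((measurable_fst.pow_const n).inv).mul h2)).mul h4
  have hne : ∀ᵐ z : Rn n, z ≠ 0 := by
    rw [ae_iff]
    simp
  have hFi : Integrable F ((volume.restrict (Ioi (0 : ℝ))).prod volume) := by
    rw [integrable_prod_iff' hFm.aestronglyMeasurable]
    constructor
    · filter_upwards [hne] with z hz
      exact (integral_ballPot hz).1.mul_const (lap g (x + z))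
    · have h1 : Integrable fun z => vball n * (fundSol n z * |lap g (x + z)|) :=
        (integrable_mul_of_compact locallyIntegrable_fundSol hlc'.abs
          (hls'.comp_left (g := fun t : ℝ => |t|) abs_zero)).const_mul _
      refine h1.congr ?_
      filter_upwards [hne] with z hz
      rw [← mul_assoc, ← (integral_ballPot hz).2, ← integral_mul_const]
      refine setIntegral_congr_fun measurableSet_Ioi fun r (hr : 0 < r) => ?_
      simp only [F]
      rw [norm_mul, Real.norm_eq_abs (lap g (x + z)), Real.norm_of_nonneg]
      have := ballPot_nonneg (r⁻¹ • z)
      positivity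
  have hswap := integral_integral_swap (f := fun r z => F (r, z)) hFi
  have hinner : ∀ r : ℝ, 0 < r → ∫ z, F (r, z) = r * ∫ y, lap g (x + r • y) * ballPot n y := by
    intro r hr
    have h1 : ∫ y, lap g (x + r • y) * ballPot n y
        = (r ^ n)⁻¹ * ∫ z, lap g (x + z) * ballPot n (r⁻¹ • z) := by
      rw [← integral_comp_add_smul (fun z => lap g (x + z) * ballPot n (r⁻¹ • z)) 0 hr]
      simp [smul_smul, hr.ne']
    rw [h1, ← mul_assoc, ← integral_const_mul]
    exact integral_congr_ae (Eventually.of_forall fun z => by simp only [F]; ring)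
  have hM := meanPair_ball (n := n)
  have hint : IntegrableOn (fun r : ℝ => r * ∫ y, lap g (x + r • y) * ballPot n y) (Ioi 0) := by
    have : IntegrableOn (fun r : ℝ => ∫ z, F (r, z)) (Ioi 0) := hFi.integral_prod_left
    exact this.congr_fun (fun r hr => hinner r hr) measurableSet_Ioi
  have hftc := integral_Ioi_of_hasDerivAt_of_tendsto
    (hM.hasDerivAt hg x 0).continuousAt.continuousWithinAt
    (fun r _ => hM.hasDerivAt hg x r) hint (tendsto_wmean_ballWt_atTop hg.continuous hc x)
  rw [wmean_zero, integral_ballWt] at hftc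
  have e1 : ∫ r in Ioi (0 : ℝ), ∫ z, F (r, z) = 0 - g x * vball n := by
    rw [← hftc]
    exact setIntegral_congr_fun measurableSet_Ioi fun r hr => hinner r hr
  have e2 : ∫ z, ∫ r in Ioi (0 : ℝ), F (r, z) = vball n * ∫ z, fundSol n z * lap g (x + z) := by
    rw [← integral_const_mul]
    refine integral_congr_ae ?_
    filter_upwards [hne] with z hz
    simp only [F]
    rw [integral_mul_const, (integral_ballPot hz).2, mul_assoc]
  have h0 := (vball_pos (n := n)).ne'
  have : vball n * ∫ z, fundSol n z * lap g (x + z) = vball n * (- g x) := by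
    rw [← e2, ← hswap, e1]; ring
  exact mul_left_cancel₀ h0 this

/-! ### The Newton potential -/

/-- The Newton potential of a function. -/
noncomputable def newton (g : Rn n → ℝ) : Rn n → ℝ := conv (fundSol n) g

theorem contDiff_newton {g : Rn n → ℝ} (hg : ContDiff ℝ ∞ g) (hc : HasCompactSupport g) :
    ContDiff ℝ ∞ (newton g) := contDiff_conv locallyIntegrable_fundSol hg hc

/-- The Laplacian falls on the smooth factor `g`, and `fundSol` is even. -/
theorem lap_newton {g : Rn n → ℝ} (hg : ContDiff ℝ ∞ g) (hc : HasCompactSupport g) (x : Rn n) :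
    lap (newton g) x = - g x := by
  rw [newton, lap_conv locallyIntegrable_fundSol hg hc, ← integral_fundSol_mul_lap hg hc x, conv,
    ← integral_neg_eq_self]
  simp [fundSol_neg]

theorem newton_nonneg {g : Rn n → ℝ} (h : ∀ x, 0 ≤ g x) (x : Rn n) : 0 ≤ newton g x :=
  integral_nonneg fun z => mul_nonneg (fundSol_nonneg z) (h _)

theorem newton_eq (g : Rn n → ℝ) (x : Rn n) : newton g x = ∫ y, fundSol n (x - y) * g y := by
  rw [newton, conv, ← integral_sub_left_eq_self _ _ x]
  simp

theorem integrable_newton {g : Rn n → ℝ} (hg : Continuous g) (hc : HasCompactSupport g)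
    (x : Rn n) : Integrable fun y => fundSol n (x - y) * g y := by
  have := (integrable_conv locallyIntegrable_fundSol hg hc x).comp_sub_left x
  simpa using this

/-- By homogeneity the quotient of the two values is a function of `‖x - y‖ / ‖x‖` alone, continuous
at `1`, and this ratio is within `L / R` of `1`. -/
theorem exists_fundSol_sub_close {δ : ℝ} (hδ : 0 < δ) (L : ℝ) :
    ∃ R, 0 < R ∧ L < R ∧ ∀ x y : Rn n, R ≤ ‖x‖ → ‖y‖ ≤ L →
      |fundSol n (x - y) - fundSol n x| ≤ δ * fundSol n x := by
  have hcont : ContinuousAt (fun t : ℝ => (t ^ (n - 2))⁻¹) 1 := by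
    refine ContinuousAt.inv₀ (by fun_prop) (by simp)
  obtain ⟨τ, hτ, hτb⟩ := Metric.continuousAt_iff.1 hcont δ hδ
  set R := max ((|L| + 1) / τ + 1) (|L| + 1) with hR
  have hR1 : |L| + 1 ≤ R := le_max_right _ _
  have hR2 : (|L| + 1) / τ < R := lt_of_lt_of_le (by linarith) (le_max_left _ _)
  have hL := le_abs_self L
  have hL0 := abs_nonneg L
  refine ⟨R, by linarith, by linarith, fun x y hx hy => ?_⟩
  have hx0 : 0 < ‖x‖ := by linarith
  have ht : |‖x - y‖ / ‖x‖ - 1| < τ := by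
    have h1 : ‖x - y‖ / ‖x‖ - 1 = (‖x - y‖ - ‖x‖) / ‖x‖ := by field_simp
    rw [h1, abs_div, abs_of_pos hx0, div_lt_iff₀ hx0]
    have h2 : |‖x - y‖ - ‖x‖| ≤ ‖y‖ := by
      have := abs_norm_sub_norm_le (x - y) x
      simpa using this
    rw [div_lt_iff₀ hτ] at hR2
    nlinarith
  have hb := hτb (by rw [Real.dist_eq]; exact ht)
  rw [Real.dist_eq, one_pow, inv_one] at hb
  have hfac : fundSol n (x - y) = fundSol n x * ((‖x - y‖ / ‖x‖) ^ (n - 2))⁻¹ := by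
    rw [fundSol_eq, fundSol_eq, div_pow, inv_div, div_eq_mul_inv]
    have : ‖x‖ ^ (n - 2) ≠ 0 := by positivity
    field_simp
  rw [hfac, show fundSol n x * ((‖x - y‖ / ‖x‖) ^ (n - 2))⁻¹ - fundSol n x
    = (((‖x - y‖ / ‖x‖) ^ (n - 2))⁻¹ - 1) * fundSol n x by ring, abs_mul,
    abs_of_nonneg (fundSol_nonneg x)]
  exact mul_le_mul_of_nonneg_right hb.le (fundSol_nonneg x)

/-- The error is relative to the total mass, so the radius depends on the support but not on the
density. -/
theorem exists_newton_close {δ : ℝ} (hδ : 0 < δ) (L : ℝ) :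
    ∃ R, 0 < R ∧ L < R ∧ ∀ f : Rn n → ℝ, Continuous f → HasCompactSupport f → (∀ y, 0 ≤ f y) →
      (∀ y, L < ‖y‖ → f y = 0) → ∀ x, R ≤ ‖x‖ →
      |newton f x - (∫ y, f y) * fundSol n x| ≤ δ * ((∫ y, f y) * fundSol n x) := by
  obtain ⟨R, hR, hLR, h⟩ := exists_fundSol_sub_close (n := n) hδ L
  refine ⟨R, hR, hLR, fun f hf hc hf0 hfL x hx => ?_⟩
  have hi := hf.integrable_of_hasCompactSupport hc (μ := volume)
  have h1 : newton f x - (∫ y, f y) * fundSol n x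
      = ∫ y, (fundSol n (x - y) - fundSol n x) * f y := by
    simp_rw [sub_mul]
    rw [newton_eq, integral_sub (integrable_newton hf hc x) (hi.const_mul _), integral_const_mul,
      mul_comm (∫ y, f y)]
  rw [h1]
  calc |∫ y, (fundSol n (x - y) - fundSol n x) * f y|
      ≤ ∫ y, ‖(fundSol n (x - y) - fundSol n x) * f y‖ := by
        rw [← Real.norm_eq_abs]; exact norm_integral_le_integral_norm _
    _ ≤ ∫ y, (δ * fundSol n x) * f y := by
        refine integral_mono_of_nonneg (Eventually.of_forall fun y => norm_nonneg _)
          (hi.const_mul _) (Eventually.of_forall fun y => ?_)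
        simp only [norm_mul, Real.norm_eq_abs]
        rw [abs_of_nonneg (hf0 y)]
        by_cases hy : ‖y‖ ≤ L
        · exact mul_le_mul_of_nonneg_right (h x y hx hy) (hf0 y)
        · simp [hfL y (not_le.1 hy)]
    _ = _ := by rw [integral_const_mul]; ring

theorem tendsto_fundSol : Tendsto (fundSol n) (Bornology.cobounded (Rn n)) (𝓝 0) := by
  have h1 : Tendsto (fun x : Rn n => ‖x‖) (Bornology.cobounded (Rn n)) atTop :=
    tendsto_norm_cobounded_atTop
  have hn := h3.out
  have h2 := ((tendsto_inv_atTop_zero.comp (tendsto_pow_atTop (α := ℝ)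
    (by omega : n - 2 ≠ 0))).comp h1).const_mul (fundConst n)
  rw [mul_zero] at h2
  exact h2.congr fun x => (fundSol_eq x).symm

theorem tendsto_newton {f : Rn n → ℝ} (hf : Continuous f) (hc : HasCompactSupport f)
    (hf0 : ∀ y, 0 ≤ f y) : Tendsto (newton f) (Bornology.cobounded (Rn n)) (𝓝 0) := by
  obtain ⟨L, hL⟩ := hc.isCompact.isBounded.subset_closedBall (0 : Rn n)
  obtain ⟨R, -, -, h⟩ := exists_newton_close (n := n) one_pos L
  have h2 := (tendsto_fundSol (n := n)).const_mul (2 * ∫ y, f y)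
  rw [mul_zero] at h2
  refine squeeze_zero' (Eventually.of_forall (newton_nonneg hf0)) ?_ h2
  have hev : ∀ᶠ x : Rn n in Bornology.cobounded (Rn n), R ≤ ‖x‖ :=
    tendsto_norm_cobounded_atTop.eventually_ge_atTop R
  filter_upwards [hev] with x hx
  have h1 := h f hf hc hf0 (fun y hy => by
    by_contra hne
    have := hL (subset_tsupport _ hne)
    rw [mem_closedBall_zero_iff] at this
    linarith) x hx
  have := (abs_le.1 h1).2
  linarith

/-- A Newton potential that is positive, uniformly on a ball. -/
theorem exists_newton_bump_ge (M : ℝ) :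
    ∃ c, 0 < c ∧ ∀ x : Rn n, ‖x‖ ≤ M → c ≤ newton (bump n) x := by
  set c := fundConst n * ((|M| + 1) ^ (n - 2))⁻¹ with hc
  have hpos : 0 < c := by
    have := fundConst_pos (n := n)
    positivity
  refine ⟨c, hpos, fun x hx => ?_⟩
  -- Since `fundSol n 0 = 0` by the convention for division by zero, the pointwise lower bound fails
  -- at `y = x`.
  have hne : ∀ᵐ y : Rn n, y ≠ x := by
    rw [ae_iff]
    simp
  rw [newton_eq]
  calc c = ∫ y, c * bump n y := by rw [integral_const_mul, integral_bump, mul_one]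
    _ ≤ _ := by
      refine integral_mono_ae (integrable_bump.const_mul c)
        (integrable_newton contDiff_bump.continuous hasCompactSupport_bump x) ?_
      filter_upwards [hne] with y hy
      by_cases hy1 : 1 < ‖y‖
      · simp [meanPair_bump.supp y hy1]
      · refine mul_le_mul_of_nonneg_right ?_ (meanPair_bump.nonneg y)
        rw [fundSol_eq, hc]
        have h0 : 0 < ‖x - y‖ := norm_pos_iff.2 (sub_ne_zero.2 (Ne.symm hy))
        have h1 : ‖x - y‖ ≤ |M| + 1 :=
          (norm_sub_le x y).trans (add_le_add (hx.trans (le_abs_self M)) (not_lt.1 hy1))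
        refine mul_le_mul_of_nonneg_left ?_ fundConst_pos.le
        exact inv_anti₀ (by positivity) (pow_le_pow_left₀ h0.le h1 _)

end CapPot

/-! ### Superharmonic functions, competitors, and approximation of potentials by those of open sets.
-/

namespace CapPot
open scoped ContDiff

variable {n : ℕ} [NeZero n]

/-! ### Superharmonic functions -/

theorem Superharmonic.integrableOn_ball {v : Rn n → ℝ} (h : Superharmonic v) (x : Rn n) (r : ℝ) :
    IntegrableOn v (Metric.ball x r) :=
  (h.locInt.integrableOn_isCompact (isCompact_closedBall x r)).mono_set Metric.ball_subset_closedBall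

/-- The minimum principle. -/
theorem Superharmonic.nonneg {v : Rn n → ℝ} (h : Superharmonic v)
    (ht : Tendsto v (Bornology.cobounded (Rn n)) (𝓝 0)) (x : Rn n) : 0 ≤ v x := by
  by_contra! hx
  obtain ⟨R, -, hR⟩ := hasBasis_cobounded_norm.eventually_iff.1 (ht.eventually (lt_mem_nhds hx))
  obtain ⟨a, -, ha⟩ := LowerSemicontinuousOn.exists_isMinOn (s := Metric.closedBall 0 (max R ‖x‖))
    ⟨x, by simp⟩ (isCompact_closedBall _ _) (h.lsc.lowerSemicontinuousOn _)
  have hax : v a ≤ v x := ha (by simp)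
  have hmin : ∀ y, v a ≤ v y := fun y => by
    by_cases hy : ‖y‖ ≤ max R ‖x‖
    · exact ha (by simpa using hy)
    · exact hax.trans (hR ((le_max_left _ _).trans (not_le.1 hy).le)).le
  obtain ⟨z, hz⟩ : ∃ z, v a < v z := by
    have : (Bornology.cobounded (Rn n)).NeBot := by infer_instance
    obtain ⟨z, hz⟩ := (ht.eventually (lt_mem_nhds (hax.trans_lt hx))).exists
    exact ⟨z, hz⟩
  -- The ball around the minimum point `a` reaches `z`. The mean inequality forces `v = v a` almost
  -- everywhere in it, yet `v > v a` holds on an open subset containing `z`, by lower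
  -- semicontinuity.
  set r := ‖z - a‖ + 1 with hr
  have hr0 : 0 < r := by positivity
  have hmean := h.mean_le a r hr0
  have hvol : 0 < volume.real (Metric.ball a r) := by
    rw [volume_real_ball _ hr0]
    have := vball_pos (n := n)
    positivity
  have hi := h.integrableOn_ball a r
  have hic : IntegrableOn (fun _ : Rn n => v a) (Metric.ball a r) :=
    integrableOn_const measure_ball_lt_top.ne
  have h0 : ∫ y in Metric.ball a r, (v y - v a) = 0 := by
    refine le_antisymm ?_ (integral_nonneg fun y => sub_nonneg.2 (hmin y))
    rw [integral_sub hi hic, setIntegral_const, smul_eq_mul]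
    rw [setAverage_eq, smul_eq_mul, inv_mul_le_iff₀ hvol] at hmean
    linarith
  have hae := (setIntegral_eq_zero_iff_of_nonneg_ae
    (Eventually.of_forall fun y => sub_nonneg.2 (hmin y)) (hi.sub hic)).1 h0
  have hopen : IsOpen (v ⁻¹' Ioi (v a) ∩ Metric.ball a r) :=
    (h.lsc.isOpen_preimage _).inter Metric.isOpen_ball
  have hpos := hopen.measure_pos volume ⟨z, hz, by
    rw [mem_ball_iff_norm]; linarith⟩
  rw [EventuallyEq, ae_restrict_iff' Metric.isOpen_ball.measurableSet] at hae
  refine hpos.ne' (measure_mono_null (fun y hy => ?_) (ae_iff.1 hae))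
  simp only [mem_ofPred_eq, Classical.not_imp]
  exact ⟨hy.2, (sub_pos.2 (show v a < v y from hy.1)).ne'⟩

theorem Superharmonic.min {u v : Rn n → ℝ} (hu : Superharmonic u) (hv : Superharmonic v) :
    Superharmonic fun x => min (u x) (v x) := by
  have hli : LocallyIntegrable fun x => Min.min (u x) (v x) := by
    intro x
    obtain ⟨s, hs, hus⟩ := hu.locInt x
    obtain ⟨t, ht, hvt⟩ := hv.locInt x
    exact ⟨s ∩ t, inter_mem hs ht, (hus.mono_set inter_subset_left).inf
      (hvt.mono_set inter_subset_right)⟩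
  refine ⟨hu.lsc.inf hv.lsc, hli, fun x r hr => ?_⟩
  have hi : IntegrableOn (fun x => Min.min (u x) (v x)) (Metric.ball x r) :=
    (hli.integrableOn_isCompact (isCompact_closedBall x r)).mono_set Metric.ball_subset_closedBall
  refine le_min ?_ ?_
  · exact (average_ball_mono_ae hi (hu.integrableOn_ball x r)
      (Eventually.of_forall fun y _ => min_le_left _ _)).trans (hu.mean_le x r hr)
  · exact (average_ball_mono_ae hi (hv.integrableOn_ball x r)
      (Eventually.of_forall fun y _ => min_le_right _ _)).trans (hv.mean_le x r hr)

theorem average_ball_const_mul (c : ℝ) (v : Rn n → ℝ) (x : Rn n) (r : ℝ) :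
    ⨍ y in Metric.ball x r, c * v y = c * ⨍ y in Metric.ball x r, v y := by
  rw [setAverage_eq, setAverage_eq, integral_const_mul, smul_eq_mul, smul_eq_mul]
  ring

theorem Superharmonic.const_mul {v : Rn n → ℝ} (h : Superharmonic v) {c : ℝ} (hc : 0 ≤ c) :
    Superharmonic fun x => c * v x where
  lsc := (continuous_const_mul c).comp_lowerSemicontinuous h.lsc
    (fun _ _ hab => mul_le_mul_of_nonneg_left hab hc)
  locInt := h.locInt.smul c
  mean_le := fun x r hr => by
    rw [average_ball_const_mul]
    exact mul_le_mul_of_nonneg_left (h.mean_le x r hr) hc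

theorem superharmonic_const (c : ℝ) : Superharmonic fun _ : Rn n => c where
  lsc := lowerSemicontinuous_const
  locInt := locallyIntegrable_const c
  mean_le := fun x r hr => by
    have hvol : 0 < volume.real (Metric.ball x r) := by
      rw [volume_real_ball _ hr]
      have := vball_pos (n := n)
      positivity
    rw [setAverage_eq, setIntegral_const, smul_smul, inv_mul_cancel₀ hvol.ne', one_smul]

/-! ### Lower semicontinuous regularisation -/

/-- The lower semicontinuous regularisation. -/
noncomputable def lscHull (f : Rn n → ℝ) (x : Rn n) : ℝ := sSup {c | ∀ᶠ y in 𝓝 x, c ≤ f y}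

section lscHull

variable {f : Rn n → ℝ}

theorem lscHull_bddAbove (x : Rn n) : BddAbove {c | ∀ᶠ y in 𝓝 x, c ≤ f y} :=
  ⟨f x, fun _ hc => hc.self_of_nhds⟩

theorem le_lscHull {c : ℝ} {x : Rn n} (h : ∀ᶠ y in 𝓝 x, c ≤ f y) : c ≤ lscHull f x :=
  le_csSup (lscHull_bddAbove x) h

theorem lscHull_le (h0 : ∀ x, 0 ≤ f x) (x : Rn n) : lscHull f x ≤ f x :=
  csSup_le ⟨0, Eventually.of_forall h0⟩ fun _ hc => hc.self_of_nhds

theorem lscHull_nonneg (h0 : ∀ x, 0 ≤ f x) (x : Rn n) : 0 ≤ lscHull f x :=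
  le_lscHull (Eventually.of_forall h0)

theorem lowerSemicontinuous_lscHull (h0 : ∀ x, 0 ≤ f x) : LowerSemicontinuous (lscHull f) := by
  intro x a ha
  obtain ⟨c, hc, hac⟩ := exists_lt_of_lt_csSup
    (s := {c | ∀ᶠ y in 𝓝 x, c ≤ f y}) ⟨0, Eventually.of_forall h0⟩ ha
  have hc' : ∀ᶠ y in 𝓝 x, c ≤ f y := hc
  filter_upwards [hc'.eventually_nhds] with y hy
  exact hac.trans_le (le_lscHull hy)

end lscHull

/-- The indicator of a moving ball converges off a sphere, which is a null set. -/
theorem continuous_average_ball {g : Rn n → ℝ} (hm : Measurable g) {C : ℝ}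
    (hb : ∀ x, |g x| ≤ C) {r : ℝ} (hr : 0 < r) :
    Continuous fun x => ⨍ y in Metric.ball x r, g y := by
  have hC : 0 ≤ C := (abs_nonneg _).trans (hb 0)
  have hform : ∀ x, ⨍ y in Metric.ball x r, g y
      = (r ^ n * vball n)⁻¹ * ∫ y, (Metric.ball x r).indicator g y := fun x => by
    rw [setAverage_eq, volume_real_ball _ hr, smul_eq_mul,
      integral_indicator Metric.isOpen_ball.measurableSet]
  simp_rw [hform]
  refine continuous_const.mul (continuous_iff_continuousAt.2 fun x => ?_)
  refine tendsto_integral_filter_of_dominated_convergence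
    ((Metric.ball x (r + 1)).indicator fun _ => C)
    (Eventually.of_forall fun y => (hm.indicator Metric.isOpen_ball.measurableSet).aestronglyMeasurable)
    ?_ ?_ ?_
  · filter_upwards [Metric.ball_mem_nhds x one_pos] with y hy
    refine Eventually.of_forall fun z => ?_
    by_cases hz : z ∈ Metric.ball y r
    · rw [indicator_of_mem hz, indicator_of_mem]
      · exact hb z
      · exact Metric.ball_subset_ball' (by rw [Metric.mem_ball] at hy; linarith) hz
    · rw [indicator_of_notMem hz, norm_zero]
      exact indicator_nonneg (fun _ _ => hC) z
  · rw [integrable_indicator_iff Metric.isOpen_ball.measurableSet]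
    exact integrableOn_const measure_ball_lt_top.ne
  · have hs : ∀ᵐ z, z ∉ Metric.sphere x r :=
      measure_eq_zero_iff_ae_notMem.1 (Measure.addHaar_sphere volume x r)
    filter_upwards [hs] with z hz
    have hcd : Tendsto (fun y : Rn n => dist z y) (𝓝 x) (𝓝 (dist z x)) :=
      (continuous_const.dist continuous_id).tendsto x
    refine tendsto_const_nhds.congr' ?_
    rcases lt_or_gt_of_ne (show dist z x ≠ r from hz) with h | h
    · filter_upwards [hcd.eventually (gt_mem_nhds h)] with y hy
      rw [indicator_of_mem (Metric.mem_ball.2 h), indicator_of_mem (Metric.mem_ball.2 hy)]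
    · filter_upwards [hcd.eventually (lt_mem_nhds h)] with y hy
      rw [indicator_of_notMem (by rw [Metric.mem_ball]; linarith),
        indicator_of_notMem (by rw [Metric.mem_ball]; linarith)]

/-- An infimum of superharmonic functions may fail to be lower semicontinuous, but its
regularisation is superharmonic: means over balls of fixed radius are continuous in the centre, so a
bound by `f` at every point near `x` is a bound by the hull at `x`. -/
theorem superharmonic_lscHull {f : Rn n → ℝ} (h0 : ∀ x, 0 ≤ f x) (h1 : ∀ x, f x ≤ 1)
    (h : ∀ x r, 0 < r → ⨍ y in Metric.ball x r, lscHull f y ≤ f x) :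
    Superharmonic (lscHull f) := by
  have hl := lowerSemicontinuous_lscHull h0
  have hb : ∀ x, |lscHull f x| ≤ 1 := fun x =>
    abs_le.2 ⟨by linarith [lscHull_nonneg h0 x], (lscHull_le h0 x).trans (h1 x)⟩
  refine ⟨hl, locallyIntegrable_of_bdd hl.measurable hb, fun x r hr => ?_⟩
  refine le_of_forall_lt fun a ha => ?_
  obtain ⟨b, hab, hb'⟩ := exists_between ha
  refine hab.trans_le (le_lscHull ?_)
  filter_upwards [((continuous_average_ball hl.measurable hb hr).tendsto x).eventually
    (lt_mem_nhds hb')] with y hy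
  exact hy.le.trans (h y r hr)

/-! ### Competitors and the capacitary potential -/

section potential

variable {S T : Set (Rn n)} {v : Rn n → ℝ}

theorem IsCompetitor.nonneg (h : IsCompetitor S v) (x : Rn n) : 0 ≤ v x :=
  h.superharmonic.nonneg h.tendsto_zero x

theorem IsCompetitor.mono (h : IsCompetitor T v) (hST : S ⊆ T) : IsCompetitor S v :=
  ⟨h.superharmonic, fun x hx => h.one_le x (hST hx), h.tendsto_zero⟩

theorem potential_le (h : IsCompetitor S v) (x : Rn n) : potential S x ≤ v x :=
  csInf_le ⟨0, by rintro _ ⟨w, hw, rfl⟩; exact hw.nonneg x⟩ ⟨v, h, rfl⟩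

theorem potential_nonneg (S : Set (Rn n)) (x : Rn n) : 0 ≤ potential S x :=
  Real.sInf_nonneg (by rintro _ ⟨w, hw, rfl⟩; exact hw.nonneg x)

variable [h3 : Fact (3 ≤ n)]

/-- A Newton potential, scaled to be at least `1` on the ball and truncated at `1`. It makes the
infimum in `potential` one over a nonempty set. -/
theorem exists_competitor {M : ℝ} (hS : S ⊆ Metric.ball 0 M) :
    ∃ b : Rn n → ℝ, IsCompetitor S b ∧ ∀ x, b x ≤ 1 := by
  obtain ⟨c, hc, hge⟩ := exists_newton_bump_ge (n := n) M
  have hN : Superharmonic (newton (bump n)) :=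
    superharmonic_of_lap_nonpos (contDiff_newton contDiff_bump hasCompactSupport_bump) fun y => by
      rw [lap_newton contDiff_bump hasCompactSupport_bump]
      exact neg_nonpos.2 (meanPair_bump.nonneg y)
  refine ⟨fun x => min 1 (c⁻¹ * newton (bump n) x), ⟨?_, fun x hx => ?_, ?_⟩, fun x => min_le_left _ _⟩
  · exact (superharmonic_const 1).min (hN.const_mul (inv_nonneg.2 hc.le))
  · refine le_min le_rfl ?_
    rw [le_inv_mul_iff₀ hc, mul_one]
    have := hS hx
    rw [mem_ball_zero_iff] at this
    exact hge x this.le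
  · have h1 := (tendsto_newton (n := n) contDiff_bump.continuous hasCompactSupport_bump
      meanPair_bump.nonneg).const_mul c⁻¹
    have h2 := (tendsto_const_nhds (x := (1 : ℝ))).min h1
    rwa [mul_zero, min_eq_right zero_le_one] at h2

variable {M : ℝ}

theorem le_potential (hS : S ⊆ Metric.ball 0 M) {c : ℝ} {x : Rn n}
    (h : ∀ v, IsCompetitor S v → c ≤ v x) : c ≤ potential S x := by
  obtain ⟨b, hb, -⟩ := exists_competitor hS
  exact le_csInf ⟨_, b, hb, rfl⟩ (by rintro _ ⟨w, hw, rfl⟩; exact h w hw)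

theorem potential_le_one (hS : S ⊆ Metric.ball 0 M) (x : Rn n) : potential S x ≤ 1 := by
  obtain ⟨b, hb, hb1⟩ := exists_competitor hS
  exact (potential_le hb x).trans (hb1 x)

theorem potential_eq_one (hS : S ⊆ Metric.ball 0 M) {x : Rn n} (hx : x ∈ S) :
    potential S x = 1 :=
  le_antisymm (potential_le_one hS x) (le_potential hS fun _ hv => hv.one_le x hx)

theorem tendsto_potential (hS : S ⊆ Metric.ball 0 M) :
    Tendsto (potential S) (Bornology.cobounded (Rn n)) (𝓝 0) := by
  obtain ⟨b, hb, -⟩ := exists_competitor hS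
  exact squeeze_zero (potential_nonneg S) (potential_le hb) hb.tendsto_zero

theorem potential_mono (hT : T ⊆ Metric.ball 0 M) (hST : S ⊆ T) (x : Rn n) :
    potential S x ≤ potential T x :=
  le_potential hT fun _ hv => potential_le (hv.mono hST) x

theorem exists_competitor_lt (hS : S ⊆ Metric.ball 0 M) (x : Rn n) {c : ℝ}
    (hc : potential S x < c) : ∃ v, IsCompetitor S v ∧ v x < c := by
  obtain ⟨b, hb, -⟩ := exists_competitor hS
  obtain ⟨_, ⟨v, hv, rfl⟩, hvc⟩ := exists_lt_of_csInf_lt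
    (s := {t : ℝ | ∃ v : Rn n → ℝ, IsCompetitor S v ∧ t = v x}) ⟨b x, b, hb, rfl⟩ hc
  exact ⟨v, hv, hvc⟩

theorem average_ball_lscHull_potential_le (hS : S ⊆ Metric.ball 0 M) (x : Rn n) {r : ℝ}
    (hr : 0 < r) : ⨍ y in Metric.ball x r, lscHull (potential S) y ≤ potential S x := by
  have h0 := potential_nonneg S
  have hl := lowerSemicontinuous_lscHull h0
  have hb : ∀ x, |lscHull (potential S) x| ≤ 1 := fun x =>
    abs_le.2 ⟨by linarith [lscHull_nonneg h0 x], (lscHull_le h0 x).trans (potential_le_one hS x)⟩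
  refine le_potential hS fun v hv => le_trans ?_ (hv.superharmonic.mean_le x r hr)
  exact average_ball_mono_ae (integrableOn_ball_of_bdd hl.measurable hb x r)
    (hv.superharmonic.integrableOn_ball x r)
    (Eventually.of_forall fun y _ => (lscHull_le h0 y).trans (potential_le hv y))

/-- The potential of an open set is itself a competitor. -/
theorem isCompetitor_potential (hS : S ⊆ Metric.ball 0 M) (ho : IsOpen S) :
    IsCompetitor S (potential S) := by
  have h0 := potential_nonneg S
  have hc : IsCompetitor S (lscHull (potential S)) := by
    refine ⟨superharmonic_lscHull h0 (potential_le_one hS)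
      fun x r hr => average_ball_lscHull_potential_le hS x hr, fun x hx => le_lscHull ?_, ?_⟩
    · filter_upwards [ho.mem_nhds hx] with y hy
      exact (potential_eq_one hS hy).ge
    · exact squeeze_zero (lscHull_nonneg h0) (lscHull_le h0) (tendsto_potential hS)
  have : lscHull (potential S) = potential S :=
    funext fun x => le_antisymm (lscHull_le h0 x) (potential_le hc x)
  rwa [this] at hc

/-- Multiplying a nearly optimal competitor by `θ > 1` makes it exceed `1` on an open set containing
`S`, for which it is then a competitor. -/
theorem exists_open_potential_le (hS : S ⊆ Metric.ball 0 M) {V : Set (Rn n)} (hV : IsOpen V)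
    (hSV : S ⊆ V) (x : Rn n) {c : ℝ} (hc : potential S x < c) :
    ∃ U, IsOpen U ∧ S ⊆ U ∧ U ⊆ V ∧ potential U x < c := by
  obtain ⟨v, hv, hvc⟩ := exists_competitor_lt hS x hc
  obtain ⟨θ, hθ, hθc⟩ : ∃ θ : ℝ, 1 < θ ∧ θ * v x < c := by
    have h1 : Tendsto (fun θ : ℝ => θ * v x) (𝓝[>] 1) (𝓝 (1 * v x)) :=
      ((continuous_mul_const (v x)).tendsto 1).mono_left nhdsWithin_le_nhds
    rw [one_mul] at h1
    obtain ⟨θ, h2, h3⟩ := ((h1.eventually (gt_mem_nhds hvc)).and self_mem_nhdsWithin).exists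
    exact ⟨θ, h3, h2⟩
  have hθ0 : 0 ≤ θ := by linarith
  have hsup := hv.superharmonic.const_mul hθ0
  refine ⟨V ∩ (fun y => θ * v y) ⁻¹' Ioi 1, hV.inter (hsup.lsc.isOpen_preimage 1),
    fun y hy => ⟨hSV hy, ?_⟩, inter_subset_left, (potential_le ⟨hsup, fun y hy => ?_, ?_⟩ x).trans_lt hθc⟩
  · have := hv.one_le y hy
    show 1 < θ * v y
    nlinarith
  · exact le_of_lt hy.2
  · simpa using hv.tendsto_zero.const_mul θ

/-- Potentials are continuous along increasing sequences of open sets. -/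
theorem tendsto_potential_iUnion {U : ℕ → Set (Rn n)} (hU : Monotone U) (ho : ∀ j, IsOpen (U j))
    {V : Set (Rn n)} (hV : V ⊆ Metric.ball 0 M) (hUV : V = ⋃ j, U j) (x : Rn n) :
    Tendsto (fun j => potential (U j) x) atTop (𝓝 (potential V x)) := by
  have hsub : ∀ j, U j ⊆ V := fun j => by rw [hUV]; exact subset_iUnion U j
  have hsubM : ∀ j, U j ⊆ Metric.ball 0 M := fun j => (hsub j).trans hV
  have hmono : ∀ y, Monotone fun j => potential (U j) y := fun y i j hij =>
    potential_mono (hsubM j) (hU hij) y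
  have hbdd : ∀ y, BddAbove (range fun j => potential (U j) y) := fun y =>
    ⟨1, by rintro _ ⟨j, rfl⟩; exact potential_le_one (hsubM j) y⟩
  -- An increasing limit of lower semicontinuous functions is lower semicontinuous and keeps the
  -- mean inequality, so no regularisation is needed for `ψ` to compete for `V`.
  let ψ : Rn n → ℝ := fun y => ⨆ j, potential (U j) y
  have hlim : ∀ y, Tendsto (fun j => potential (U j) y) atTop (𝓝 (ψ y)) := fun y =>
    tendsto_atTop_ciSup (hmono y) (hbdd y)
  have hle : ∀ y, ψ y ≤ potential V y := fun y => ciSup_le fun j => potential_mono hV (hsub j) y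
  have hge : ∀ j y, potential (U j) y ≤ ψ y := fun j y => le_ciSup (hbdd y) j
  have h0 : ∀ y, 0 ≤ ψ y := fun y => (potential_nonneg _ y).trans (hge 0 y)
  have hcomp := fun j => isCompetitor_potential (hsubM j) (ho j)
  have hlsc : LowerSemicontinuous ψ :=
    lowerSemicontinuous_ciSup hbdd fun j => (hcomp j).superharmonic.lsc
  have hb : ∀ y, |ψ y| ≤ 1 := fun y =>
    abs_le.2 ⟨by linarith [h0 y], (hle y).trans (potential_le_one hV y)⟩
  have hψ : IsCompetitor V ψ := by
    refine ⟨⟨hlsc, locallyIntegrable_of_bdd hlsc.measurable hb, fun y r hr => ?_⟩,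
      fun y hy => ?_, squeeze_zero h0 hle (tendsto_potential hV)⟩
    · rw [average_ball_eq _ _ hr]
      have h1 := (tendsto_moll_of_ae (C := 1) meanPair_ball
        (fun j => (hcomp j).superharmonic.lsc.measurable)
        (fun j y => abs_le.2 ⟨by linarith [potential_nonneg (U j) y],
          potential_le_one (hsubM j) y⟩) (Eventually.of_forall hlim) y hr).const_mul (vball n)⁻¹
      refine le_of_tendsto_of_tendsto' h1 (hlim y) fun j => ?_
      rw [← average_ball_eq _ _ hr]
      exact (hcomp j).superharmonic.mean_le y r hr
    · rw [hUV] at hy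
      obtain ⟨j, hj⟩ := mem_iUnion.1 hy
      exact (potential_eq_one (hsubM j) hj).ge.trans (hge j y)
  have : ψ x = potential V x := le_antisymm (hle x) (potential_le hψ x)
  rw [← this]
  exact hlim x

end potential

end CapPot

/-! ### Sweeping: the potential of an open set is harmonic off its closure. -/

namespace CapPot
open scoped ContDiff

variable {n : ℕ} [h3 : Fact (3 ≤ n)] {U : Set (Rn n)} {M : ℝ}

/-! ### Harmonicity of the potential of an open set -/

theorem abs_potential_le (hU : U ⊆ Metric.ball 0 M) (x : Rn n) : |potential U x| ≤ 1 :=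
  abs_le.2 ⟨by linarith [potential_nonneg U x], potential_le_one hU x⟩

theorem measurable_potential (hU : U ⊆ Metric.ball 0 M) (ho : IsOpen U) :
    Measurable (potential U) := (isCompetitor_potential hU ho).superharmonic.lsc.measurable

theorem contDiff_moll_potential (hU : U ⊆ Metric.ball 0 M) (ho : IsOpen U) {ε : ℝ} (hε : 0 < ε) :
    ContDiff ℝ ∞ (moll ε (potential U)) :=
  contDiff_moll hε (locallyIntegrable_of_bdd (measurable_potential hU ho) (abs_potential_le hU))

theorem moll_potential_mem (hU : U ⊆ Metric.ball 0 M) (ho : IsOpen U) (ε : ℝ) (x : Rn n) :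
    moll ε (potential U) x ∈ Icc 0 1 :=
  moll_mem_Icc (measurable_potential hU ho)
    (fun y => ⟨potential_nonneg U y, potential_le_one hU y⟩) ε x

theorem superMeanOn_potential (hU : U ⊆ Metric.ball 0 M) (ho : IsOpen U) (D : Set (Rn n)) :
    SuperMeanOn (potential U) D := (isCompetitor_potential hU ho).superharmonic.superMeanOn D

theorem lap_moll_potential_nonpos (hU : U ⊆ Metric.ball 0 M) (ho : IsOpen U) {ε : ℝ} (hε : 0 < ε)
    (x : Rn n) : lap (moll ε (potential U)) x ≤ 0 :=
  (superMeanOn_potential hU ho univ).lap_moll_nonpos (measurable_potential hU ho)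
    (abs_potential_le hU) hε (lt_add_one ε) (subset_univ _)

theorem moll_potential_le (hU : U ⊆ Metric.ball 0 M) (ho : IsOpen U) {ε : ℝ} (hε : 0 < ε)
    (x : Rn n) : moll ε (potential U) x ≤ potential U x :=
  (superMeanOn_potential hU ho univ).moll_le (measurable_potential hU ho)
    (abs_potential_le hU) hε (lt_add_one ε) (subset_univ _)

theorem moll_potential_antitone (hU : U ⊆ Metric.ball 0 M) (ho : IsOpen U) {ε ε' : ℝ} (hε : 0 < ε)
    (h : ε ≤ ε') (x : Rn n) : moll ε' (potential U) x ≤ moll ε (potential U) x :=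
  (superMeanOn_potential hU ho univ).moll_antitone (measurable_potential hU ho)
    (abs_potential_le hU) hε h (lt_add_one ε') (subset_univ _)

theorem tendsto_moll_potential (hU : U ⊆ Metric.ball 0 M) (ho : IsOpen U) (x : Rn n) :
    Tendsto (fun ε => moll ε (potential U) x) (𝓝[>] 0) (𝓝 (potential U x)) :=
  (superMeanOn_potential hU ho univ).tendsto_moll
    (isCompetitor_potential hU ho).superharmonic.lsc (abs_potential_le hU) one_pos (subset_univ _)

theorem tendsto_moll_potential_cobounded (hU : U ⊆ Metric.ball 0 M) (ho : IsOpen U) {ε : ℝ}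
    (hε : 0 < ε) : Tendsto (moll ε (potential U)) (Bornology.cobounded (Rn n)) (𝓝 0) :=
  squeeze_zero (fun x => (moll_potential_mem hU ho ε x).1) (moll_potential_le hU ho hε)
    (tendsto_potential hU)

/-- A sequence of scales that tends to zero. -/
noncomputable def scale (j : ℕ) : ℝ := 1 / ((j : ℝ) + 1)

theorem scale_pos (j : ℕ) : 0 < scale j := by unfold scale; positivity

theorem scale_anti : Antitone scale := fun i j hij => by
  unfold scale
  exact one_div_le_one_div_of_le (by positivity) (by simpa using hij)

theorem tendsto_scale : Tendsto scale atTop (𝓝 0) := tendsto_one_div_add_atTop_nhds_zero_nat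

theorem tendsto_scale' : Tendsto scale atTop (𝓝[>] 0) :=
  tendsto_nhdsWithin_iff.2 ⟨tendsto_scale, Eventually.of_forall scale_pos⟩

/-- The sweeping of a smooth superharmonic function `w`: the part of the mass of `- lap w` that is
close to `x₀` is replaced by its mollification. -/
theorem exists_sweep {w : Rn n → ℝ} (hw : ContDiff ℝ ∞ w) (hl : ∀ x, lap w x ≤ 0)
    (ht : Tendsto w (Bornology.cobounded (Rn n)) (𝓝 0)) {r c : ℝ} (hr : 0 < r)
    (hc : ∀ u : Rn n → ℝ, ContDiff ℝ ∞ u → ∀ x, (∀ y ∈ Metric.closedBall x r, lap u y ≤ 0) →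
      c * ∫ y in Metric.closedBall x (r / 4), - lap u y ≤ u x - wmean (bump n) u x r)
    (x₀ : Rn n) :
    ∃ w' : Rn n → ℝ, Superharmonic w' ∧ (∀ x, 0 ≤ w' x) ∧ (∀ x, w' x ≤ w x) ∧
      (∀ x, x ∉ Metric.closedBall x₀ (3 * r) → w' x = w x) ∧
      c * ∫ y in Metric.closedBall x₀ (r / 4), - lap w y ≤ w x₀ - w' x₀ := by
  let χ : ContDiffBump x₀ := ⟨r, 2 * r, hr, by linarith⟩
  let g : Rn n → ℝ := fun y => χ y * (-1 * lap w y)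
  have hg : ContDiff ℝ ∞ g := χ.contDiff.mul (contDiff_const.mul (contDiff_lap hw))
  have hgc : HasCompactSupport g := χ.hasCompactSupport.mul_right
  have hg0 : ∀ y, 0 ≤ g y := fun y => mul_nonneg χ.nonneg (by linarith [hl y])
  let P := newton g
  have hP : ContDiff ℝ ∞ P := contDiff_newton hg hgc
  have hPl : ∀ y, lap P y = - g y := lap_newton hg hgc
  have hPl0 : ∀ y, lap P y ≤ 0 := fun y => by rw [hPl]; linarith [hg0 y]
  have hmP : ContDiff ℝ ∞ (moll r P) := contDiff_moll hr hP.continuous.locallyIntegrable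
  -- Subtracting `p` replaces the localised mass `g` by `moll r g`, so `-Δ(w - p) = (1 - χ)(-Δw) +
  -- moll r g ≥ 0`. Since `g` lives within `2 r` of `x₀`, the function `p` vanishes beyond `3 r`.
  let p : Rn n → ℝ := fun x => P x - moll r P x
  have hp : ContDiff ℝ ∞ p := hP.sub hmP
  have hp0 : ∀ x, 0 ≤ p x := fun x => by
    have := meanPair_bump.antitoneOn (x := x) (R := r) hP (fun y _ => hPl0 y)
      ⟨le_rfl, hr.le⟩ ⟨hr.le, le_rfl⟩ hr.le
    rw [wmean_zero, integral_bump, mul_one] at this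
    exact sub_nonneg.2 this
  have hpz : ∀ x, x ∉ Metric.closedBall x₀ (3 * r) → p x = 0 := fun x hx => by
    have := meanPair_bump.wmean_const (x := x) (R := r) hP (fun y hy => ?_) hr.le le_rfl
    · rw [integral_bump, mul_one] at this
      exact sub_eq_zero.2 this.symm
    · rw [hPl, neg_eq_zero]
      have : χ y = 0 := χ.zero_of_le_dist (by
        rw [Metric.mem_closedBall] at hx hy
        have := dist_triangle x y x₀
        rw [dist_comm] at hy
        show 2 * r ≤ dist y x₀
        linarith [dist_comm x y])
      simp [g, this]
  have hmg : ∀ x, 0 ≤ moll r g x := fun x =>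
    integral_nonneg fun y => mul_nonneg (hg0 _) (meanPair_bump.nonneg y)
  have hw' : ContDiff ℝ ∞ fun x => w x - p x := hw.sub hp
  have hlw' : ∀ x, lap (fun x => w x - p x) x ≤ 0 := fun x => by
    have e1 : lap (moll r P) x = - moll r g x := by
      rw [lap_moll hr hP, ← moll_neg]
      exact congrFun (congrArg _ (funext hPl)) x
    have e2 : lap p x = - g x + moll r g x := by
      rw [show lap p x = _ from congrFun (lap_sub hP hmP) x, hPl, e1]; ring
    rw [congrFun (lap_sub hw hp) x, e2]
    have h1 := hmg x
    have h2 : χ x ≤ 1 := χ.le_one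
    have h4 : g x = χ x * (-1 * lap w x) := rfl
    nlinarith [hl x]
  have hS := superharmonic_of_lap_nonpos hw' hlw'
  have htw' : Tendsto (fun x => w x - p x) (Bornology.cobounded (Rn n)) (𝓝 0) := by
    refine ht.congr' ?_
    have : (Metric.closedBall x₀ (3 * r))ᶜ ∈ Bornology.cobounded (Rn n) :=
      Bornology.isBounded_def.1 Metric.isBounded_closedBall
    filter_upwards [this] with x hx
    rw [hpz x hx, sub_zero]
  refine ⟨fun x => w x - p x, hS, hS.nonneg htw', fun x => by linarith [hp0 x],
    fun x hx => by simp [hpz x hx], ?_⟩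
  have h1 := hc P hP x₀ fun y _ => hPl0 y
  have h2 : ∫ y in Metric.closedBall x₀ (r / 4), - lap P y
      = ∫ y in Metric.closedBall x₀ (r / 4), - lap w y := by
    refine setIntegral_congr_fun Metric.isClosed_closedBall.measurableSet fun y hy => ?_
    have : χ y = 1 := χ.one_of_mem_closedBall
      (Metric.closedBall_subset_closedBall (by show r / 4 ≤ r; linarith) hy)
    simp [hPl, g, this]
  rw [h2] at h1
  refine h1.trans (le_of_eq ?_)
  simp only [p, P, moll]
  ring

/-- The swept functions `w' j` lie below the potential and, away from `x₀`, agree with the mollified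
potentials. The regularised lower limit is therefore still a competitor for `U`, hence at least the
potential. So sweeping lowers the value at `x₀` by an amount that tends to zero, and this amount
dominates the mass. -/
theorem tendsto_integral_lap_moll (hU : U ⊆ Metric.ball 0 M) (ho : IsOpen U) {x₀ : Rn n} {r : ℝ}
    (hr : 0 < r) (hd : ∀ y ∈ U, y ∉ Metric.closedBall x₀ (3 * r)) :
    Tendsto (fun j => ∫ y in Metric.closedBall x₀ (r / 4), - lap (moll (scale j) (potential U)) y)
      atTop (𝓝 0) := by
  set φ := potential U with hφ
  obtain ⟨c, hc, hcmass⟩ := exists_mass_le_bump_defect (n := n) hr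
  choose w' hsup hnn hle heq hmass using fun j =>
    exists_sweep (contDiff_moll_potential hU ho (scale_pos j))
      (lap_moll_potential_nonpos hU ho (scale_pos j))
      (tendsto_moll_potential_cobounded hU ho (scale_pos j)) hr hcmass x₀
  have hleφ : ∀ j x, w' j x ≤ φ x := fun j x =>
    (hle j x).trans (moll_potential_le hU ho (scale_pos j) x)
  have hφ1 : ∀ x, φ x ≤ 1 := potential_le_one hU
  have hbb : ∀ x k, BddBelow (range fun j => w' (j + k) x) := fun x k =>
    ⟨0, by rintro _ ⟨j, rfl⟩; exact hnn _ x⟩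
  let ψk : ℕ → Rn n → ℝ := fun k x => ⨅ j, w' (j + k) x
  have hψk_le : ∀ k j x, k ≤ j → ψk k x ≤ w' j x := fun k j x hkj => by
    have := ciInf_le (hbb x k) (j - k)
    rwa [Nat.sub_add_cancel hkj] at this
  have hψk0 : ∀ k x, 0 ≤ ψk k x := fun k x => le_ciInf fun j => hnn _ x
  have hψkφ : ∀ k x, ψk k x ≤ φ x := fun k x => (hψk_le k k x le_rfl).trans (hleφ k x)
  have hψk_mono : ∀ x, Monotone fun k => ψk k x := fun x k l hkl =>
    le_ciInf fun j => hψk_le k (j + l) x (by omega)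
  have hψk_meas : ∀ k, Measurable (ψk k) := fun k =>
    Measurable.iInf fun j => (hsup (j + k)).lsc.measurable
  have hba : ∀ x, BddAbove (range fun k => ψk k x) := fun x =>
    ⟨φ x, by rintro _ ⟨k, rfl⟩; exact hψkφ k x⟩
  -- This is the lower limit of the `w' j`, as an increasing limit of tail infima, so that both the
  -- mean inequality and dominated convergence apply.
  let ψ : Rn n → ℝ := fun x => ⨆ k, ψk k x
  have hlim : ∀ x, Tendsto (fun k => ψk k x) atTop (𝓝 (ψ x)) := fun x =>
    tendsto_atTop_ciSup (hψk_mono x) (hba x)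
  have hψφ : ∀ x, ψ x ≤ φ x := fun x => ciSup_le fun k => hψkφ k x
  have hψ0 : ∀ x, 0 ≤ ψ x := fun x => (hψk0 0 x).trans (le_ciSup (hba x) 0)
  have hψ1 : ∀ x, ψ x ≤ 1 := fun x => (hψφ x).trans (hφ1 x)
  have hψm : Measurable ψ := Measurable.iSup hψk_meas
  have hb : ∀ {u : Rn n → ℝ}, (∀ x, 0 ≤ u x) → (∀ x, u x ≤ 1) → ∀ x, |u x| ≤ 1 := fun h0 h1 x =>
    abs_le.2 ⟨by linarith [h0 x], h1 x⟩
  have hψk1 : ∀ k x, ψk k x ≤ 1 := fun k x => (hψkφ k x).trans (hφ1 x)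
  have hmean : ∀ x r, 0 < r → ⨍ y in Metric.ball x r, ψ y ≤ ψ x := fun x s hs => by
    rw [average_ball_eq _ _ hs]
    have h1 := (tendsto_moll_of_ae (C := 1) meanPair_ball hψk_meas
      (fun k => hb (hψk0 k) (hψk1 k)) (Eventually.of_forall hlim) x hs).const_mul (vball n)⁻¹
    refine le_of_tendsto_of_tendsto' h1 (hlim x) fun k => ?_
    rw [← average_ball_eq _ _ hs]
    refine le_ciInf fun j => le_trans ?_ ((hsup (j + k)).mean_le x s hs)
    exact average_ball_mono_ae (integrableOn_ball_of_bdd (hψk_meas k) (hb (hψk0 k) (hψk1 k)) x s)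
      ((hsup (j + k)).integrableOn_ball x s)
      (Eventually.of_forall fun y _ => hψk_le k (j + k) y (by omega))
  have hhull : IsCompetitor U (lscHull ψ) := by
    refine ⟨superharmonic_lscHull hψ0 hψ1 fun x s hs => le_trans ?_ (hmean x s hs),
      fun x hx => le_lscHull ?_, squeeze_zero (lscHull_nonneg hψ0)
        (fun x => (lscHull_le hψ0 x).trans (hψφ x)) (tendsto_potential hU)⟩
    · exact average_ball_mono_ae (integrableOn_ball_of_bdd
        (lowerSemicontinuous_lscHull hψ0).measurable
        (hb (lscHull_nonneg hψ0) fun x => (lscHull_le hψ0 x).trans (hψ1 x)) x s)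
        (integrableOn_ball_of_bdd hψm (hb hψ0 hψ1) x s)
        (Eventually.of_forall fun y _ => lscHull_le hψ0 y)
    · filter_upwards [ho.mem_nhds hx] with y hy
      refine le_of_forall_lt fun a ha => ?_
      obtain ⟨a', haa', ha'⟩ := exists_between ha
      have h1 := ((tendsto_moll_potential hU ho y).comp tendsto_scale').eventually
        (lt_mem_nhds (show a' < potential U y by rwa [potential_eq_one hU hy]))
      obtain ⟨k, hk⟩ := eventually_atTop.1 h1
      refine haa'.trans_le (le_trans (le_ciInf fun j => ?_) (le_ciSup (hba y) k))
      rw [heq (j + k) y (hd y hy)]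
      exact (hk (j + k) (by omega)).le
  have hfin : φ x₀ ≤ ψ x₀ := (potential_le hhull x₀).trans (lscHull_le hψ0 x₀)
  have hpt : Tendsto (fun k => c⁻¹ * (φ x₀ - ψk k x₀)) atTop (𝓝 0) := by
    have h1 : ψ x₀ = φ x₀ := le_antisymm (hψφ x₀) hfin
    have h2 := ((hlim x₀).const_sub (φ x₀)).const_mul c⁻¹
    rwa [h1, sub_self, mul_zero] at h2
  refine squeeze_zero (fun j => ?_) (fun j => ?_) hpt
  · exact setIntegral_nonneg Metric.isClosed_closedBall.measurableSet
      fun y _ => neg_nonneg.2 (lap_moll_potential_nonpos hU ho (scale_pos j) y)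
  · rw [le_inv_mul_iff₀ hc]
    refine (hmass j).trans ?_
    have h1 := moll_potential_le hU ho (scale_pos j) x₀
    have h2 := hψk_le j j x₀ le_rfl
    linarith

/-- Vanishing mass makes the ball means of the potential independent of the positive radius in the
limit (`MeanPair.wmean_sub_le`). Lower semicontinuity bounds the value at the centre by the means
over very small balls. -/
theorem superMeanOn_neg_potential_closedBall (hU : U ⊆ Metric.ball 0 M) (ho : IsOpen U)
    {x₀ : Rn n} {r : ℝ} (hr : 0 < r) (hd : ∀ y ∈ U, y ∉ Metric.closedBall x₀ (3 * r)) :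
    SuperMeanOn (fun y => - potential U y) (Metric.closedBall x₀ (r / 4)) := by
  intro y s hs hsub
  have hlim0 := tendsto_integral_lap_moll hU ho hr hd
  have hpt : ∀ᵐ x, Tendsto (fun j => moll (scale j) (potential U) x) atTop (𝓝 (potential U x)) :=
    Eventually.of_forall fun x => (tendsto_moll_potential hU ho x).comp tendsto_scale'
  have hconv : ∀ a, 0 < a → Tendsto (fun j => wmean (ballWt n) (moll (scale j) (potential U)) y a)
      atTop (𝓝 (wmean (ballWt n) (potential U) y a)) := fun a ha =>
    tendsto_moll_of_ae (C := 1) meanPair_ball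
      (fun j => (contDiff_moll_potential hU ho (scale_pos j)).continuous.measurable)
      (fun j x => abs_moll_le (measurable_potential hU ho) (abs_potential_le hU) _ x) hpt y ha
  have hle : ∀ a, 0 < a → a ≤ s →
      ⨍ z in Metric.ball y a, potential U z ≤ ⨍ z in Metric.ball y s, potential U z := by
    intro a ha has
    obtain ⟨C, hC⟩ := (meanPair_ball (n := n)).wmean_sub_le ha has
    rw [average_ball_eq _ _ ha, average_ball_eq _ _ hs]
    refine mul_le_mul_of_nonneg_left ?_ (inv_nonneg.2 vball_pos.le)
    have h1 := hlim0.const_mul |C|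
    rw [mul_zero] at h1
    refine sub_nonpos.1 (le_of_tendsto_of_tendsto' ((hconv a ha).sub (hconv s hs)) h1 fun j => ?_)
    have hlj := lap_moll_potential_nonpos hU ho (scale_pos j)
    refine (hC _ (contDiff_moll_potential hU ho (scale_pos j)) y fun z _ => hlj z).trans ?_
    have hi0 : 0 ≤ ∫ z in Metric.closedBall y s, - lap (moll (scale j) (potential U)) z :=
      setIntegral_nonneg Metric.isClosed_closedBall.measurableSet fun z _ => neg_nonneg.2 (hlj z)
    refine (mul_le_mul_of_nonneg_right (le_abs_self C) hi0).trans
      (mul_le_mul_of_nonneg_left ?_ (abs_nonneg C))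
    refine setIntegral_mono_set ?_ (Eventually.of_forall fun z => neg_nonneg.2 (hlj z))
      hsub.eventuallyLE
    exact ((contDiff_lap (contDiff_moll_potential hU ho (scale_pos j))).continuous.neg.continuousOn
      ).integrableOn_compact (isCompact_closedBall _ _)
  have hmain : potential U y ≤ ⨍ z in Metric.ball y s, potential U z := by
    refine le_of_forall_lt fun a ha => ?_
    obtain ⟨b, hab, hb⟩ := exists_between ha
    obtain ⟨τ, hτ, hball⟩ := Metric.eventually_nhds_iff_ball.1
      ((isCompetitor_potential hU ho).superharmonic.lsc y b hb)
    have hm : 0 < min τ s := lt_min hτ hs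
    refine hab.trans_le (le_trans ?_ (hle (min τ s) hm (min_le_right _ _)))
    have hvol : 0 < volume.real (Metric.ball y (min τ s)) := by
      rw [volume_real_ball _ hm]
      have := vball_pos (n := n)
      positivity
    have hc : ⨍ z in Metric.ball y (min τ s), b = b := by
      rw [setAverage_eq, setIntegral_const, smul_smul, inv_mul_cancel₀ hvol.ne', one_smul]
    rw [← hc]
    exact average_ball_mono_ae (integrableOn_const measure_ball_lt_top.ne)
      (integrableOn_ball_of_bdd (measurable_potential hU ho) (abs_potential_le hU) _ _)
      (Eventually.of_forall fun z hz => (hball z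
        (Metric.ball_subset_ball (min_le_left _ _) hz)).le)
  have : ⨍ z in Metric.ball y s, - potential U z = - ⨍ z in Metric.ball y s, potential U z := by
    rw [setAverage_eq, setAverage_eq, integral_neg, smul_neg]
  rw [this]
  linarith

/-- Off the closure of the open set, mollifications of the potential are harmonic. -/
theorem lap_moll_potential_eq_zero (hU : U ⊆ Metric.ball 0 M) (ho : IsOpen U) {x : Rn n} {r ε : ℝ}
    (hε : 0 < ε) (hεr : 16 * ε < r) (hd : ∀ y ∈ U, y ∉ Metric.closedBall x r) :
    lap (moll ε (potential U)) x = 0 := by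
  refine (superMeanOn_potential hU ho _).lap_moll_eq_zero
    (superMeanOn_neg_potential_closedBall hU ho (r := r / 3) (x₀ := x) (by linarith) ?_)
    (measurable_potential hU ho) (abs_potential_le hU) hε (by linarith : ε < r / 3 / 4) le_rfl
  rwa [mul_div_cancel₀ _ (by norm_num : (3 : ℝ) ≠ 0)]

/-- The local result only covers small balls. For a ball of any size in the complement, a
compactness margin makes the mollifications harmonic on all of it at small scales; their means are
then exact and pass to the limit. -/
theorem superMeanOn_neg_potential (hU : U ⊆ Metric.ball 0 M) (ho : IsOpen U) :
    SuperMeanOn (fun y => - potential U y) (closure U)ᶜ := by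
  intro y s hs hsub
  obtain ⟨τ, hτ, hτs⟩ := (isCompact_closedBall y s).exists_cthickening_subset_open
    isClosed_closure.isOpen_compl hsub
  have hd : ∀ x ∈ Metric.closedBall y s, ∀ z ∈ U, z ∉ Metric.closedBall x τ := fun x hx z hz hzx =>
    hτs (Metric.closedBall_subset_cthickening hx τ hzx) (subset_closure hz)
  have hev : ∀ᶠ ε in 𝓝[>] (0 : ℝ), (vball n)⁻¹ * wmean (ballWt n) (moll ε (potential U)) y s
      = moll ε (potential U) y := by
    filter_upwards [Ioo_mem_nhdsGT (show 0 < τ / 16 by positivity)] with ε hε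
    rw [meanPair_ball.wmean_const (contDiff_moll_potential hU ho hε.1)
      (fun x hx => lap_moll_potential_eq_zero hU ho hε.1 (by linarith [hε.2]) (hd x hx))
      hs.le le_rfl, integral_ballWt]
    have := (vball_pos (n := n)).ne'
    field_simp
  have h1 := (tendsto_moll_of_ae (C := 1) (l := 𝓝[>] (0 : ℝ)) meanPair_ball
    (fun ε => measurable_moll (ε := ε) (measurable_potential hU ho))
    (fun ε x => abs_moll_le (measurable_potential hU ho) (abs_potential_le hU) ε x)
    (Eventually.of_forall (tendsto_moll_potential hU ho)) y hs).const_mul (vball n)⁻¹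
  have h2 := tendsto_nhds_unique (h1.congr' hev) (tendsto_moll_potential hU ho y)
  rw [← average_ball_eq _ _ hs] at h2
  have : ⨍ z in Metric.ball y s, - potential U z = - ⨍ z in Metric.ball y s, potential U z := by
    rw [setAverage_eq, setAverage_eq, integral_neg, smul_neg]
  rw [this, h2]

end CapPot

/-! ### Harmonicity for arbitrary sets, and the flux of an open set. -/

namespace CapPot
open scoped ContDiff

variable {n : ℕ} [h3 : Fact (3 ≤ n)] {U S : Set (Rn n)} {M : ℝ}

/-! ### Harmonicity of the potential of an arbitrary bounded set -/

theorem average_ball_neg (v : Rn n → ℝ) (x : Rn n) (r : ℝ) :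
    ⨍ y in Metric.ball x r, - v y = - ⨍ y in Metric.ball x r, v y := by
  rw [setAverage_eq, setAverage_eq, integral_neg, smul_neg]

theorem SuperMeanOn.average_eq {v : Rn n → ℝ} {D : Set (Rn n)} (h : SuperMeanOn v D)
    (h' : SuperMeanOn (fun y => - v y) D) {x : Rn n} {r : ℝ} (hr : 0 < r)
    (hx : Metric.closedBall x r ⊆ D) : ⨍ y in Metric.ball x r, v y = v x := by
  have h1 := h x r hr hx
  have h2 := h' x r hr hx
  rw [average_ball_neg] at h2
  linarith

/-- Harnack's inequality, in the form needed for ordered families. -/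
theorem harnack_le {u : Rn n → ℝ} {x₀ : Rn n} {ρ : ℝ} (hρ : 0 < ρ) (hm : Measurable u) {C : ℝ}
    (hb : ∀ x, |u x| ≤ C) (hu : ∀ x, 0 ≤ u x)
    (hmean : ∀ x r, 0 < r → Metric.closedBall x r ⊆ Metric.ball x₀ ρ →
      ⨍ y in Metric.ball x r, u y = u x) {x : Rn n} (hx : x ∈ Metric.ball x₀ (ρ / 4)) :
    u x ≤ 2 ^ n * u x₀ := by
  have hρ4 : 0 < ρ / 4 := by positivity
  have hρ2 : 0 < ρ / 2 := by positivity
  rw [Metric.mem_ball] at hx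
  have h1 := hmean x (ρ / 4) hρ4 (fun y hy => by
    rw [Metric.mem_closedBall] at hy
    rw [Metric.mem_ball]
    linarith [dist_triangle y x x₀])
  have h2 := hmean x₀ (ρ / 2) hρ2 (Metric.closedBall_subset_ball (by linarith))
  rw [← h1, ← h2, setAverage_eq, setAverage_eq, volume_real_ball _ hρ4, volume_real_ball _ hρ2,
    smul_eq_mul, smul_eq_mul]
  have hmono : ∫ y in Metric.ball x (ρ / 4), u y ≤ ∫ y in Metric.ball x₀ (ρ / 2), u y :=
    setIntegral_mono_set (integrableOn_ball_of_bdd hm hb _ _) (Eventually.of_forall hu)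
      (Metric.ball_subset_ball' (by linarith)).eventuallyLE
  have hv := vball_pos (n := n)
  have hconst : (2 : ℝ) ^ n * ((ρ / 2) ^ n * vball n)⁻¹ = ((ρ / 4) ^ n * vball n)⁻¹ := by
    have : (ρ / 2) ^ n = 2 ^ n * (ρ / 4) ^ n := by rw [← mul_pow]; congr 1; ring
    rw [this]
    field_simp
  rw [← mul_assoc, hconst]
  exact mul_le_mul_of_nonneg_left hmono (by positivity)

/-- Open sets `U j` containing `S` are chosen with potentials converging at the single point `x₀`;
Harnack upgrades this to uniform convergence near `x₀`, which preserves the mean value property. -/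
theorem harmonicAt_potential (hS : S ⊆ Metric.ball 0 M) {x₀ : Rn n} (hx₀ : x₀ ∈ (closure S)ᶜ) :
    InnerProductSpace.HarmonicAt (potential S) x₀ := by
  obtain ⟨ρ, hρ, hball⟩ := Metric.nhds_basis_closedBall.mem_iff.1
    (isClosed_closure.isOpen_compl.mem_nhds hx₀)
  -- Staying inside `V` keeps every open approximation away from a common ball about `x₀`, where all
  -- their potentials are harmonic.
  let V : Set (Rn n) := (Metric.closedBall x₀ ρ)ᶜ ∩ Metric.ball 0 M
  have hVo : IsOpen V := Metric.isClosed_closedBall.isOpen_compl.inter Metric.isOpen_ball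
  have hSV : S ⊆ V := fun y hy => ⟨fun h => hball h (subset_closure hy), hS hy⟩
  have hVM : V ⊆ Metric.ball 0 M := inter_subset_right
  have hcl : ∀ U ⊆ V, Metric.ball x₀ ρ ⊆ (closure U)ᶜ := fun U hU y hy hyc => by
    have h1 : closure U ⊆ (Metric.ball x₀ ρ)ᶜ :=
      closure_minimal (fun z hz hzb => (hU hz).1 (Metric.ball_subset_closedBall hzb))
        Metric.isOpen_ball.isClosed_compl
    exact h1 hyc hy
  choose U hUo hSU hUV hUlt using fun j : ℕ => exists_open_potential_le hS hVo hSV x₀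
    (c := potential S x₀ + scale j) (by linarith [scale_pos j])
  have hUM : ∀ j, U j ⊆ Metric.ball 0 M := fun j => (hUV j).trans hVM
  have hmeanU : ∀ W ⊆ V, IsOpen W → ∀ x r, 0 < r → Metric.closedBall x r ⊆ Metric.ball x₀ ρ →
      ⨍ y in Metric.ball x r, potential W y = potential W x := fun W hW hWo x r hr hsub =>
    (superMeanOn_potential (hW.trans hVM) hWo _).average_eq
      (superMeanOn_neg_potential (hW.trans hVM) hWo) hr (hsub.trans (hcl W hW))
  have hclose : ∀ j, ∀ x ∈ Metric.ball x₀ (ρ / 4),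
      potential (U j) x ≤ potential S x + 2 ^ n * scale j := by
    intro j x hx
    refine le_of_forall_gt fun c hc => ?_
    -- The set `W` lies inside `U j`, so the difference of potentials is nonnegative and harmonic.
    -- At `x₀` it is at most `scale j`, because the potential of `W` is at least that of `S`.
    obtain ⟨W, hWo, hSW, hWU, hWc⟩ := exists_open_potential_le hS (hUo j) (hSU j) x
      (c := c - 2 ^ n * scale j) (by linarith)
    have hWV := hWU.trans (hUV j)
    have hm1 := measurable_potential (hUM j) (hUo j)
    have hm2 := measurable_potential (hWV.trans hVM) hWo
    have hH := harnack_le (u := fun y => potential (U j) y - potential W y) hρ (hm1.sub hm2)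
      (C := 1) (fun y => ?_) (fun y => sub_nonneg.2 (potential_mono (hUM j) hWU y))
      (fun y r hr hsub => ?_) hx
    · have h1 := potential_mono (hWV.trans hVM) hSW x₀
      have h2 : (2 : ℝ) ^ n * (potential (U j) x₀ - potential W x₀) ≤ 2 ^ n * scale j :=
        mul_le_mul_of_nonneg_left (by linarith [hUlt j]) (by positivity)
      linarith
    · have := potential_nonneg (U j) y
      have := potential_nonneg W y
      have := potential_le_one (hUM j) y
      have := potential_le_one (hWV.trans hVM) y
      rw [abs_le]; constructor <;> linarith
    · rw [← hmeanU _ (hUV j) (hUo j) y r hr hsub, ← hmeanU W hWV hWo y r hr hsub, setAverage_eq,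
        setAverage_eq, setAverage_eq, integral_sub
          (integrableOn_ball_of_bdd hm1 (abs_potential_le (hUM j)) _ _)
          (integrableOn_ball_of_bdd hm2 (abs_potential_le (hWV.trans hVM)) _ _), smul_sub]
  -- A countable infimum is measurable, which is not apparent for `potential S`; the two agree near
  -- `x₀`.
  let ψ : Rn n → ℝ := fun x => ⨅ j, potential (U j) x
  have hbb : ∀ x, BddBelow (range fun j => potential (U j) x) := fun x =>
    ⟨0, by rintro _ ⟨j, rfl⟩; exact potential_nonneg _ x⟩
  have hψle : ∀ j x, ψ x ≤ potential (U j) x := fun j x => ciInf_le (hbb x) j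
  have hψm : Measurable ψ := Measurable.iInf fun j => measurable_potential (hUM j) (hUo j)
  have hψb : ∀ x, |ψ x| ≤ 1 := fun x => by
    have h1 : 0 ≤ ψ x := le_ciInf fun j => potential_nonneg _ x
    have h2 := (hψle 0 x).trans (potential_le_one (hUM 0) x)
    exact abs_le.2 ⟨by linarith, h2⟩
  have hs0 : Tendsto (fun j => (2 : ℝ) ^ n * scale j) atTop (𝓝 0) := by
    simpa using tendsto_scale.const_mul ((2 : ℝ) ^ n)
  have hψS : ∀ x ∈ Metric.ball x₀ (ρ / 4), ψ x = potential S x := by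
    intro x hx
    refine le_antisymm ?_ (le_ciInf fun j => potential_mono (hUM j) (hSU j) x)
    have h1 := hs0.const_add (potential S x)
    rw [add_zero] at h1
    exact ge_of_tendsto' h1 fun j => (hψle j x).trans (hclose j x hx)
  have hsub4 : Metric.ball x₀ (ρ / 4) ⊆ Metric.ball x₀ ρ := Metric.ball_subset_ball (by linarith)
  have hsup : SuperMeanOn ψ (Metric.ball x₀ (ρ / 4)) := by
    intro x r hr hsub
    have hx := hsub (Metric.mem_closedBall_self hr.le)
    have h1 := hs0.const_add (ψ x)
    rw [add_zero] at h1
    refine ge_of_tendsto' h1 fun j => ?_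
    calc ⨍ y in Metric.ball x r, ψ y ≤ ⨍ y in Metric.ball x r, potential (U j) y :=
          average_ball_mono_ae (integrableOn_ball_of_bdd hψm hψb _ _)
            (integrableOn_ball_of_bdd (measurable_potential (hUM j) (hUo j))
              (abs_potential_le (hUM j)) _ _) (Eventually.of_forall fun y _ => hψle j y)
      _ = potential (U j) x := hmeanU _ (hUV j) (hUo j) x r hr (hsub.trans hsub4)
      _ ≤ ψ x + 2 ^ n * scale j := by rw [hψS x hx]; exact hclose j x hx
  have hsub' : SuperMeanOn (fun y => - ψ y) (Metric.ball x₀ (ρ / 4)) := by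
    intro x r hr hsub
    have hx := hsub (Metric.mem_closedBall_self hr.le)
    rw [average_ball_neg, neg_le_neg_iff]
    have h1 := hs0.const_add (⨍ y in Metric.ball x r, ψ y)
    rw [add_zero] at h1
    refine ge_of_tendsto' h1 fun j => ?_
    have hvol : 0 < volume.real (Metric.ball x r) := by
      rw [volume_real_ball _ hr]
      have := vball_pos (n := n)
      positivity
    have hi := integrableOn_ball_of_bdd hψm hψb x r
    have hic : IntegrableOn (fun _ : Rn n => 2 ^ n * scale j) (Metric.ball x r) :=
      integrableOn_const measure_ball_lt_top.ne
    calc ψ x ≤ potential (U j) x := hψle j x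
      _ = ⨍ y in Metric.ball x r, potential (U j) y :=
          (hmeanU _ (hUV j) (hUo j) x r hr (hsub.trans hsub4)).symm
      _ ≤ ⨍ y in Metric.ball x r, (ψ y + 2 ^ n * scale j) := by
          refine average_ball_mono_ae (integrableOn_ball_of_bdd
            (measurable_potential (hUM j) (hUo j)) (abs_potential_le (hUM j)) _ _) (hi.add hic)
            (Eventually.of_forall fun y hy => ?_)
          have hy' := hsub (Metric.ball_subset_closedBall hy)
          rw [hψS y hy']
          exact hclose j y hy'
      _ = _ := by
          rw [setAverage_eq, setAverage_eq, integral_add hi hic, setIntegral_const, smul_add,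
            smul_smul, inv_mul_cancel₀ hvol.ne', one_smul]
  have hfinal := hsup.harmonicAt hsub' hψm hψb (x := x₀) (Metric.ball_mem_nhds _ (by positivity))
  refine (InnerProductSpace.harmonicAt_congr_nhds ?_).1 hfinal
  filter_upwards [Metric.ball_mem_nhds x₀ (show 0 < ρ / 4 by positivity)] with y hy
  exact hψS y hy

/-! ### The potential of an open set far away -/

/-- The density of the mollified capacitary distribution. -/
noncomputable def mollMass (U : Set (Rn n)) (ε : ℝ) (x : Rn n) : ℝ :=
  - lap (moll ε (potential U)) x

section mollMass

variable {ε : ℝ}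

theorem mollMass_nonneg (hU : U ⊆ Metric.ball 0 M) (ho : IsOpen U) (hε : 0 < ε) (x : Rn n) :
    0 ≤ mollMass U ε x := neg_nonneg.2 (lap_moll_potential_nonpos hU ho hε x)

theorem contDiff_mollMass (hU : U ⊆ Metric.ball 0 M) (ho : IsOpen U) (hε : 0 < ε) :
    ContDiff ℝ ∞ (mollMass U ε) := (contDiff_lap (contDiff_moll_potential hU ho hε)).neg

theorem mollMass_eq_zero (hU : U ⊆ Metric.ball 0 M) (ho : IsOpen U) (hε : 0 < ε) {x : Rn n} {r : ℝ}
    (hεr : 16 * ε < r) (hd : ∀ y ∈ U, y ∉ Metric.closedBall x r) : mollMass U ε x = 0 :=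
  neg_eq_zero.2 (lap_moll_potential_eq_zero hU ho hε hεr hd)

theorem notMem_closedBall_of_far (hU : U ⊆ Metric.ball 0 M) {x : Rn n} {r : ℝ}
    (hx : M + r < ‖x‖) : ∀ y ∈ U, y ∉ Metric.closedBall x r := fun y hy hyx => by
  have h1 := hU hy
  rw [mem_ball_zero_iff] at h1
  rw [mem_closedBall_iff_norm] at hyx
  have := norm_sub_norm_le x y
  rw [norm_sub_rev] at this
  linarith

theorem mollMass_eq_zero_of_far (hU : U ⊆ Metric.ball 0 M) (ho : IsOpen U) (hε : 0 < ε) {x : Rn n}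
    (hx : M + 17 * ε < ‖x‖) : mollMass U ε x = 0 :=
  mollMass_eq_zero hU ho hε (by linarith : 16 * ε < 17 * ε) (notMem_closedBall_of_far hU hx)

theorem hasCompactSupport_mollMass (hU : U ⊆ Metric.ball 0 M) (ho : IsOpen U) (hε : 0 < ε) :
    HasCompactSupport (mollMass U ε) := by
  refine HasCompactSupport.of_support_subset_isCompact
    (isCompact_closedBall (0 : Rn n) (M + 17 * ε)) fun y hy => ?_
  by_contra h
  exact hy (mollMass_eq_zero_of_far hU ho hε (by simpa using h))

theorem moll_potential_eq (hU : U ⊆ Metric.ball 0 M) (ho : IsOpen U) (hε : 0 < ε) {x : Rn n}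
    (hx : M + 2 * ε < ‖x‖) : moll ε (potential U) x = potential U x := by
  refine (superMeanOn_potential hU ho _).moll_eq (superMeanOn_neg_potential hU ho)
    (measurable_potential hU ho) (abs_potential_le hU) hε (by linarith : ε < 2 * ε)
    fun y hy hyc => ?_
  have h1 := (closure_mono hU).trans Metric.closure_ball_subset_closedBall hyc
  rw [mem_closedBall_zero_iff] at h1
  rw [mem_closedBall_iff_norm] at hy
  have := norm_sub_norm_le x y
  rw [norm_sub_rev] at this
  linarith

/-- Both sides have the same Laplacian and vanish at infinity, so the minimum principle applies to
their difference and to its negative. -/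
theorem moll_potential_eq_newton (hU : U ⊆ Metric.ball 0 M) (ho : IsOpen U) (hε : 0 < ε)
    (x : Rn n) : moll ε (potential U) x = newton (mollMass U ε) x := by
  have hw := contDiff_moll_potential hU ho hε
  have hf := contDiff_mollMass hU ho hε
  have hc := hasCompactSupport_mollMass hU ho hε
  have hN := contDiff_newton hf hc
  have ht1 := tendsto_moll_potential_cobounded hU ho hε
  have ht2 := tendsto_newton hf.continuous hc (mollMass_nonneg hU ho hε)
  have hl : ∀ y, lap (newton (mollMass U ε)) y = lap (moll ε (potential U)) y := fun y => by
    rw [lap_newton hf hc, mollMass, neg_neg]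
  have hs1 := superharmonic_of_lap_nonpos (hw.sub hN) fun y => by
    rw [congrFun (lap_sub hw hN) y, hl, sub_self]
  have hs2 := superharmonic_of_lap_nonpos (hN.sub hw) fun y => by
    rw [congrFun (lap_sub hN hw) y, hl, sub_self]
  have h1 := hs1.nonneg (by simpa using ht1.sub ht2) x
  have h2 := hs2.nonneg (by simpa using ht2.sub ht1) x
  linarith

end mollMass

/-- `m` is the coefficient of the fundamental solution in the expansion of the potential at
infinity. -/
def IsFlux (U : Set (Rn n)) (m : ℝ) : Prop :=
  ∀ δ, 0 < δ → ∃ R : ℝ, 0 < R ∧ ∀ x, R ≤ ‖x‖ →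
    |potential U x - m * fundSol n x| ≤ δ * fundSol n x

theorem exists_norm_eq {R : ℝ} (hR : 0 ≤ R) : ∃ x : Rn n, ‖x‖ = R :=
  ⟨R • stdVec 0, by rw [norm_smul, Real.norm_of_nonneg hR]; simp⟩

/-- Comparison at one sufficiently distant point suffices. The one-sided hypothesis on `T` also
serves when only an upper bound is available, as in the exhaustion of an open set. -/
theorem IsFlux.le_of_le {T : Set (Rn n)} {m m' : ℝ} (h : IsFlux U m)
    (h' : ∀ δ, 0 < δ → ∃ R : ℝ, 0 < R ∧ ∀ x, R ≤ ‖x‖ → potential T x ≤ (m' + δ) * fundSol n x)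
    (hle : ∀ x, potential U x ≤ potential T x) : m ≤ m' := by
  refine le_of_forall_pos_le_add fun δ hδ => ?_
  obtain ⟨R, hR, h1⟩ := h (δ / 2) (by positivity)
  obtain ⟨R', hR', h2⟩ := h' (δ / 2) (by positivity)
  obtain ⟨x, hx⟩ := exists_norm_eq (n := n) (hR.le.trans (le_max_left R R'))
  have hx0 : x ≠ 0 := norm_pos_iff.1 (by rw [hx]; exact lt_max_of_lt_left hR)
  have h3 := (abs_le.1 (h1 x (by rw [hx]; exact le_max_left _ _))).1
  have h4 := h2 x (by rw [hx]; exact le_max_right _ _)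
  have h5 := hle x
  have hp := fundSol_pos hx0
  have : (m - m' - δ) * fundSol n x ≤ 0 := by linarith
  have := nonpos_of_mul_nonpos_left this hp
  linarith

theorem IsFlux.unique {m m' : ℝ} (h : IsFlux U m) (h' : IsFlux U m') : m = m' := by
  have key : ∀ {a b : ℝ}, IsFlux U a → IsFlux U b → a ≤ b := fun {a b} ha hb =>
    ha.le_of_le (T := U) (fun δ hδ => by
      obtain ⟨R, hR, h1⟩ := hb δ hδ
      exact ⟨R, hR, fun x hx => by linarith [(abs_le.1 (h1 x hx)).2]⟩) fun x => le_rfl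
  exact le_antisymm (key h h') (key h' h)

/-- Off a ball that depends only on `M` and `ε`, the potential equals its mollification, a Newton
potential. The relative error becomes absolute once the total mass is bounded uniformly in `U`. -/
theorem exists_uniform_radius (M : ℝ) {δ : ℝ} (hδ : 0 < δ) (ε : ℝ) (hε : 0 < ε) :
    ∃ R, 0 < R ∧ ∀ U : Set (Rn n), U ⊆ Metric.ball 0 M → IsOpen U → ∀ x, R ≤ ‖x‖ →
      |potential U x - (∫ y, mollMass U ε y) * fundSol n x| ≤ δ * fundSol n x := by
  obtain ⟨R₀, hR₀, hLR₀, h0⟩ := exists_newton_close (n := n) (δ := 1 / 2) (by norm_num)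
    (M + 17 * ε)
  obtain ⟨z, hz⟩ := exists_norm_eq (n := n) hR₀.le
  have hz0 : 0 < fundSol n z := fundSol_pos (norm_pos_iff.1 (by rw [hz]; exact hR₀))
  -- A bound for the mass: at the fixed point `z` the Newton potential is at most `1` and at least
  -- half of the mass times `fundSol n z`.
  set K := 2 / fundSol n z with hK
  have hK0 : 0 < K := by positivity
  obtain ⟨R, hR, hLR, h1⟩ := exists_newton_close (n := n) (δ := δ / K) (by positivity)
    (M + 17 * ε)
  refine ⟨R, hR, fun U hU ho x hx => ?_⟩
  have hf := (contDiff_mollMass hU ho hε).continuous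
  have hc := hasCompactSupport_mollMass hU ho hε
  have hn := mollMass_nonneg hU ho hε
  have hfar := fun y (hy : M + 17 * ε < ‖y‖) => mollMass_eq_zero_of_far hU ho hε hy
  set m := ∫ y, mollMass U ε y with hm
  have hm0 : 0 ≤ m := integral_nonneg hn
  have hmK : m ≤ K := by
    have h2 := (abs_le.1 (h0 _ hf hc hn hfar z hz.ge)).1
    have h4 : newton (mollMass U ε) z ≤ 1 := by
      rw [← moll_potential_eq_newton hU ho hε]; exact (moll_potential_mem hU ho ε z).2
    rw [hK, le_div_iff₀ hz0]
    linarith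
  have h2 := h1 _ hf hc hn hfar x hx
  rw [← moll_potential_eq_newton hU ho hε, moll_potential_eq hU ho hε (by linarith)] at h2
  refine h2.trans ?_
  have h5 : δ / K * m ≤ δ := by
    rw [div_mul_eq_mul_div, div_le_iff₀ hK0]
    exact mul_le_mul_of_nonneg_left hmK hδ.le
  rw [← mul_assoc]
  exact mul_le_mul_of_nonneg_right h5 (fundSol_nonneg x)

theorem isFlux_mollMass (hU : U ⊆ Metric.ball 0 M) (ho : IsOpen U) {ε : ℝ} (hε : 0 < ε) :
    IsFlux U (∫ y, mollMass U ε y) := fun δ hδ => by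
  obtain ⟨R, hR, h⟩ := exists_uniform_radius (n := n) M hδ ε hε
  exact ⟨R, hR, h U hU ho⟩

/-- Uniqueness of the flux removes the mollification scale from the statement; scale `1` serves for
all sets. -/
theorem IsFlux.uniform (M : ℝ) {δ : ℝ} (hδ : 0 < δ) :
    ∃ R, 0 < R ∧ ∀ U : Set (Rn n), U ⊆ Metric.ball 0 M → IsOpen U → ∀ m, IsFlux U m →
      ∀ x, R ≤ ‖x‖ → |potential U x - m * fundSol n x| ≤ δ * fundSol n x := by
  obtain ⟨R, hR, h⟩ := exists_uniform_radius (n := n) M hδ 1 one_pos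
  refine ⟨R, hR, fun U hU ho m hm => ?_⟩
  rw [hm.unique (isFlux_mollMass hU ho one_pos)]
  exact h U hU ho

end CapPot

/-! ### Energy identities, cutoff functions and decay estimates. -/

namespace CapPot
open scoped ContDiff

variable {n : ℕ}

/-! ### Gradients and energies -/

/-- The gradient. -/
noncomputable def grad (u : Rn n → ℝ) (x : Rn n) : Rn n := WithLp.toLp 2 fun i => pd i u x

theorem inner_grad (u : Rn n → ℝ) (x e : Rn n) : inner ℝ (grad u x) e = fderiv ℝ u x e := by
  rw [fderiv_apply_eq_sum, PiLp.inner_apply]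
  simp [grad]

theorem norm_grad_sq (u : Rn n → ℝ) (x : Rn n) : ‖grad u x‖ ^ 2 = ∑ i, pd i u x ^ 2 := by
  rw [EuclideanSpace.norm_sq_eq]
  simp [grad]

theorem continuous_grad {u : Rn n → ℝ} (hu : ContDiff ℝ ∞ u) : Continuous (grad u) :=
  (PiLp.continuous_toLp 2 _).comp (continuous_pi fun i => (contDiff_pd hu i).continuous)

theorem hasCompactSupport_grad {u : Rn n → ℝ} (hc : HasCompactSupport u) :
    HasCompactSupport (grad u) := by
  refine HasCompactSupport.of_support_subset_isCompact hc fun x hx => ?_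
  by_contra h
  refine hx ?_
  have h0 : u =ᶠ[𝓝 x] fun _ => 0 := notMem_tsupport_iff_eventuallyEq.1 h
  ext i
  simp only [grad]
  rw [(pd_congr h0 i).eq_of_nhds, pd_zero_fun]
  rfl

theorem hasCompactSupport_sq {f : Rn n → ℝ} (hc : HasCompactSupport f) :
    HasCompactSupport fun x => f x ^ 2 := by
  have : HasCompactSupport fun x => f x * f x := hc.mul_left
  simpa only [sq] using this

theorem memLp_grad {u : Rn n → ℝ} (hu : ContDiff ℝ ∞ u) (hc : HasCompactSupport u) :
    MemLp (grad u) 2 volume :=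
  (continuous_grad hu).memLp_of_hasCompactSupport (hasCompactSupport_grad hc)

theorem integral_lap_mul {u g : Rn n → ℝ} (hu : ContDiff ℝ ∞ u) (hg : ContDiff ℝ ∞ g)
    (hc : HasCompactSupport g) : ∫ x, lap u x * g x = - ∑ i, ∫ x, pd i u x * pd i g x := by
  simp only [lap, Finset.sum_mul]
  rw [integral_finsetSum, ← Finset.sum_neg_distrib]
  · exact Finset.sum_congr rfl fun i _ => integral_pd_mul (contDiff_pd hu i) hg hc i
  · exact fun i _ => ((contDiff_pd (contDiff_pd hu i) i).continuous.mul
      hg.continuous).integrable_of_hasCompactSupport hc.mul_left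

/-- Green's second identity. -/
theorem integral_lap_mul_comm {u g : Rn n → ℝ} (hu : ContDiff ℝ ∞ u) (hg : ContDiff ℝ ∞ g)
    (hc : HasCompactSupport g) : ∫ x, lap u x * g x = ∫ x, lap g x * u x := by
  rw [integral_lap_mul hu hg hc]
  simp only [lap, Finset.sum_mul]
  rw [integral_finsetSum, ← Finset.sum_neg_distrib]
  · refine Finset.sum_congr rfl fun i _ => ?_
    have h := integral_pd_mul hu (contDiff_pd hg i) (hasCompactSupport_pd hc i) i
    rw [h, neg_neg]
    exact integral_congr_ae (Eventually.of_forall fun x => mul_comm _ _)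
  · exact fun i _ => ((contDiff_pd (contDiff_pd hg i) i).continuous.mul
      hu.continuous).integrable_of_hasCompactSupport
      (hasCompactSupport_pd (hasCompactSupport_pd hc i) i).mul_right

theorem integral_norm_grad_sq {u : Rn n → ℝ} (hu : ContDiff ℝ ∞ u) (hc : HasCompactSupport u) :
    ∫ x, ‖grad u x‖ ^ 2 = ∑ i, ∫ x, pd i u x ^ 2 := by
  simp only [norm_grad_sq]
  rw [integral_finsetSum]
  exact fun i _ => ((contDiff_pd hu i).continuous.pow 2).integrable_of_hasCompactSupport
    (hasCompactSupport_sq (hasCompactSupport_pd hc i))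

theorem integral_norm_grad_sq_eq {u : Rn n → ℝ} (hu : ContDiff ℝ ∞ u) (hc : HasCompactSupport u) :
    ∫ x, ‖grad u x‖ ^ 2 = ∫ x, - lap u x * u x := by
  have h1 : ∫ x, - lap u x * u x = - ∫ x, lap u x * u x := by
    rw [← integral_neg]
    exact integral_congr_ae (Eventually.of_forall fun x => by simp)
  rw [h1, integral_lap_mul hu hu hc, neg_neg, integral_norm_grad_sq hu hc]
  exact Finset.sum_congr rfl fun i _ => integral_congr_ae (Eventually.of_forall fun x => by
    simp only; ring)

/-- The energy of a truncated function. -/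
theorem integral_norm_grad_mul_sq {w χ : Rn n → ℝ} (hw : ContDiff ℝ ∞ w) (hχ : ContDiff ℝ ∞ χ)
    (hc : HasCompactSupport χ) :
    ∫ x, ‖grad (fun y => χ y * w y) x‖ ^ 2
      = (∫ x, χ x ^ 2 * w x * - lap w x) + ∫ x, w x ^ 2 * ‖grad χ x‖ ^ 2 := by
  have hχw : ContDiff ℝ ∞ fun y => χ y * w y := hχ.mul hw
  have hg : ContDiff ℝ ∞ fun y => χ y * (χ y * w y) := hχ.mul hχw
  have hgc : HasCompactSupport fun y => χ y * (χ y * w y) := hc.mul_right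
  have h1 := integral_lap_mul hw hg hgc
  have h2 : ∫ x, χ x ^ 2 * w x * - lap w x = ∑ i, ∫ x, pd i w x * pd i (fun y => χ y * (χ y * w y)) x := by
    have e : ∫ x, χ x ^ 2 * w x * - lap w x = - ∫ x, lap w x * (χ x * (χ x * w x)) := by
      rw [← integral_neg]
      exact integral_congr_ae (Eventually.of_forall fun x => by simp only; ring)
    rw [e, h1, neg_neg]
  have hcont1 : ∀ i, Continuous (pd i χ) := fun i => (contDiff_pd hχ i).continuous
  have hcont2 : ∀ i, Continuous (pd i w) := fun i => (contDiff_pd hw i).continuous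
  have h3 : ∫ x, w x ^ 2 * ‖grad χ x‖ ^ 2 = ∑ i, ∫ x, w x ^ 2 * pd i χ x ^ 2 := by
    simp only [norm_grad_sq, Finset.mul_sum]
    rw [integral_finsetSum]
    exact fun i _ => ((hw.continuous.pow 2).mul ((hcont1 i).pow 2)).integrable_of_hasCompactSupport
      (hasCompactSupport_sq (hasCompactSupport_pd hc i)).mul_left
  rw [integral_norm_grad_sq hχw hc.mul_right, h2, h3, ← Finset.sum_add_distrib]
  refine Finset.sum_congr rfl fun i _ => ?_
  rw [← integral_add]
  · refine integral_congr_ae (Eventually.of_forall fun x => ?_)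
    simp only [pd_mul hχ hχw, pd_mul hχ hw]
    ring
  · exact ((hcont2 i).mul (contDiff_pd hg i).continuous).integrable_of_hasCompactSupport
      (hasCompactSupport_pd hgc i).mul_left
  · exact ((hw.continuous.pow 2).mul ((hcont1 i).pow 2)).integrable_of_hasCompactSupport
      (hasCompactSupport_sq (hasCompactSupport_pd hc i)).mul_left

/-! ### Cutoff functions -/

/-- `χ` is a cutoff function between the balls of radius `R` and `2R`, with constant `C`. -/
structure IsCutoff (C R : ℝ) (χ : Rn n → ℝ) : Prop where
  smooth : ContDiff ℝ ∞ χ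
  compact : HasCompactSupport χ
  nonneg : ∀ x, 0 ≤ χ x
  le_one : ∀ x, χ x ≤ 1
  eq_one : ∀ x, ‖x‖ ≤ R → χ x = 1
  eq_zero : ∀ x, 2 * R < ‖x‖ → χ x = 0
  grad_le : ∀ x, ‖grad χ x‖ ≤ C / R
  lap_le : ∀ x, |lap χ x| ≤ C / R ^ 2

theorem exists_isCutoff : ∃ C : ℝ, 0 < C ∧ ∀ R, 0 < R → ∃ χ : Rn n → ℝ, IsCutoff C R χ := by
  let b : ContDiffBump (0 : Rn n) := ⟨1, 2, one_pos, by norm_num⟩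
  have hb : ContDiff ℝ ∞ (fun x => b x) := b.contDiff
  obtain ⟨C₁, hC₁⟩ := (hasCompactSupport_grad b.hasCompactSupport).exists_bound_of_continuous
    (continuous_grad hb)
  obtain ⟨C₂, hC₂⟩ := (hasCompactSupport_lap b.hasCompactSupport).exists_bound_of_continuous
    (contDiff_lap hb).continuous
  refine ⟨max (max C₁ C₂) 1, lt_max_of_lt_right one_pos, fun R hR => ⟨fun x => b (R⁻¹ • x), ?_⟩⟩
  have hR' := inv_pos.2 hR
  have hnorm : ∀ x : Rn n, ‖R⁻¹ • x‖ = ‖x‖ / R := fun x => by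
    rw [norm_smul, norm_inv, Real.norm_of_nonneg hR.le, inv_mul_eq_div]
  have hpd : ∀ u : Rn n → ℝ, ContDiff ℝ ∞ u → ∀ i,
      pd i (fun x => u (R⁻¹ • x)) = fun x => R⁻¹ * pd i u (R⁻¹ • x) := fun u hu i => by
    have := pd_comp_add_smul hu 0 R⁻¹ i
    simpa only [zero_add] using this
  have hs : ContDiff ℝ ∞ fun x : Rn n => R⁻¹ • x := contDiff_id.const_smul _
  refine ⟨hb.comp hs, b.hasCompactSupport.comp_smul hR'.ne', fun x => b.nonneg, fun x => b.le_one,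
    fun x hx => b.one_of_mem_closedBall ?_, fun x hx => b.zero_of_le_dist ?_, fun x => ?_, fun x => ?_⟩
  · rw [mem_closedBall_zero_iff, hnorm]
    exact (div_le_one hR).2 hx
  · rw [dist_zero_right, hnorm]
    exact (le_div_iff₀ hR).2 hx.le
  · have : grad (fun x => b (R⁻¹ • x)) x = R⁻¹ • grad (fun x => b x) (R⁻¹ • x) := by
      ext i
      simp [grad, hpd _ hb]
    rw [this, norm_smul, norm_inv, Real.norm_of_nonneg hR.le, inv_mul_eq_div]
    exact div_le_div_of_nonneg_right ((hC₁ _).trans ((le_max_left _ _).trans (le_max_left _ _))) hR.le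
  · have : lap (fun x => b (R⁻¹ • x)) x = (R ^ 2)⁻¹ * lap (fun x => b x) (R⁻¹ • x) := by
      simp only [lap, Finset.mul_sum]
      refine Finset.sum_congr rfl fun i _ => ?_
      have h2 : ContDiff ℝ ∞ fun x => pd i (fun x => b x) (R⁻¹ • x) := (contDiff_pd hb i).comp hs
      rw [hpd _ hb, pd_const_mul h2, hpd _ (contDiff_pd hb i)]
      simp only
      rw [← mul_assoc]
      congr 1
      field_simp
    rw [this, abs_mul, abs_of_pos (by positivity), inv_mul_eq_div]
    exact div_le_div_of_nonneg_right ((hC₂ _).trans ((le_max_right _ _).trans (le_max_left _ _)))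
      (by positivity)

variable [h3 : Fact (3 ≤ n)]

theorem IsCutoff.grad_eq_zero {C R : ℝ} {χ : Rn n → ℝ} (h : IsCutoff C R χ) {x : Rn n}
    (hx : ‖x‖ < R ∨ 2 * R < ‖x‖) : grad χ x = 0 := by
  have hc : ∃ c : ℝ, χ =ᶠ[𝓝 x] fun _ => c := by
    rcases hx with hx | hx
    · exact ⟨1, by
        filter_upwards [(continuous_norm.tendsto x).eventually (gt_mem_nhds hx)] with y hy
        exact h.eq_one y hy.le⟩
    · exact ⟨0, by
        filter_upwards [(continuous_norm.tendsto x).eventually (lt_mem_nhds hx)] with y hy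
        exact h.eq_zero y hy⟩
  obtain ⟨c, hc⟩ := hc
  ext i
  simp only [grad]
  rw [(pd_congr hc i).eq_of_nhds]
  simp [pd]

theorem IsCutoff.lap_eq_zero {C R : ℝ} {χ : Rn n → ℝ} (h : IsCutoff C R χ) {x : Rn n}
    (hx : ‖x‖ < R ∨ 2 * R < ‖x‖) : lap χ x = 0 := by
  have hc : ∃ c : ℝ, χ =ᶠ[𝓝 x] fun _ => c := by
    rcases hx with hx | hx
    · exact ⟨1, by
        filter_upwards [(continuous_norm.tendsto x).eventually (gt_mem_nhds hx)] with y hy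
        exact h.eq_one y hy.le⟩
    · exact ⟨0, by
        filter_upwards [(continuous_norm.tendsto x).eventually (lt_mem_nhds hx)] with y hy
        exact h.eq_zero y hy⟩
  obtain ⟨c, hc⟩ := hc
  rw [lap_congr hc]
  have : ∀ i : Fin n, pd i (fun _ : Rn n => c) = fun _ => 0 := fun i => by ext y; simp [pd]
  simp [lap, this, pd_zero_fun]

/-- Square integrals over the region where a cutoff function varies are small for functions that
decay like the fundamental solution. -/
theorem integral_sq_le_of_decay {A C R : ℝ} (hR : 1 ≤ R) {w f : Rn n → ℝ} (hA : 0 ≤ A)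
    (hw : ∀ x, R ≤ ‖x‖ → |w x| ≤ A * (‖x‖ ^ (n - 2))⁻¹) (hf : ∀ x, 0 ≤ f x)
    (hf0 : ∀ x, ‖x‖ < R ∨ 2 * R < ‖x‖ → f x = 0) (hfC : ∀ x, f x ≤ (C / R) ^ 2) :
    ∫ x, w x ^ 2 * f x ≤ A ^ 2 * C ^ 2 * 3 ^ n * vball n / R := by
  have hR0 : 0 < R := by linarith
  have h3R : (0 : ℝ) < 3 * R := by positivity
  set B := (A * (R ^ (n - 2))⁻¹) ^ 2 * (C / R) ^ 2 with hB
  have hB0 : 0 ≤ B := by positivity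
  have hpt : ∀ x, w x ^ 2 * f x ≤ (Metric.ball (0 : Rn n) (3 * R)).indicator (fun _ => B) x := by
    intro x
    by_cases hx : ‖x‖ < R ∨ 2 * R < ‖x‖
    · rw [hf0 x hx, mul_zero]
      exact indicator_nonneg (fun _ _ => hB0) x
    · push Not at hx
      rw [indicator_of_mem (by rw [mem_ball_zero_iff]; linarith [hx.2])]
      refine mul_le_mul ?_ (hfC x) (hf x) (by positivity)
      rw [← sq_abs]
      refine pow_le_pow_left₀ (abs_nonneg _) ((hw x hx.1).trans ?_) 2
      exact mul_le_mul_of_nonneg_left (inv_anti₀ (by positivity)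
        (pow_le_pow_left₀ hR0.le hx.1 _)) hA
  have hint : Integrable ((Metric.ball (0 : Rn n) (3 * R)).indicator fun _ => B) := by
    rw [integrable_indicator_iff Metric.isOpen_ball.measurableSet]
    exact integrableOn_const measure_ball_lt_top.ne
  calc ∫ x, w x ^ 2 * f x ≤ ∫ x, (Metric.ball (0 : Rn n) (3 * R)).indicator (fun _ => B) x :=
        integral_mono_of_nonneg (Eventually.of_forall fun x => mul_nonneg (sq_nonneg _) (hf x)) hint
          (Eventually.of_forall hpt)
    _ = (3 * R) ^ n * vball n * B := by
        rw [integral_indicator Metric.isOpen_ball.measurableSet, setIntegral_const,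
          volume_real_ball _ h3R, smul_eq_mul]
    -- The powers of `R` combine as `-2 (n - 2) - 2 + n = -(n - 2)`, and `n ≥ 3` makes the result at
    -- most `1 / R`.
    _ = A ^ 2 * C ^ 2 * 3 ^ n * vball n * (R ^ (n - 2))⁻¹ := by
        obtain ⟨k, hk⟩ : ∃ k, n = k + 2 := ⟨n - 2, by have := h3.out; omega⟩
        have e : R ^ n = R ^ (n - 2) * R ^ 2 := by rw [← pow_add]; congr 1; omega
        rw [hB, mul_pow, e]
        field_simp
    _ ≤ _ := by
        rw [div_eq_mul_inv]
        have := vball_pos (n := n)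
        refine mul_le_mul_of_nonneg_left (inv_anti₀ hR0 ?_) (by positivity)
        exact le_self_pow₀ hR (by have := h3.out; omega)

end CapPot

/-! ### Capacity at most flux: truncated potentials as admissible functions. -/

namespace CapPot
open scoped ContDiff

variable {n : ℕ} [h3 : Fact (3 ≤ n)] {U : Set (Rn n)} {M m : ℝ}

/-! ### The capacity of an open set is at most its flux -/

theorem IsFlux.exists_decay (h : IsFlux U m) : ∃ A R₀ : ℝ, 0 ≤ A ∧ 1 ≤ R₀ ∧
    ∀ x, R₀ ≤ ‖x‖ → potential U x ≤ A * (‖x‖ ^ (n - 2))⁻¹ := by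
  obtain ⟨R, hR, h1⟩ := h 1 one_pos
  have hc := fundConst_pos (n := n)
  refine ⟨(|m| + 1) * fundConst n, max R 1, by positivity, le_max_right _ _, fun x hx => ?_⟩
  have h2 := (abs_le.1 (h1 x ((le_max_left _ _).trans hx))).2
  have h4 : m * fundSol n x ≤ |m| * fundSol n x :=
    mul_le_mul_of_nonneg_right (le_abs_self m) (fundSol_nonneg x)
  rw [mul_assoc, ← fundSol_eq]
  linarith

theorem integrable_mul_mollMass (hU : U ⊆ Metric.ball 0 M) (ho : IsOpen U) {ε : ℝ} (hε : 0 < ε)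
    {g : Rn n → ℝ} (hg : Continuous g) : Integrable fun x => g x * mollMass U ε x :=
  (hg.mul (contDiff_mollMass hU ho hε).continuous).integrable_of_hasCompactSupport
    (hasCompactSupport_mollMass hU ho hε).mul_left

theorem integral_mollMass (hU : U ⊆ Metric.ball 0 M) (ho : IsOpen U) (hm : IsFlux U m) {ε : ℝ}
    (hε : 0 < ε) : ∫ x, mollMass U ε x = m := (isFlux_mollMass hU ho hε).unique hm

theorem integral_mul_mollMass_le (hU : U ⊆ Metric.ball 0 M) (ho : IsOpen U) (hm : IsFlux U m)
    {ε : ℝ} (hε : 0 < ε) {g : Rn n → ℝ} (hg : Continuous g) (hg1 : ∀ x, g x ≤ 1) :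
    ∫ x, g x * mollMass U ε x ≤ m := by
  rw [← integral_mollMass hU ho hm hε]
  refine integral_mono (integrable_mul_mollMass hU ho hε hg)
    ((contDiff_mollMass hU ho hε).continuous.integrable_of_hasCompactSupport
      (hasCompactSupport_mollMass hU ho hε)) fun x => ?_
  exact mul_le_of_le_one_left (mollMass_nonneg hU ho hε x) (hg1 x)

/-- The main term of the truncated energy is the integral of `χ² w ≤ 1` against the mass, hence at
most the flux; the cutoff term is small because the potential decays like the fundamental solution.
-/
theorem energy_trunc_le (hU : U ⊆ Metric.ball 0 M) (ho : IsOpen U) (hm : IsFlux U m)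
    {ε : ℝ} (hε : 0 < ε) {C R A : ℝ} {χ : Rn n → ℝ} (hχ : IsCutoff C R χ) (hR : 1 ≤ R)
    (hA : 0 ≤ A) (hdec : ∀ x, R ≤ ‖x‖ → potential U x ≤ A * (‖x‖ ^ (n - 2))⁻¹) :
    ∫ x, ‖grad (fun y => χ y * moll ε (potential U) y) x‖ ^ 2
      ≤ m + A ^ 2 * C ^ 2 * 3 ^ n * vball n / R := by
  have hw := contDiff_moll_potential hU ho hε
  have hmem := moll_potential_mem hU ho ε
  rw [integral_norm_grad_mul_sq hw hχ.smooth hχ.compact]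
  refine add_le_add ?_ ?_
  · refine integral_mul_mollMass_le hU ho hm hε
      (g := fun x => χ x ^ 2 * moll ε (potential U) x)
      ((hχ.smooth.continuous.pow 2).mul hw.continuous) fun x => ?_
    have h1 : χ x ^ 2 ≤ 1 := pow_le_one₀ (hχ.nonneg x) (hχ.le_one x)
    exact mul_le_one₀ h1 (hmem x).1 (hmem x).2
  · refine integral_sq_le_of_decay hR hA (fun x hx => ?_) (fun x => sq_nonneg _)
      (fun x hx => by rw [hχ.grad_eq_zero hx]; simp)
      fun x => pow_le_pow_left₀ (norm_nonneg _) (hχ.grad_le x) 2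
    rw [abs_of_nonneg (hmem x).1]
    exact (moll_potential_le hU ho hε x).trans (hdec x hx)

/-- The mutual energies are increasing, so mollified potentials form a Cauchy sequence. -/
theorem integral_norm_grad_sub_sq_le (hU : U ⊆ Metric.ball 0 M) (ho : IsOpen U) {ε δ : ℝ}
    (hδ : 0 < δ) (hδε : δ ≤ ε) :
    ∫ x, ‖grad (fun y => moll ε (potential U) y - moll δ (potential U) y) x‖ ^ 2
      ≤ (∫ x, moll δ (potential U) x * mollMass U δ x)
        - ∫ x, moll ε (potential U) x * mollMass U ε x := by
  have hε : 0 < ε := hδ.trans_le hδε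
  have hw := contDiff_moll_potential hU ho hε
  have hv := contDiff_moll_potential hU ho hδ
  set w := moll ε (potential U) with hwdef
  set v := moll δ (potential U) with hvdef
  have hd : ContDiff ℝ ∞ fun y => w y - v y := hw.sub hv
  have hdc : HasCompactSupport fun y => w y - v y := by
    refine HasCompactSupport.of_support_subset_isCompact
      (isCompact_closedBall (0 : Rn n) (M + 2 * ε)) fun y hy => ?_
    by_contra h
    rw [mem_closedBall_zero_iff, not_le] at h
    refine hy ?_
    show w y - v y = 0
    rw [hwdef, hvdef, moll_potential_eq hU ho hε h, moll_potential_eq hU ho hδ (by linarith),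
      sub_self]
  have hlw : ∀ x, lap w x = - mollMass U ε x := fun x => by rw [mollMass, neg_neg]
  have hlv : ∀ x, lap v x = - mollMass U δ x := fun x => by rw [mollMass, neg_neg]
  have hld : ∀ x, lap (fun y => w y - v y) x = mollMass U δ x - mollMass U ε x := fun x => by
    rw [congrFun (lap_sub hw hv) x, hlw, hlv]; ring
  have iww := integrable_mul_mollMass hU ho hε hw.continuous
  have ivw := integrable_mul_mollMass hU ho hε hv.continuous
  have iwv := integrable_mul_mollMass hU ho hδ hw.continuous
  have ivv := integrable_mul_mollMass hU ho hδ hv.continuous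
  -- Green's identity is applied to `w` and `w - v`: neither `w` nor `v` need have compact support,
  -- but their difference has it.
  have hsym : ∫ x, w x * mollMass U δ x = ∫ x, v x * mollMass U ε x := by
    have h1 := integral_lap_mul_comm hw hd hdc
    have e1 : ∫ x, lap w x * (w x - v x)
        = (∫ x, v x * mollMass U ε x) - ∫ x, w x * mollMass U ε x := by
      rw [← integral_sub ivw iww]
      exact integral_congr_ae (Eventually.of_forall fun x => by simp only [hlw]; ring)
    have e2 : ∫ x, lap (fun y => w y - v y) x * w x
        = (∫ x, w x * mollMass U δ x) - ∫ x, w x * mollMass U ε x := by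
      rw [← integral_sub iwv iww]
      exact integral_congr_ae (Eventually.of_forall fun x => by simp only [hld]; ring)
    rw [e1, e2] at h1
    linarith
  have hmono : ∫ x, w x * mollMass U ε x ≤ ∫ x, v x * mollMass U ε x :=
    integral_mono iww ivw fun x => mul_le_mul_of_nonneg_right
      (moll_potential_antitone hU ho hδ hδε x) (mollMass_nonneg hU ho hε x)
  have e3 : ∫ x, - lap (fun y => w y - v y) x * (w x - v x)
      = ((∫ x, w x * mollMass U ε x) - ∫ x, v x * mollMass U ε x)
        - ((∫ x, w x * mollMass U δ x) - ∫ x, v x * mollMass U δ x) := by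
    have i1 : Integrable fun x => w x * mollMass U ε x - v x * mollMass U ε x := iww.sub ivw
    have i2 : Integrable fun x => w x * mollMass U δ x - v x * mollMass U δ x := iwv.sub ivv
    rw [← integral_sub iww ivw, ← integral_sub iwv ivv, ← integral_sub i1 i2]
    exact integral_congr_ae (Eventually.of_forall fun x => by simp only [hld]; ring)
  rw [integral_norm_grad_sq_eq hd hdc, e3]
  linarith

theorem norm_toLp_sq {F : Rn n → Rn n} (hF : MemLp F 2 volume) :
    ‖hF.toLp F‖ ^ 2 = ∫ x, ‖F x‖ ^ 2 := by
  rw [← real_inner_self_eq_norm_sq, L2.inner_def]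
  refine integral_congr_ae ?_
  filter_upwards [hF.coeFn_toLp] with x hx
  rw [hx, real_inner_self_eq_norm_sq]

/-- Passage to the limit in the definition of the weak gradient. -/
theorem exists_weakGradient_of_cauchy {v : ℕ → Rn n → ℝ} {u : Rn n → ℝ}
    (hv : ∀ j, ContDiff ℝ ∞ (v j)) (hc : ∀ j, HasCompactSupport (v j)) {C E : ℝ}
    (hb : ∀ j x, |v j x| ≤ C) (hlim : ∀ x, Tendsto (fun j => v j x) atTop (𝓝 (u x)))
    {a : ℕ → ℝ} (ha : CauchySeq a)
    (hcau : ∀ j k, j ≤ k → ∫ x, ‖grad (fun y => v j y - v k y) x‖ ^ 2 ≤ a k - a j)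
    (hE : ∀ j, ∫ x, ‖grad (v j) x‖ ^ 2 ≤ E) :
    ∃ G : Rn n → Rn n, MemLp G 2 volume ∧ IsWeakGradient u G ∧ ∫ x, ‖G x‖ ^ 2 ≤ E := by
  have hL := fun j => memLp_grad (hv j) (hc j)
  let F : ℕ → Lp (Rn n) 2 (volume : Measure (Rn n)) := fun j => (hL j).toLp (grad (v j))
  have hsq : ∀ j k, j ≤ k → ‖F j - F k‖ ^ 2 ≤ a k - a j := fun j k hjk => by
    have e : F j - F k = ((hL j).sub (hL k)).toLp (grad (v j) - grad (v k)) :=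
      (MemLp.toLp_sub (hL j) (hL k)).symm
    rw [e, norm_toLp_sq]
    refine le_trans (le_of_eq (integral_congr_ae (Eventually.of_forall fun x => ?_))) (hcau j k hjk)
    have : grad (fun y => v j y - v k y) x = grad (v j) x - grad (v k) x := by
      ext i
      simp [grad, pd_sub (hv j) (hv k)]
    simp [this]
  have hF : CauchySeq F := by
    rw [Metric.cauchySeq_iff'] at ha ⊢
    intro η hη
    obtain ⟨N, hN⟩ := ha (η ^ 2) (by positivity)
    refine ⟨N, fun j hj => ?_⟩
    have h1 := hN j hj
    rw [Real.dist_eq] at h1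
    rw [dist_comm, dist_eq_norm]
    have h2 := (hsq N j hj).trans (le_abs_self _)
    exact lt_of_pow_lt_pow_left₀ 2 hη.le (h2.trans_lt h1)
  obtain ⟨G, hG⟩ := cauchySeq_tendsto_of_complete hF
  refine ⟨G, Lp.memLp G, fun ψ hψ hψc e => ?_, ?_⟩
  · have hΨ : MemLp (fun x => ψ x • e) 2 (volume : Measure (Rn n)) :=
      (hψ.continuous.smul continuous_const).memLp_of_hasCompactSupport hψc.smul_right
    have h1 : Tendsto (fun j => inner ℝ (hΨ.toLp _) (F j)) atTop (𝓝 (inner ℝ (hΨ.toLp _) G)) :=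
      tendsto_const_nhds.inner hG
    have e1 : ∀ H : Lp (Rn n) 2 (volume : Measure (Rn n)),
        inner ℝ (hΨ.toLp _) H = ∫ x, ψ x * inner ℝ (H x) e := fun H => by
      rw [L2.inner_def]
      refine integral_congr_ae ?_
      filter_upwards [hΨ.coeFn_toLp] with x hx
      rw [hx, real_inner_smul_left, real_inner_comm]
    have hdc : Continuous fun x => fderiv ℝ ψ x e :=
      (hψ.continuous_fderiv (by simp)).clm_apply continuous_const
    have hdcs : HasCompactSupport fun x => fderiv ℝ ψ x e := hψc.fderiv_apply ℝ e
    have e2 : ∀ j, ∫ x, v j x * fderiv ℝ ψ x e = - inner ℝ (hΨ.toLp _) (F j) := fun j => by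
      have h2 : ∫ x, ψ x * inner ℝ (F j x) e = ∫ x, fderiv ℝ (v j) x e * ψ x := by
        refine integral_congr_ae ?_
        filter_upwards [(hL j).coeFn_toLp] with x hx
        have hx' : (F j) x = grad (v j) x := hx
        rw [hx', inner_grad, mul_comm]
      rw [e1, h2]
      refine integral_mul_fderiv_eq_neg_fderiv_mul_of_integrable ?_ ?_ ?_
        (fun x _ => differentiable_of_smooth (hv j) x)
        (fun x _ => differentiable_of_smooth hψ x)
      · exact ((((hv j).continuous_fderiv (by simp)).clm_apply continuous_const).mul
          hψ.continuous).integrable_of_hasCompactSupport hψc.mul_left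
      · exact ((hv j).continuous.mul hdc).integrable_of_hasCompactSupport hdcs.mul_left
      · exact ((hv j).continuous.mul hψ.continuous).integrable_of_hasCompactSupport hψc.mul_left
    have h2 : Tendsto (fun j => ∫ x, v j x * fderiv ℝ ψ x e) atTop
        (𝓝 (∫ x, u x * fderiv ℝ ψ x e)) := by
      refine tendsto_integral_of_dominated_convergence (fun x => C * |fderiv ℝ ψ x e|)
        (fun j => ((hv j).continuous.mul hdc).aestronglyMeasurable)
        ((hdc.integrable_of_hasCompactSupport hdcs).abs.const_mul C)
        (fun j => Eventually.of_forall fun x => ?_)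
        (Eventually.of_forall fun x => (hlim x).mul_const _)
      rw [norm_mul]
      exact mul_le_mul_of_nonneg_right (hb j x) (abs_nonneg _)
    simp_rw [e2] at h2
    rw [← e1 G]
    exact tendsto_nhds_unique h2 h1.neg
  · have e1 : ∫ x, ‖G x‖ ^ 2 = ‖G‖ ^ 2 := by
      rw [← real_inner_self_eq_norm_sq, L2.inner_def]
      exact integral_congr_ae (Eventually.of_forall fun x => by
        simp only [real_inner_self_eq_norm_sq])
    rw [e1]
    refine le_of_tendsto' (hG.norm.pow 2) fun j => ?_
    rw [norm_toLp_sq (hL j)]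
    exact hE j

/-- The function is `χ` times the potential itself, which is exactly `1` on `U`; its mollifications
need not be. Its weak gradient is an `L²` limit, the gradients being Cauchy because the
self-energies `a j` increase and are bounded by the flux. -/
theorem exists_h1_competitor (hU : U ⊆ Metric.ball 0 M) (ho : IsOpen U) (hm : IsFlux U m) {η : ℝ}
    (hη : 0 < η) : ∃ (u : Rn n → ℝ) (G : Rn n → Rn n), IsH1With u G ∧ (∀ x ∈ U, 1 ≤ u x) ∧
      Tendsto u (Bornology.cobounded (Rn n)) (𝓝 0) ∧ ∫ x, ‖G x‖ ^ 2 ≤ m + η := by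
  obtain ⟨A, R₀, hA, hR₀, hdec⟩ := hm.exists_decay
  obtain ⟨C, hC, hcut⟩ := exists_isCutoff (n := n)
  set D := A ^ 2 * C ^ 2 * 3 ^ n * vball n with hD
  have hD0 : 0 ≤ D := by have := vball_pos (n := n); positivity
  -- The cutoff starts beyond the decay radius `R₀`, beyond `M + 2`, where all mollifications of
  -- scale at most `1` agree with the potential, and far enough to make the truncation error at most
  -- `η`.
  set R := max (max R₀ (M + 3)) (D / η) with hR
  have hR1 : R₀ ≤ R := (le_max_left _ _).trans (le_max_left _ _)
  have hR2 : M + 3 ≤ R := (le_max_right _ _).trans (le_max_left _ _)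
  have hR3 : D / η ≤ R := le_max_right _ _
  have hRpos : 0 < R := by linarith
  have hDR : D / R ≤ η := by
    rw [div_le_iff₀ hRpos]
    rw [div_le_iff₀ hη] at hR3
    linarith
  obtain ⟨χ, hχ⟩ := hcut R hRpos
  set φ := potential U with hφ
  let v : ℕ → Rn n → ℝ := fun j y => χ y * moll (scale j) φ y
  have hv : ∀ j, ContDiff ℝ ∞ (v j) := fun j =>
    hχ.smooth.mul (contDiff_moll_potential hU ho (scale_pos j))
  have hvc : ∀ j, HasCompactSupport (v j) := fun j => hχ.compact.mul_right
  have hb : ∀ j x, |v j x| ≤ 1 := fun j x => by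
    have h1 := moll_potential_mem hU ho (scale j) x
    have h0 := mul_nonneg (hχ.nonneg x) h1.1
    rw [abs_of_nonneg h0]
    exact mul_le_one₀ (hχ.le_one x) h1.1 h1.2
  have hlim : ∀ x, Tendsto (fun j => v j x) atTop (𝓝 (χ x * φ x)) := fun x =>
    ((tendsto_moll_potential hU ho x).comp tendsto_scale').const_mul _
  let a : ℕ → ℝ := fun j => ∫ x, moll (scale j) φ x * mollMass U (scale j) x
  have hscale1 : ∀ j, scale j ≤ 1 := fun j => by
    have := scale_anti (Nat.zero_le j)
    simpa [scale] using this
  have hcau : ∀ j k, j ≤ k → ∫ x, ‖grad (fun y => v j y - v k y) x‖ ^ 2 ≤ a k - a j := by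
    intro j k hjk
    -- The cutoff disappears from differences: two mollifications can differ only where `χ = 1`.
    have e : (fun y => v j y - v k y) = fun y => moll (scale j) φ y - moll (scale k) φ y := by
      ext y
      simp only [v]
      by_cases hy : ‖y‖ ≤ R
      · rw [hχ.eq_one y hy, one_mul, one_mul]
      · rw [moll_potential_eq hU ho (scale_pos j) (by linarith [hscale1 j]),
          moll_potential_eq hU ho (scale_pos k) (by linarith [hscale1 k]), sub_self, sub_self]
    rw [e]
    exact integral_norm_grad_sub_sq_le hU ho (scale_pos k) (scale_anti hjk)
  have hamono : Monotone a := fun j k hjk =>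
    sub_nonneg.1 ((integral_nonneg fun x => sq_nonneg _).trans (hcau j k hjk))
  have habdd : BddAbove (range a) := ⟨m, by
    rintro _ ⟨j, rfl⟩
    exact integral_mul_mollMass_le hU ho hm (scale_pos j)
      (contDiff_moll_potential hU ho (scale_pos j)).continuous
      fun x => (moll_potential_mem hU ho (scale j) x).2⟩
  have hac : CauchySeq a := (tendsto_atTop_ciSup hamono habdd).cauchySeq
  obtain ⟨G, hG, hGw, hGE⟩ := exists_weakGradient_of_cauchy hv hvc hb hlim hac hcau (E := m + η)
    fun j => (energy_trunc_le hU ho hm (scale_pos j) hχ (hR₀.trans hR1) hA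
      fun x hx => hdec x (hR1.trans hx)).trans (by linarith)
  have hu1 : ∀ x, χ x * φ x ≤ 1 := fun x =>
    mul_le_one₀ (hχ.le_one x) (potential_nonneg U x) (potential_le_one hU x)
  have hu0 : ∀ x, 0 ≤ χ x * φ x := fun x => mul_nonneg (hχ.nonneg x) (potential_nonneg U x)
  have hum : Measurable fun x => χ x * φ x :=
    hχ.smooth.continuous.measurable.mul (measurable_potential hU ho)
  have huz : ∀ x, 2 * R < ‖x‖ → χ x * φ x = 0 := fun x hx => by rw [hχ.eq_zero x hx, zero_mul]
  refine ⟨fun x => χ x * φ x, G, ⟨?_, hG, hGw⟩, fun x hx => ?_, ?_, hGE⟩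
  · rw [memLp_two_iff_integrable_sq hum.aestronglyMeasurable]
    refine integrable_of_bdd_supp (C := 1) (ρ := 2 * R) (hum.pow_const 2).aestronglyMeasurable
      (fun y => ?_) fun y hy => by rw [huz y hy]; simp
    rw [abs_of_nonneg (sq_nonneg _)]
    exact pow_le_one₀ (hu0 y) (hu1 y)
  · have hx' := hU hx
    rw [mem_ball_zero_iff] at hx'
    show 1 ≤ χ x * φ x
    rw [hχ.eq_one x (by linarith), one_mul]
    exact (potential_eq_one hU hx).ge
  · refine tendsto_const_nhds.congr' ?_
    have hev : ∀ᶠ x : Rn n in Bornology.cobounded (Rn n), 2 * R < ‖x‖ :=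
      tendsto_norm_cobounded_atTop.eventually_gt_atTop (2 * R)
    filter_upwards [hev] with x hx
    exact (huz x hx).symm

theorem cap_bddBelow (A : Set (Rn n)) : BddBelow {c : ℝ | ∃ (u : Rn n → ℝ) (G : Rn n → Rn n),
    IsH1With u G ∧ (∃ U : Set (Rn n), IsOpen U ∧ A ⊆ U ∧ ∀ x ∈ U, 1 ≤ u x) ∧
    Tendsto u (Bornology.cobounded (Rn n)) (𝓝 0) ∧ c = ∫ x, ‖G x‖ ^ 2} :=
  ⟨0, by rintro _ ⟨u, G, -, -, -, rfl⟩; exact integral_nonneg fun x => sq_nonneg _⟩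

theorem cap_le_flux (hU : U ⊆ Metric.ball 0 M) (ho : IsOpen U) (hm : IsFlux U m) : cap U ≤ m := by
  refine le_of_forall_pos_le_add fun η hη => ?_
  obtain ⟨u, G, h1, h2, h4, h5⟩ := exists_h1_competitor hU ho hm hη
  exact (csInf_le (cap_bddBelow U) ⟨u, G, h1, ⟨U, ho, Subset.rfl, h2⟩, h4, rfl⟩).trans h5

end CapPot

/-! ### Flux at most capacity: testing admissible functions against the potential. -/

namespace CapPot
open scoped ContDiff

variable {n : ℕ} [h3 : Fact (3 ≤ n)] {U : Set (Rn n)} {M m : ℝ}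

/-! ### The capacity of an open set is at least its flux -/

theorem integrable_mul_of_memLp_two {f g : Rn n → ℝ} (hf : MemLp f 2 volume)
    (hg : MemLp g 2 volume) : Integrable fun x => f x * g x := hf.integrable_mul hg

theorem integrable_inner_of_memLp_two {F H : Rn n → Rn n} (hF : MemLp F 2 volume)
    (hH : MemLp H 2 volume) : Integrable fun x => inner ℝ (F x) (H x) := by
  refine (L2.integrable_inner (𝕜 := ℝ) (hF.toLp F) (hH.toLp H)).congr ?_
  filter_upwards [hF.coeFn_toLp, hH.coeFn_toLp] with x h1 h2
  rw [h1, h2]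

/-- The weak gradient tested with the field `χ ∇w - w ∇χ`. -/
theorem IsH1With.integral_mul_lap {u : Rn n → ℝ} {G : Rn n → Rn n} (h : IsH1With u G)
    {w χ : Rn n → ℝ} (hw : ContDiff ℝ ∞ w) (hχ : ContDiff ℝ ∞ χ) (hc : HasCompactSupport χ) :
    ∫ x, u x * (χ x * lap w x - w x * lap χ x)
      = - ∫ x, inner ℝ (G x) (grad (fun y => χ y * w y) x - (2 * w x) • grad χ x) := by
  let ψ : Fin n → Rn n → ℝ := fun i x => χ x * pd i w x - w x * pd i χ x
  have hψ : ∀ i, ContDiff ℝ ∞ (ψ i) := fun i =>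
    (hχ.mul (contDiff_pd hw i)).sub (hw.mul (contDiff_pd hχ i))
  have hψc : ∀ i, HasCompactSupport (ψ i) := fun i =>
    (hc.mul_right).sub ((hasCompactSupport_pd hc i).mul_left)
  have hpd : ∀ i x, pd i (ψ i) x = χ x * pd i (pd i w) x - w x * pd i (pd i χ) x := fun i x => by
    have e : pd i (ψ i) x = pd i (fun x => χ x * pd i w x) x - pd i (fun x => w x * pd i χ x) x :=
      congrFun (pd_sub (hχ.mul (contDiff_pd hw i)) (hw.mul (contDiff_pd hχ i)) i) x
    rw [e, pd_mul hχ (contDiff_pd hw i), pd_mul hw (contDiff_pd hχ i)]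
    ring
  have e1 : ∫ x, u x * (χ x * lap w x - w x * lap χ x) = ∑ i, ∫ x, u x * pd i (ψ i) x := by
    rw [← integral_finsetSum]
    · refine integral_congr_ae (Eventually.of_forall fun x => ?_)
      simp only [hpd, lap, ← Finset.mul_sum, Finset.sum_sub_distrib]
    · exact fun i _ => integrable_mul_of_memLp_two h.memLp
        ((contDiff_pd (hψ i) i).continuous.memLp_of_hasCompactSupport (hasCompactSupport_pd (hψc i) i))
  have e2 : ∫ x, inner ℝ (G x) (grad (fun y => χ y * w y) x - (2 * w x) • grad χ x)
      = ∑ i, ∫ x, ψ i x * inner ℝ (G x) (stdVec i) := by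
    rw [← integral_finsetSum]
    · refine integral_congr_ae (Eventually.of_forall fun x => ?_)
      simp only [PiLp.inner_apply]
      refine Finset.sum_congr rfl fun i _ => ?_
      simp only [grad, pd_mul hχ hw, ψ, PiLp.sub_apply, PiLp.smul_apply, smul_eq_mul]
      rw [← PiLp.inner_apply, EuclideanSpace.inner_single_right]
      simp
      exact Or.inl (by ring)
    · refine fun i _ => integrable_mul_of_memLp_two
        ((hψ i).continuous.memLp_of_hasCompactSupport (hψc i)) ?_
      exact h.memLp_grad.inner_const (stdVec i)
  rw [e1, e2, ← Finset.sum_neg_distrib]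
  exact Finset.sum_congr rfl fun i _ => h.weakGrad (ψ i) (hψ i) (hψc i) (stdVec i)

/-- Young's inequality, with weight `1 / 2` for the main term and weight `s` for the cutoff terms.
The latter carry `s⁻¹` only on quantities that vanish as the cutoff recedes. -/
theorem inner_sub_mul_le {E : Type*} [NormedAddCommGroup E] [InnerProductSpace ℝ E] (g a b : E)
    (u w l : ℝ) {s : ℝ} (hs : 0 < s) :
    inner ℝ g (a - (2 * w) • b) - u * (w * l) ≤ (1 / 2) * ‖a‖ ^ 2 + (1 / 2 + s) * ‖g‖ ^ 2
      + s * u ^ 2 + s⁻¹ * (w ^ 2 * ‖b‖ ^ 2) + s⁻¹ * (w ^ 2 * l ^ 2) := by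
  have h1 : inner ℝ g a ≤ ‖g‖ * ‖a‖ := real_inner_le_norm g a
  have h2 : -(w * inner ℝ g b) ≤ |w| * (‖g‖ * ‖b‖) := by
    refine (neg_le_abs _).trans ?_
    rw [abs_mul]
    exact mul_le_mul_of_nonneg_left (abs_real_inner_le_norm g b) (abs_nonneg w)
  obtain ⟨t, ht, rfl⟩ : ∃ t, 0 < t ∧ t ^ 2 = s := ⟨√s, Real.sqrt_pos.2 hs, Real.sq_sqrt hs.le⟩
  rw [inner_sub_right, real_inner_smul_right]
  have e1 : t * t⁻¹ = 1 := mul_inv_cancel₀ ht.ne'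
  have h4 := sq_nonneg (t * ‖g‖ - t⁻¹ * (|w| * ‖b‖))
  have h5 := sq_nonneg (t * u + t⁻¹ * (w * l))
  have h6 : 0 ≤ (t * u) ^ 2 + (t⁻¹ * (w * l)) ^ 2 := by positivity
  have e4 : (t * ‖g‖ - t⁻¹ * (|w| * ‖b‖)) ^ 2
      = t ^ 2 * ‖g‖ ^ 2 + (t ^ 2)⁻¹ * (w ^ 2 * ‖b‖ ^ 2) - 2 * (|w| * (‖g‖ * ‖b‖)) := by
    rw [← sq_abs w, inv_eq_one_div (t ^ 2), ← one_div_pow, one_div]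
    linear_combination (-2 * |w| * ‖g‖ * ‖b‖) * e1
  have e5 : (t * u + t⁻¹ * (w * l)) ^ 2
      = t ^ 2 * u ^ 2 + (t ^ 2)⁻¹ * (w ^ 2 * l ^ 2) + 2 * (u * (w * l)) := by
    rw [inv_eq_one_div (t ^ 2), ← one_div_pow, one_div]
    linear_combination (2 * u * w * l) * e1
  have e6 : (t * u) ^ 2 + (t⁻¹ * (w * l)) ^ 2 = t ^ 2 * u ^ 2 + (t ^ 2)⁻¹ * (w ^ 2 * l ^ 2) := by
    rw [inv_eq_one_div (t ^ 2), ← one_div_pow, one_div]; ring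
  have h7 := sq_nonneg (‖g‖ - ‖a‖)
  nlinarith

/-- The mollified mass lives where `u ≥ 1` and `χ = 1`, so the flux is at most the integral of `u χ`
against it. The weak gradient identity turns this into the pairing of `G` with the gradient of the
truncated potential, up to cutoff terms, and `energy_trunc_le` bounds the energy of the latter by
about the flux. -/
theorem flux_le_of_isCutoff (hU : U ⊆ Metric.ball 0 M) (ho : IsOpen U) (hm : IsFlux U m)
    {V : Set (Rn n)} {τ : ℝ} (hτ : 0 < τ) (hUV : ∀ x ∈ U, Metric.closedBall x τ ⊆ V)
    {u : Rn n → ℝ} {G : Rn n → Rn n} (hu : IsH1With u G) (hu1 : ∀ x ∈ V, 1 ≤ u x)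
    {C R A : ℝ} (hC : 0 ≤ C) {χ : Rn n → ℝ} (hχ : IsCutoff C R χ) (hR : 1 ≤ R) (hRM : M + τ ≤ R)
    (hA : 0 ≤ A) (hdec : ∀ x, R ≤ ‖x‖ → potential U x ≤ A * (‖x‖ ^ (n - 2))⁻¹)
    {s : ℝ} (hs : 0 < s) :
    m ≤ (1 / 2) * (m + A ^ 2 * C ^ 2 * 3 ^ n * vball n / R) + (1 / 2 + s) * (∫ x, ‖G x‖ ^ 2)
      + s * (∫ x, u x ^ 2) + s⁻¹ * (A ^ 2 * C ^ 2 * 3 ^ n * vball n / R)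
      + s⁻¹ * (A ^ 2 * C ^ 2 * 3 ^ n * vball n / R) := by
  -- With this scale `16 * ε < τ`, so the mass stays within `τ` of `U`, and `M + 17 * ε = M + τ ≤
  -- R`, so it stays where `χ = 1`.
  set ε := τ / 17 with hε
  have hε0 : 0 < ε := by positivity
  have hw := contDiff_moll_potential hU ho hε0
  have hmem := moll_potential_mem hU ho ε
  have hdw : ∀ x, R ≤ ‖x‖ → |moll ε (potential U) x| ≤ A * (‖x‖ ^ (n - 2))⁻¹ := fun x hx => by
    rw [abs_of_nonneg (hmem x).1]
    exact (moll_potential_le hU ho hε0 x).trans (hdec x hx)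
  have hE := energy_trunc_le hU ho hm hε0 hχ hR hA hdec
  set w := moll ε (potential U) with hwdef
  have hf := contDiff_mollMass hU ho hε0
  have hfc := hasCompactSupport_mollMass hU ho hε0
  have hpt : ∀ x, mollMass U ε x ≤ u x * (χ x * mollMass U ε x) := fun x => by
    by_cases hx : mollMass U ε x = 0
    · simp [hx]
    · have h1 : ‖x‖ ≤ M + 17 * ε := by
        by_contra! h
        exact hx (mollMass_eq_zero_of_far hU ho hε0 h)
      have h2 : ∃ y ∈ U, y ∈ Metric.closedBall x τ := by
        by_contra! h
        exact hx (mollMass_eq_zero hU ho hε0 (by rw [hε]; linarith) h)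
      obtain ⟨y, hy, hyx⟩ := h2
      have hxV := hUV y hy (Metric.mem_closedBall_comm.1 hyx)
      rw [hχ.eq_one x (by rw [hε] at h1; linarith), one_mul]
      exact le_mul_of_one_le_left (mollMass_nonneg hU ho hε0 x) (hu1 x hxV)
  have hgχ : Continuous (grad χ) := continuous_grad hχ.smooth
  have hgχc := hasCompactSupport_grad hχ.compact
  have hlχ : Continuous (lap χ) := (contDiff_lap hχ.smooth).continuous
  have hlχc := hasCompactSupport_lap hχ.compact
  have hχw : ContDiff ℝ ∞ fun y => χ y * w y := hχ.smooth.mul hw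
  have hχwc : HasCompactSupport fun y => χ y * w y := hχ.compact.mul_right
  have i1 : Integrable fun x => u x * (χ x * mollMass U ε x) :=
    integrable_mul_of_memLp_two hu.memLp
      ((hχ.smooth.continuous.mul hf.continuous).memLp_of_hasCompactSupport hfc.mul_left)
  have i2 : Integrable fun x => u x * (w x * lap χ x) :=
    integrable_mul_of_memLp_two hu.memLp
      ((hw.continuous.mul hlχ).memLp_of_hasCompactSupport hlχc.mul_left)
  have i3 : Integrable fun x => inner ℝ (G x) (grad (fun y => χ y * w y) x - (2 * w x) • grad χ x) := by
    have hΨ : MemLp (fun x => grad (fun y => χ y * w y) x - (2 * w x) • grad χ x) 2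
        (volume : Measure (Rn n)) :=
      ((continuous_grad hχw).sub ((continuous_const.mul hw.continuous).smul
        hgχ)).memLp_of_hasCompactSupport ((hasCompactSupport_grad hχwc).sub hgχc.smul_left)
    exact integrable_inner_of_memLp_two hu.memLp_grad hΨ
  have j1 : Integrable fun x => ‖grad (fun y => χ y * w y) x‖ ^ 2 :=
    (memLp_grad hχw hχwc).integrable_norm_pow two_ne_zero
  have j2 : Integrable fun x => ‖G x‖ ^ 2 := hu.memLp_grad.integrable_norm_pow two_ne_zero
  have j3 : Integrable fun x => u x ^ 2 := hu.memLp.integrable_sq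
  have j4 : Integrable fun x => w x ^ 2 * ‖grad χ x‖ ^ 2 := by
    refine ((hw.continuous.pow 2).mul (hgχ.norm.pow 2)).integrable_of_hasCompactSupport
      (HasCompactSupport.mul_left (hasCompactSupport_sq hgχc.norm))
  have j5 : Integrable fun x => w x ^ 2 * lap χ x ^ 2 := by
    refine ((hw.continuous.pow 2).mul (hlχ.pow 2)).integrable_of_hasCompactSupport
      (HasCompactSupport.mul_left (hasCompactSupport_sq hlχc))
  have b4 : ∫ x, w x ^ 2 * ‖grad χ x‖ ^ 2 ≤ A ^ 2 * C ^ 2 * 3 ^ n * vball n / R :=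
    integral_sq_le_of_decay hR hA hdw (fun x => sq_nonneg _)
      (fun x hx => by rw [hχ.grad_eq_zero hx]; simp)
      fun x => pow_le_pow_left₀ (norm_nonneg _) (hχ.grad_le x) 2
  have b5 : ∫ x, w x ^ 2 * lap χ x ^ 2 ≤ A ^ 2 * C ^ 2 * 3 ^ n * vball n / R :=
    integral_sq_le_of_decay hR hA hdw (fun x => sq_nonneg _)
      (fun x hx => by rw [hχ.lap_eq_zero hx]; simp) fun x => by
        rw [← sq_abs]
        refine pow_le_pow_left₀ (abs_nonneg _) ((hχ.lap_le x).trans ?_) 2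
        exact div_le_div_of_nonneg_left hC (by linarith) (le_self_pow₀ hR two_ne_zero)
  have hid : ∫ x, u x * (χ x * mollMass U ε x)
      = ∫ x, (inner ℝ (G x) (grad (fun y => χ y * w y) x - (2 * w x) • grad χ x)
          - u x * (w x * lap χ x)) := by
    have h1 := hu.integral_mul_lap hw hχ.smooth hχ.compact
    have h2 : ∫ x, u x * (χ x * lap w x - w x * lap χ x)
        = - (∫ x, u x * (χ x * mollMass U ε x)) - ∫ x, u x * (w x * lap χ x) := by
      have i4 : Integrable fun x => -(u x * (χ x * mollMass U ε x)) := i1.neg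
      rw [← integral_neg, ← integral_sub i4 i2]
      exact integral_congr_ae (Eventually.of_forall fun x => by
        simp only [mollMass, ← hwdef]; ring)
    rw [integral_sub i3 i2]
    linarith
  calc m = ∫ x, mollMass U ε x := (integral_mollMass hU ho hm hε0).symm
    _ ≤ ∫ x, u x * (χ x * mollMass U ε x) :=
        integral_mono (hf.continuous.integrable_of_hasCompactSupport hfc) i1 hpt
    _ ≤ ∫ x, ((1 / 2) * ‖grad (fun y => χ y * w y) x‖ ^ 2 + (1 / 2 + s) * ‖G x‖ ^ 2
          + s * u x ^ 2 + s⁻¹ * (w x ^ 2 * ‖grad χ x‖ ^ 2) + s⁻¹ * (w x ^ 2 * lap χ x ^ 2)) := by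
        rw [hid]
        exact integral_mono (i3.sub i2) (((((j1.const_mul _).add (j2.const_mul _)).add
          (j3.const_mul _)).add (j4.const_mul _)).add (j5.const_mul _))
          fun x => inner_sub_mul_le _ _ _ _ _ _ hs
    _ = (1 / 2) * (∫ x, ‖grad (fun y => χ y * w y) x‖ ^ 2) + (1 / 2 + s) * (∫ x, ‖G x‖ ^ 2)
          + s * (∫ x, u x ^ 2) + s⁻¹ * (∫ x, w x ^ 2 * ‖grad χ x‖ ^ 2)
          + s⁻¹ * (∫ x, w x ^ 2 * lap χ x ^ 2) := by
        rw [integral_add, integral_add, integral_add, integral_add, integral_const_mul,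
          integral_const_mul, integral_const_mul, integral_const_mul, integral_const_mul]
        · exact j1.const_mul _
        · exact j2.const_mul _
        · exact (j1.const_mul _).add (j2.const_mul _)
        · exact j3.const_mul _
        · exact ((j1.const_mul _).add (j2.const_mul _)).add (j3.const_mul _)
        · exact j4.const_mul _
        · exact (((j1.const_mul _).add (j2.const_mul _)).add (j3.const_mul _)).add (j4.const_mul _)
        · exact j5.const_mul _
    _ ≤ _ := by
        have hs' : 0 ≤ s⁻¹ := (inv_pos.2 hs).le
        gcongr

/-- The order of limits matters: `R → ∞` with `s` fixed kills the terms with `s⁻¹`, then `s → 0`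
leaves `m ≤ m / 2 + E / 2`. -/
theorem flux_le_energy (hU : U ⊆ Metric.ball 0 M) (ho : IsOpen U) (hm : IsFlux U m)
    {V : Set (Rn n)} {τ : ℝ} (hτ : 0 < τ) (hUV : ∀ x ∈ U, Metric.closedBall x τ ⊆ V)
    {u : Rn n → ℝ} {G : Rn n → Rn n} (hu : IsH1With u G) (hu1 : ∀ x ∈ V, 1 ≤ u x) :
    m ≤ ∫ x, ‖G x‖ ^ 2 := by
  obtain ⟨A, R₀, hA, hR₀, hdec⟩ := hm.exists_decay
  obtain ⟨C, hC, hcut⟩ := exists_isCutoff (n := n)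
  set D := A ^ 2 * C ^ 2 * 3 ^ n * vball n with hD
  set E := ∫ x, ‖G x‖ ^ 2 with hE
  set K := ∫ x, u x ^ 2 with hK
  have h1 : ∀ s, 0 < s → m ≤ (1 / 2) * m + (1 / 2 + s) * E + s * K := fun s hs => by
    have hlim : Tendsto (fun R : ℝ => (1 / 2) * (m + D / R) + (1 / 2 + s) * E + s * K
        + s⁻¹ * (D / R) + s⁻¹ * (D / R)) atTop
        (𝓝 ((1 / 2) * (m + 0) + (1 / 2 + s) * E + s * K + s⁻¹ * 0 + s⁻¹ * 0)) := by
      have h0 : Tendsto (fun R : ℝ => D / R) atTop (𝓝 0) := tendsto_id.const_div_atTop D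
      exact (((((h0.const_add m).const_mul _).add_const _).add_const _).add
        (h0.const_mul _)).add (h0.const_mul _)
    have h2 := ge_of_tendsto hlim (b := m) (by
      filter_upwards [eventually_ge_atTop (max R₀ (M + τ))] with R hR
      have hR1 := (le_max_left _ _).trans hR
      obtain ⟨χ, hχ⟩ := hcut R (by linarith)
      exact flux_le_of_isCutoff hU ho hm hτ hUV hu hu1 hC.le hχ (hR₀.trans hR1)
        ((le_max_right _ _).trans hR) hA (fun x hx => hdec x (hR1.trans hx)) hs)
    linarith
  have hlim : Tendsto (fun s : ℝ => (1 / 2) * m + (1 / 2 + s) * E + s * K) (𝓝[>] 0)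
      (𝓝 ((1 / 2) * m + (1 / 2 + 0) * E + 0 * K)) := by
    have : Continuous fun s : ℝ => (1 / 2) * m + (1 / 2 + s) * E + s * K := by fun_prop
    exact (this.tendsto 0).mono_left nhdsWithin_le_nhds
  have h2 := ge_of_tendsto hlim (b := m) (by
    filter_upwards [self_mem_nhdsWithin] with s hs using h1 s hs)
  linarith

theorem IsFlux.exists (hU : U ⊆ Metric.ball 0 M) (ho : IsOpen U) : ∃ m, IsFlux U m :=
  ⟨_, isFlux_mollMass hU ho one_pos⟩

/-- Mollification spreads mass slightly outside the set, so the preceding bound is applied to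
smaller open sets `V j` with a margin inside `U`. Their potentials increase to that of `U`, and the
radius of `IsFlux.uniform` is common to all `j`, so the bound on their fluxes survives. -/
theorem flux_le_energy_of_open (hU : U ⊆ Metric.ball 0 M) (ho : IsOpen U) (hm : IsFlux U m)
    {u : Rn n → ℝ} {G : Rn n → Rn n} (hu : IsH1With u G) (hu1 : ∀ x ∈ U, 1 ≤ u x) :
    m ≤ ∫ x, ‖G x‖ ^ 2 := by
  let V : ℕ → Set (Rn n) := fun j => interior {x | Metric.closedBall x (scale j) ⊆ U}
  have hVo : ∀ j, IsOpen (V j) := fun j => isOpen_interior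
  have hVU : ∀ j, ∀ x ∈ V j, Metric.closedBall x (scale j) ⊆ U := fun j x hx =>
    interior_subset (s := {x | Metric.closedBall x (scale j) ⊆ U}) hx
  have hVsub : ∀ j, V j ⊆ U := fun j x hx =>
    hVU j x hx (Metric.mem_closedBall_self (scale_pos j).le)
  have hVm : Monotone V := fun i j hij => interior_mono fun x hx =>
    (Metric.closedBall_subset_closedBall (scale_anti hij)).trans hx
  have hUn : U = ⋃ j, V j := by
    refine subset_antisymm (fun x hx => ?_) (iUnion_subset hVsub)
    obtain ⟨r, hr, hrU⟩ := Metric.isOpen_iff.1 ho x hx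
    obtain ⟨j, hj⟩ := (tendsto_scale.eventually (gt_mem_nhds (half_pos hr))).exists
    refine mem_iUnion.2 ⟨j, mem_interior.2 ⟨Metric.ball x (r / 2), fun y hy => ?_,
      Metric.isOpen_ball, Metric.mem_ball_self (half_pos hr)⟩⟩
    refine subset_trans (fun z hz => ?_) hrU
    rw [Metric.mem_closedBall] at hz
    rw [Metric.mem_ball] at hy ⊢
    linarith [dist_triangle z y x]
  refine hm.le_of_le (T := U) (fun δ hδ => ?_) fun x => le_rfl
  obtain ⟨R, hR, h⟩ := IsFlux.uniform (n := n) M hδ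
  refine ⟨R, hR, fun x hx => le_of_tendsto' (tendsto_potential_iUnion hVm hVo hU hUn x) fun j => ?_⟩
  obtain ⟨mj, hmj⟩ := IsFlux.exists ((hVsub j).trans hU) (hVo j)
  have h1 := (abs_le.1 (h (V j) ((hVsub j).trans hU) (hVo j) mj hmj x hx)).2
  have h2 := flux_le_energy ((hVsub j).trans hU) (hVo j) hmj (scale_pos j) (hVU j) hu hu1
  have h4 := mul_le_mul_of_nonneg_right h2 (fundSol_nonneg x)
  linarith

theorem cap_eq_of_isFlux (hU : U ⊆ Metric.ball 0 M) (ho : IsOpen U) (hm : IsFlux U m) :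
    cap U = m := by
  refine le_antisymm (cap_le_flux hU ho hm) ?_
  obtain ⟨u, G, h1, h2, h4, -⟩ := exists_h1_competitor hU ho hm one_pos
  refine le_csInf ⟨_, u, G, h1, ⟨U, ho, Subset.rfl, h2⟩, h4, rfl⟩ ?_
  rintro _ ⟨u, G, h1, ⟨U', -, hUU', h2⟩, -, rfl⟩
  exact flux_le_energy_of_open hU ho hm h1 fun x hx => h2 x (hUU' hx)

end CapPot

/-! ### Arbitrary bounded sets, and dilations. -/

namespace CapPot
open scoped ContDiff

variable {n : ℕ} [h3 : Fact (3 ≤ n)] {S T : Set (Rn n)} {M : ℝ}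

/-! ### Sets that are not open -/

theorem cap_nonempty (hS : S ⊆ Metric.ball 0 M) : {c : ℝ | ∃ (u : Rn n → ℝ) (G : Rn n → Rn n),
    IsH1With u G ∧ (∃ U : Set (Rn n), IsOpen U ∧ S ⊆ U ∧ ∀ x ∈ U, 1 ≤ u x) ∧
    Tendsto u (Bornology.cobounded (Rn n)) (𝓝 0) ∧ c = ∫ x, ‖G x‖ ^ 2}.Nonempty := by
  have hb : Metric.ball (0 : Rn n) M ⊆ Metric.ball 0 M := Subset.rfl
  obtain ⟨m, hm⟩ := IsFlux.exists hb Metric.isOpen_ball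
  obtain ⟨u, G, h1, h2, h4, -⟩ := exists_h1_competitor hb Metric.isOpen_ball hm one_pos
  exact ⟨_, u, G, h1, ⟨_, Metric.isOpen_ball, hS, h2⟩, h4, rfl⟩

theorem cap_mono (hT : T ⊆ Metric.ball 0 M) (hST : S ⊆ T) : cap S ≤ cap T := by
  refine csInf_le_csInf (cap_bddBelow S) (cap_nonempty hT) ?_
  rintro _ ⟨u, G, h1, ⟨U, hU, hTU, h2⟩, h4, rfl⟩
  exact ⟨u, G, h1, ⟨U, hU, hST.trans hTU, h2⟩, h4, rfl⟩

/-- The open set comes with a nearly optimal admissible function. The bound holds for all its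
subsets, so it can still be shrunk to improve the potential. -/
theorem exists_open_cap_lt (hS : S ⊆ Metric.ball 0 M) {c : ℝ} (hc : cap S < c) :
    ∃ V, IsOpen V ∧ S ⊆ V ∧ ∀ U ⊆ V, cap U < c := by
  obtain ⟨_, ⟨u, G, h1, ⟨V, hV, hSV, h2⟩, h4, rfl⟩, h5⟩ := exists_lt_of_csInf_lt (cap_nonempty hS) hc
  exact ⟨V, hV, hSV, fun U hU => (csInf_le (cap_bddBelow U)
    ⟨u, G, h1, ⟨V, hV, hU, h2⟩, h4, rfl⟩).trans_lt h5⟩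

/-- The asymptotics of capacitary potentials at infinity, uniformly over the subsets of a ball. -/
theorem exists_radius_potential (M : ℝ) {δ : ℝ} (hδ : 0 < δ) :
    ∃ R, 0 < R ∧ ∀ S : Set (Rn n), S ⊆ Metric.ball 0 M → ∀ x, R ≤ ‖x‖ →
      |potential S x - cap S * fundSol n x| ≤ δ * fundSol n x := by
  obtain ⟨R, hR, h⟩ := IsFlux.uniform (n := n) M hδ
  refine ⟨R, hR, fun S hS x hx => le_of_forall_pos_le_add fun t ht => ?_⟩
  have hf := fundSol_nonneg x
  -- The potential contributes an error `η` and the capacity an error `η * fundSol n x`, together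
  -- exactly `t`. The open set depends on `x` and `t`, the radius does not.
  set η := t / (1 + fundSol n x) with hη
  have hη0 : 0 < η := by positivity
  have hηt : η + η * fundSol n x = t := by rw [hη]; field_simp
  obtain ⟨V, hV, hSV, hVc⟩ := exists_open_cap_lt hS (lt_add_of_pos_right _ hη0)
  obtain ⟨U, hU, hSU, hUV, hUφ⟩ := exists_open_potential_le hS (hV.inter Metric.isOpen_ball)
    (subset_inter hSV hS) x (lt_add_of_pos_right _ hη0)
  have hUM : U ⊆ Metric.ball 0 M := hUV.trans inter_subset_right
  obtain ⟨m, hm⟩ := IsFlux.exists hUM hU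
  have h1 := abs_le.1 (h U hUM hU m hm x hx)
  have h2 := potential_mono hUM hSU x
  have h4 := mul_le_mul_of_nonneg_right (cap_mono hUM hSU) hf
  have h5 := mul_le_mul_of_nonneg_right (hVc U (hUV.trans inter_subset_left)).le hf
  rw [cap_eq_of_isFlux hUM hU hm] at h4 h5
  have h6 : 0 ≤ η * fundSol n x := by positivity
  rw [abs_le]
  constructor <;> nlinarith [h1.1, h1.2]

/-! ### Change of scale -/

section scaling

variable {p : Rn n} {a : ℝ}

theorem comp_affine_inv (ha : 0 < a) (p z : Rn n) : p + a • (-(a⁻¹ • p) + a⁻¹ • z) = z := by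
  rw [smul_add, smul_neg, smul_smul, smul_smul, mul_inv_cancel₀ ha.ne', one_smul, one_smul]
  abel

theorem preimage_affine_inv (ha : 0 < a) (p : Rn n) (S : Set (Rn n)) :
    (fun z : Rn n => -(a⁻¹ • p) + a⁻¹ • z) ⁻¹' ((fun y => p + a • y) ⁻¹' S) = S := by
  ext z
  simp only [mem_preimage, comp_affine_inv ha]

/-- The homeomorphism `y ↦ p + a y`. -/
noncomputable def affineHomeo (p : Rn n) (ha : 0 < a) : Rn n ≃ₜ Rn n :=
  (Homeomorph.smulOfNeZero a ha.ne').trans (Homeomorph.addLeft p)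

theorem map_affineHomeo (p : Rn n) (ha : 0 < a) :
    Measure.map (affineHomeo p ha) volume
      = ENNReal.ofReal |(a ^ n)⁻¹| • (volume : Measure (Rn n)) := by
  have e : ⇑(affineHomeo p ha) = (fun y => p + y) ∘ (fun y => a • y) := rfl
  rw [e, ← Measure.map_map (measurable_const_add p) (measurable_const_smul a),
    Measure.map_addHaar_smul _ ha.ne', Measure.map_smul, map_add_left_eq_self, finrank_euclideanSpace_fin]

theorem Superharmonic.comp_affine {v : Rn n → ℝ} (h : Superharmonic v) (p : Rn n) (ha : 0 < a) :
    Superharmonic fun y => v (p + a • y) where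
  lsc := h.lsc.comp (by fun_prop)
  locInt := by
    have h1 : LocallyIntegrable v (Measure.map (affineHomeo p ha) volume) := by
      rw [map_affineHomeo]
      intro x
      obtain ⟨s, hs, hi⟩ := h.locInt x
      refine ⟨s, hs, ?_⟩
      rw [IntegrableOn, Measure.restrict_smul]
      exact hi.smul_measure ENNReal.ofReal_ne_top
    exact (locallyIntegrable_map_homeomorph (affineHomeo p ha)).1 h1
  mean_le := fun x r hr => by
    have h1 := h.mean_le (p + a • x) (a * r) (mul_pos ha hr)
    have h2 := wmean_ballWt v (p + a • x) (mul_pos ha hr)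
    have h4 : wmean (ballWt n) v (p + a • x) (a * r)
        = wmean (ballWt n) (fun y => v (p + a • y)) x r := by
      simp only [wmean, smul_add, smul_smul, add_assoc]
    rw [h4, wmean_ballWt _ _ hr] at h2
    rwa [mul_left_cancel₀ vball_pos.ne' h2]

theorem tendsto_affine_cobounded (p : Rn n) (ha : 0 < a) :
    Tendsto (fun y : Rn n => p + a • y) (Bornology.cobounded _) (Bornology.cobounded _) := by
  rw [← tendsto_norm_atTop_iff_cobounded]
  have h : Tendsto (fun y : Rn n => a * ‖y‖ - ‖p‖) (Bornology.cobounded _) atTop :=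
    tendsto_atTop_add_const_right _ _ (tendsto_norm_cobounded_atTop.const_mul_atTop ha)
  refine tendsto_atTop_mono (fun y => ?_) h
  have h1 := norm_sub_norm_le (a • y) (-p)
  rw [norm_neg, sub_neg_eq_add, norm_smul, Real.norm_of_nonneg ha.le, add_comm (a • y)] at h1
  exact h1

theorem IsCompetitor.comp_affine {v : Rn n → ℝ} (h : IsCompetitor S v) (p : Rn n) (ha : 0 < a) :
    IsCompetitor ((fun y => p + a • y) ⁻¹' S) fun y => v (p + a • y) :=
  ⟨h.superharmonic.comp_affine p ha, fun _ hx => h.one_le _ hx,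
    h.tendsto_zero.comp (tendsto_affine_cobounded p ha)⟩

theorem potential_preimage_affine_le (hS : S ⊆ Metric.ball 0 M) (p : Rn n) (ha : 0 < a) (y : Rn n) :
    potential ((fun y => p + a • y) ⁻¹' S) y ≤ potential S (p + a • y) :=
  le_potential hS fun _ hv => potential_le (hv.comp_affine p ha) y

theorem memLp_comp_affine {E : Type*} [NormedAddCommGroup E] {f : Rn n → E} (hf : MemLp f 2 volume)
    (p : Rn n) (ha : 0 < a) : MemLp (fun y => f (p + a • y)) 2 volume := by
  have h : MemLp f 2 (Measure.map (affineHomeo p ha) volume) := by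
    rw [map_affineHomeo]
    exact hf.smul_measure ENNReal.ofReal_ne_top
  exact (affineHomeo p ha).isClosedEmbedding.measurableEmbedding.memLp_map_measure_iff.1 h

theorem IsH1With.comp_affine {u : Rn n → ℝ} {G : Rn n → Rn n} (h : IsH1With u G) (p : Rn n)
    (ha : 0 < a) : IsH1With (fun y => u (p + a • y)) fun y => a • G (p + a • y) := by
  refine ⟨memLp_comp_affine h.memLp p ha, (memLp_comp_affine h.memLp_grad p ha).const_smul a,
    fun ψ hψ hψc e => ?_⟩
  let Ψ : Rn n → ℝ := fun z => ψ (-(a⁻¹ • p) + a⁻¹ • z)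
  have hai := inv_pos.2 ha
  have hΨ : ContDiff ℝ ∞ Ψ := hψ.comp (contDiff_const.add (contDiff_id.const_smul _))
  have hΨc : HasCompactSupport Ψ := hψc.comp_homeomorph (affineHomeo (-(a⁻¹ • p)) hai)
  have e1 : ∀ y, ψ y = Ψ (p + a • y) := fun y => by
    simp only [Ψ]
    congr 1
    rw [smul_add, smul_smul, inv_mul_cancel₀ ha.ne', one_smul]
    abel
  have e2 : ∀ y, fderiv ℝ ψ y e = a * fderiv ℝ Ψ (p + a • y) e := fun y => by
    have h1 : HasFDerivAt (fun y : Rn n => p + a • y) (a • ContinuousLinearMap.id ℝ (Rn n)) y :=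
      ((hasFDerivAt_id y).const_smul a).const_add p
    have h2 := (differentiable_of_smooth hΨ (p + a • y)).hasFDerivAt.comp y h1
    have h4 : ψ = Ψ ∘ fun y => p + a • y := funext e1
    rw [h4, h2.fderiv]
    simp
  have h1 := h.weakGrad Ψ hΨ hΨc e
  have e3 : ∫ y, u (p + a • y) * fderiv ℝ ψ y e = a * ∫ y, u (p + a • y) * fderiv ℝ Ψ (p + a • y) e := by
    rw [← integral_const_mul]
    exact integral_congr_ae (Eventually.of_forall fun y => by simp only [e2]; ring)
  have e4 : ∫ y, ψ y * inner ℝ (a • G (p + a • y)) e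
      = a * ∫ y, Ψ (p + a • y) * inner ℝ (G (p + a • y)) e := by
    rw [← integral_const_mul]
    exact integral_congr_ae (Eventually.of_forall fun y => by
      simp only [e1 y, real_inner_smul_left]; ring)
  rw [e3, e4, integral_comp_add_smul (fun x => u x * fderiv ℝ Ψ x e) p ha,
    integral_comp_add_smul (fun x => Ψ x * inner ℝ (G x) e) p ha, h1]
  ring

/-- Composition with the dilation multiplies the squared gradient by `a ^ 2` and volume by `(a ^
n)⁻¹`. Applying the inequality to the inverse dilation as well yields equality. -/
theorem cap_preimage_affine_le (hS : S ⊆ Metric.ball 0 M) (p : Rn n) (ha : 0 < a) :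
    cap ((fun y => p + a • y) ⁻¹' S) ≤ a ^ 2 * (a ^ n)⁻¹ * cap S := by
  have hk : 0 < a ^ 2 * (a ^ n)⁻¹ := by positivity
  rw [← div_le_iff₀' hk]
  refine le_csInf (cap_nonempty hS) ?_
  rintro _ ⟨u, G, h1, ⟨U, hU, hSU, h2⟩, h4, rfl⟩
  rw [div_le_iff₀' hk]
  refine (csInf_le (cap_bddBelow _) ⟨_, _, h1.comp_affine p ha,
    ⟨_, hU.preimage (affineHomeo p ha).continuous, preimage_mono hSU, fun _ hx => h2 _ hx⟩,
    h4.comp (tendsto_affine_cobounded p ha), rfl⟩).trans_eq ?_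
  rw [mul_assoc, ← integral_comp_add_smul (fun x => ‖G x‖ ^ 2) p ha, ← integral_const_mul]
  exact integral_congr_ae (Eventually.of_forall fun y => by
    simp only [norm_smul, mul_pow, Real.norm_eq_abs, sq_abs])

theorem fundSol_smul (ha : 0 < a) (x : Rn n) :
    fundSol n (a⁻¹ • x) = a ^ (n - 2) * fundSol n x := by
  simp only [fundSol, norm_smul, norm_inv, Real.norm_of_nonneg ha.le, mul_pow, inv_pow, one_div,
    mul_inv, inv_inv]
  ring

/-- The asymptotics at infinity for a set contained in a small ball. -/
theorem abs_potential_sub_le_of_scale {R δ : ℝ}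
    (h : ∀ S : Set (Rn n), S ⊆ Metric.ball 0 M → ∀ x, R ≤ ‖x‖ →
      |potential S x - cap S * fundSol n x| ≤ δ * fundSol n x)
    (ha : 0 < a) (hS : S ⊆ Metric.ball p (M * a)) {x : Rn n} (hx : R * a ≤ ‖x - p‖) :
    |potential S x - cap S * fundSol n (x - p)| ≤ δ * a ^ (n - 2) * fundSol n (x - p) := by
  have hai := inv_pos.2 ha
  have hS0 : S ⊆ Metric.ball 0 (M * a + ‖p‖) := hS.trans
    (Metric.ball_subset_ball' (by rw [dist_zero_right]))
  set S' := (fun y => p + a • y) ⁻¹' S with hS'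
  have hS'M : S' ⊆ Metric.ball 0 M := fun y hy => by
    have h1 := hS hy
    rw [mem_ball_iff_norm, add_sub_cancel_left, norm_smul, Real.norm_of_nonneg ha.le, mul_comm] at h1
    rw [mem_ball_zero_iff]
    exact lt_of_mul_lt_mul_right h1 ha.le
  have hback : (fun z : Rn n => -(a⁻¹ • p) + a⁻¹ • z) ⁻¹' S' = S := preimage_affine_inv ha p S
  have hxy : a⁻¹ • (x - p) = -(a⁻¹ • p) + a⁻¹ • x := by rw [smul_sub]; abel
  -- One inequality comes from the dilation, the other from its inverse, and likewise for the
  -- capacity below.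
  have hφ : potential S x = potential S' (a⁻¹ • (x - p)) := by
    refine le_antisymm ?_ ?_
    · have := potential_preimage_affine_le hS'M (-(a⁻¹ • p)) hai x
      rwa [hback, ← hxy] at this
    · have := potential_preimage_affine_le hS0 p ha (a⁻¹ • (x - p))
      rwa [hxy, comp_affine_inv ha, ← hxy] at this
  have hpow : a ^ n = a ^ 2 * a ^ (n - 2) := by
    rw [← pow_add]; congr 1; have := h3.out; omega
  have hcap : cap S = a ^ (n - 2) * cap S' := by
    have hk : 0 < a ^ (n - 2) := by positivity
    have h1 := cap_preimage_affine_le hS0 p ha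
    have h2 := cap_preimage_affine_le hS'M (-(a⁻¹ • p)) hai
    rw [hback] at h2
    have e1 : a ^ 2 * (a ^ n)⁻¹ = (a ^ (n - 2))⁻¹ := by rw [hpow]; field_simp
    have e2 : a⁻¹ ^ 2 * (a⁻¹ ^ n)⁻¹ = a ^ (n - 2) := by rw [inv_pow, inv_pow, hpow]; field_simp
    rw [e1, inv_mul_eq_div, le_div_iff₀' hk] at h1
    rw [e2] at h2
    exact le_antisymm h2 h1
  have h1 := h S' hS'M (a⁻¹ • (x - p)) (by
    rw [norm_smul, norm_inv, Real.norm_of_nonneg ha.le, inv_mul_eq_div, le_div_iff₀ ha]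
    exact hx)
  rw [fundSol_smul ha, ← hφ] at h1
  rw [hcap]
  calc _ = |potential S x - cap S' * (a ^ (n - 2) * fundSol n (x - p))| := by congr 1; ring
    _ ≤ _ := h1
    _ = _ := by ring

end scaling

theorem critRadius_eq_mul (ε r : ℝ) : critRadius n ε r = r * critRadius n ε 1 := by
  simp [critRadius]

theorem critRadius_one_pos {ε : ℝ} (hε : 0 < ε) : 0 < critRadius n ε 1 := by
  unfold critRadius
  positivity

theorem critRadius_one_pow {ε : ℝ} (hε : 0 < ε) : critRadius n ε 1 ^ (n - 2) = ε ^ n := by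
  have h := h3.out
  have h2 : ((n - 2 : ℕ) : ℝ) = (n : ℝ) - 2 := by rw [Nat.cast_sub (by omega)]; rfl
  have h4 : (n : ℝ) - 2 ≠ 0 := by
    have : (3 : ℝ) ≤ n := by exact_mod_cast h
    linarith
  rw [critRadius, one_mul, ← Real.rpow_natCast, ← Real.rpow_mul hε.le, h2, div_mul_cancel₀ _ h4,
    Real.rpow_natCast]

end CapPot

theorem mainTheorem3 (n : ℕ) (hn : 3 ≤ n) :
    -- the basic properties of the capacitary potential of a set contained in a ball
    (∀ (M : ℝ) (S : Set (CapPot.Rn n)), S ⊆ Metric.ball 0 M →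
      InnerProductSpace.HarmonicOnNhd (CapPot.potential S) (closure S)ᶜ ∧
      (∀ x ∈ S, CapPot.potential S x = 1) ∧
      Tendsto (CapPot.potential S) (Bornology.cobounded (CapPot.Rn n)) (𝓝 0)) ∧
    -- the asymptotics at infinity, with a radius that depends only on `δ` and `M` (and `n`)
    (∀ M δ : ℝ, 0 < δ → ∃ R : ℝ, 0 < R ∧
      (∀ S : Set (CapPot.Rn n), S ⊆ Metric.ball 0 M →
        ∀ x : CapPot.Rn n, R ≤ ‖x‖ →
          |CapPot.potential S x - CapPot.cap S * CapPot.fundSol n x|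
            ≤ δ * CapPot.fundSol n x) ∧
      -- the rescaled version, uniform in `ε`, `k` and `ω`
      (∀ (Ω : Type*) (S : ℝ → (Fin n → ℤ) → Ω → Set (CapPot.Rn n))
          (γ : (Fin n → ℤ) → Ω → ℝ) (ε : ℝ) (k : Fin n → ℤ) (ω : Ω), 0 < ε →
        S ε k ω ⊆ Metric.ball (CapPot.latticePt ε k) (CapPot.critRadius n ε M) →
        CapPot.cap (S ε k ω) = ε ^ n * γ k ω →
        ∀ x : CapPot.Rn n, CapPot.critRadius n ε R ≤ ‖x - CapPot.latticePt ε k‖ →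
          |CapPot.potential (S ε k ω) x
              - ε ^ n * γ k ω * CapPot.fundSol n (x - CapPot.latticePt ε k)|
            ≤ δ * ε ^ n * CapPot.fundSol n (x - CapPot.latticePt ε k))) := by
  have : Fact (3 ≤ n) := ⟨hn⟩
  refine ⟨fun M S hS => ⟨fun x hx => CapPot.harmonicAt_potential hS hx,
    fun x hx => CapPot.potential_eq_one hS hx, CapPot.tendsto_potential hS⟩, fun M δ hδ => ?_⟩
  obtain ⟨R, hR, h⟩ := CapPot.exists_radius_potential (n := n) M hδ
  refine ⟨R, hR, h, fun Ω S γ ε k ω hε hS hcap x hx => ?_⟩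
  -- The dilation factor is `critRadius n ε 1`, whose power `n - 2` is exactly `ε ^ n`; this turns
  -- the scaled error into `δ * ε ^ n`.
  rw [CapPot.critRadius_eq_mul] at hS hx
  have h1 := CapPot.abs_potential_sub_le_of_scale h (CapPot.critRadius_one_pos hε) hS hx
  rwa [CapPot.critRadius_one_pow hε, hcap] at h1
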